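/- **Conventions.** Let $M$ be an $n$-dimensional manifold, either real smooth or complex analytic; functions and tensors are smooth, respectively holomorphic, and constants lie in $\mathbf R$, respectively $\mathbf C$. Repeated indices are summed. *Contravariant metrics.* A contravariant metric is a symmetric bilinear form on $T^*M$, $g^{ij}=(dx^i,dx^j)$, that is invertible exactly on an open dense subset $M_0\subset M$. Its contravariant Levi-Civita connection is a collection of smooth functions $\Gamma^{ij}_k$, given on every coordinate patch, with $\Gamma^{ij}_k=-g^{is}\Gamma^j_{sk}$ on $M_0$, where $\Gamma^j_{sk}$ are the Christoffel symbols of $(g_{ij})=(g^{ij})^{-1}$. The metric is flat if around each point of $M_0$ there are $n$ functions with linearly independent differentials, each differential $\xi$ satisfying $g^{is}\partial_s\xi_j+\Gamma^{is}_j\xi_s=0$. Two contravariant metrics $(\,,)_1,(\,,)_2$ form a flat pencil if for every constant $\lambda$ the form $(\,,)_1-\lambda(\,,)_2$ is a flat contravariant metric whose contravariant Levi-Civita connection is $\Gamma_1{}^{ij}_k-\lambda\,\Gamma_2{}^{ij}_k$, where $\Gamma_1,\Gamma_2$ are the contravariant Levi-Civita connections of the two metrics. On an open set $U\subset M$ the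 pencil is quasihomogeneous of degree $d$, with the function $\tau$, if the vector fields $E^i=g_1^{is}\partial_s\tau$ and $e^i=g_2^{is}\partial_s\tau$ satisfy on $U$ $$[e,E]=e,\quad \mathcal L_E(\,,)_1=(d-1)(\,,)_1,\quad \mathcal L_e(\,,)_1=(\,,)_2,\quad \mathcal L_e(\,,)_2=0 .$$ *Frobenius manifolds.* A Frobenius manifold of charge $d$ is a manifold $M$ whose tangent spaces carry, smoothly in the point, a commutative associative multiplication with unity $e$ and a nondegenerate symmetric bilinear form $\langle\,,\rangle$ with $\langle u\cdot v,w\rangle=\langle u,v\cdot w\rangle$, together with a vector field $E$ (the Euler field), such that, with $\nabla$ the Levi-Civita connection of $\langle\,,\rangle$: the metric $\langle\,,\rangle$ is flat and $\nabla e=0$; $(\nabla_z c)(u,v,w)$ is symmetric in $u,v,w,z$, where $c(u,v,w)=\langle u\cdot v,w\rangle$; $\nabla\nabla E=0$; and, $c^\gamma_{\alpha\beta}$ being the structure constants of the multiplication, $\mathcal L_Ec^\gamma_{\alpha\beta}=c^\gamma_{\alpha\beta}$ and $\mathcal L_E\langle\,,\rangle=(2-d)\langle\,,\rangle$. Diagonalizability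 of $\nabla E$ is not assumed. Identify $TM$ and $T^*M$ by $\langle\,,\rangle$; this gives a multiplication and a bilinear form $\langle\,,\rangle$ on $T^*M$. The intersection form is $(\omega_1,\omega_2)=i_E(\omega_1\cdot\omega_2)$. **Theorem 1.1.** Let $M$ be a Frobenius manifold of charge $d$. 1. The contravariant metrics $(\,,)_1=(\,,)$ and $(\,,)_2=\langle\,,\rangle$ form a flat pencil on $M$. 2. In flat coordinates $t^1,\dots,t^n$ of $\langle\,,\rangle$, with $\eta_{\alpha\beta}=\langle\partial_\alpha,\partial_\beta\rangle$ and $(\eta^{\alpha\beta})=(\eta_{\alpha\beta})^{-1}$, the contravariant Levi-Civita connection of $(\,,)-\lambda\langle\,,\rangle$ is, for every $\lambda$, $$\Gamma^{\alpha\beta}_\gamma=c^{\alpha\epsilon}_\gamma R^\beta_\epsilon,\qquad c^{\alpha\beta}_\gamma=\eta^{\alpha\epsilon}c^\beta_{\epsilon\gamma},\qquad R^\alpha_\beta=\tfrac{d-1}{2}\delta^\alpha_\beta+(\nabla E)^\alpha_\beta,\quad (\nabla E)^\alpha_\beta=\nabla_\beta E^\alpha .$$ 3. Around every point there are flat coordinates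 with $e=\partial/\partial t^1$ (or $e=\partial/\partial t^o$ for any prescribed index $o$, and then $1$ is replaced by $o$ in what follows). On the domain of any such coordinates the pencil is quasihomogeneous of degree $d$ with $\tau=\eta_{1\alpha}t^\alpha$, and the gradients $g_1^{is}\partial_s\tau$ and $g_2^{is}\partial_s\tau$ are the Euler field $E$ and the unity field $e$. 4. Every smooth function $\tau$ on the whole of $M$ with $d\tau=\langle e,\cdot\rangle$ makes the pencil quasihomogeneous of degree $d$ on $M$, with the same gradients $E$ and $e$; and if $M$ is simply connected, there is a function $\tau$ on $M$ with which the pencil is quasihomogeneous of degree $d$ on $M$, with these gradients. -/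

import Mathlib

open scoped Manifold ContDiff

noncomputable section

/-- A chart with values in the coordinate space `𝕜ⁿ`. It is used only together with the hypothesis
`IsCoordinatePatch`. -/
abbrev CoordChart (𝕜 : Type*) [RCLike 𝕜] (n : ℕ) (M : Type*) [TopologicalSpace M] :=
  OpenPartialHomeomorph M (Fin n → 𝕜)

/-- The tangent space of an `n`-dimensional manifold over `𝕜` (real if `𝕜 = ℝ`, complex if
`𝕜 = ℂ`). -/
abbrev Tan (𝕜 : Type*) [RCLike 𝕜] (n : ℕ) {M : Type*} [TopologicalSpace M]
    [ChartedSpace (Fin n → 𝕜) M] (x : M) :=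
  TangentSpace 𝓘(𝕜, Fin n → 𝕜) x

/-- The cotangent space. -/
abbrev Cotan (𝕜 : Type*) [RCLike 𝕜] (n : ℕ) {M : Type*} [TopologicalSpace M]
    [ChartedSpace (Fin n → 𝕜) M] (x : M) :=
  Module.Dual 𝕜 (Tan 𝕜 n x)

instance finiteDimensional_tan (𝕜 : Type*) [RCLike 𝕜] (n : ℕ) {M : Type*} [TopologicalSpace M]
    [ChartedSpace (Fin n → 𝕜) M] (x : M) :
    FiniteDimensional 𝕜 (TangentSpace 𝓘(𝕜, Fin n → 𝕜) x) :=
  inferInstanceAs (FiniteDimensional 𝕜 (Fin n → 𝕜))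

/-- Vector fields (no smoothness). -/
abbrev VField (𝕜 : Type*) [RCLike 𝕜] (n : ℕ) (M : Type*) [TopologicalSpace M]
    [ChartedSpace (Fin n → 𝕜) M] :=
  ∀ x : M, Tan 𝕜 n x

/-- Fields of bilinear forms on the cotangent spaces (no smoothness). -/
abbrev ContraForm (𝕜 : Type*) [RCLike 𝕜] (n : ℕ) (M : Type*) [TopologicalSpace M]
    [ChartedSpace (Fin n → 𝕜) M] :=
  ∀ x : M, LinearMap.BilinForm 𝕜 (Cotan 𝕜 n x)

section Coordinates

variable {𝕜 : Type*} [RCLike 𝕜] {n : ℕ}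

/-- The partial derivative `∂_k f` at `y` on the coordinate space. -/
def pd (k : Fin n) (f : (Fin n → 𝕜) → 𝕜) (y : Fin n → 𝕜) : 𝕜 :=
  fderiv 𝕜 f y (Pi.single k 1)

/-- The Christoffel symbol `Γ^k_{ij}` of the Levi-Civita connection of the (covariant) metric with
matrix `h = (h_{ij})` in a coordinate space. -/
def christoffel (h : (Fin n → 𝕜) → Matrix (Fin n) (Fin n) 𝕜) (k i j : Fin n)
    (y : Fin n → 𝕜) : 𝕜 :=
  2⁻¹ * ∑ l, (h y)⁻¹ k l *
    (pd i (fun z => h z l j) y + pd j (fun z => h z i l) y - pd l (fun z => h z i j) y)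

end Coordinates

section Manifold

variable {𝕜 : Type*} [RCLike 𝕜] {n : ℕ} {M : Type*} [TopologicalSpace M]
  [ChartedSpace (Fin n → 𝕜) M]

/-- `φ` is a coordinate patch (local coordinate system) of the smooth manifold `M`. -/
def IsCoordinatePatch (φ : CoordChart 𝕜 n M) : Prop :=
  φ ∈ IsManifold.maximalAtlas 𝓘(𝕜, Fin n → 𝕜) ∞ M

/-- The differential `df` at `x` as a covector. -/
def dif (f : M → 𝕜) (x : M) : Cotan 𝕜 n x :=
  (mfderiv 𝓘(𝕜, Fin n → 𝕜) 𝓘(𝕜, 𝕜) f x).toLinearMap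

/-- The coordinate covector `dx^i` at the point of `φ.source` with coordinates `y`. -/
def coframe (φ : CoordChart 𝕜 n M) (i : Fin n) (y : Fin n → 𝕜) : Cotan 𝕜 n (φ.symm y) :=
  dif (fun z : M => φ z i) (φ.symm y)

/-- The coordinate vector `∂_i` at the point of `φ.source` with coordinates `y`. -/
def frame (φ : CoordChart 𝕜 n M) (i : Fin n) (y : Fin n → 𝕜) : Tan 𝕜 n (φ.symm y) :=
  mfderiv 𝓘(𝕜, Fin n → 𝕜) 𝓘(𝕜, Fin n → 𝕜) φ.symm y (Pi.single i (1 : 𝕜) : Fin n → 𝕜)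

/-- The component `X^i` of a vector field in the coordinates `φ`. -/
def vecComp (X : VField 𝕜 n M) (φ : CoordChart 𝕜 n M) (i : Fin n) (y : Fin n → 𝕜) : 𝕜 :=
  coframe φ i y (X (φ.symm y))

/-- The matrix `(g^{ij}) = ((dx^i, dx^j))` of a bilinear form on the cotangent bundle in the
coordinates `φ`. -/
def contraComp (g : ContraForm 𝕜 n M) (φ : CoordChart 𝕜 n M) (y : Fin n → 𝕜) :
    Matrix (Fin n) (Fin n) 𝕜 :=
  Matrix.of fun i j => g (φ.symm y) (coframe φ i y) (coframe φ j y)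

/-- The set `M₀` of points at which the bilinear form on the cotangent space is invertible. -/
def invertibleLocus (g : ContraForm 𝕜 n M) : Set M :=
  {x | (g x).Nondegenerate}

/-- A contravariant metric: a smooth field of symmetric bilinear forms on the cotangent spaces that
is invertible on an open dense subset. -/
structure IsContravariantMetric (g : ContraForm 𝕜 n M) : Prop where
  symm : ∀ x u v, g x u v = g x v u
  smooth : ∀ φ, IsCoordinatePatch φ → ∀ i j,
    ContDiffOn 𝕜 ∞ (fun y => contraComp g φ y i j) φ.target
  isOpen : IsOpen (invertibleLocus g)
  dense : Dense (invertibleLocus g)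

/-- `-g^{is} Γ^j_{sk}`, where `Γ^j_{sk}` are the Christoffel symbols of the metric with matrix
`(g_{ij}) = (g^{ij})⁻¹`; meaningful at points of `M₀`. -/
def contraChristoffel (g : ContraForm 𝕜 n M) (φ : CoordChart 𝕜 n M) (k i j : Fin n)
    (y : Fin n → 𝕜) : 𝕜 :=
  -∑ s, contraComp g φ y i s * christoffel (fun z => (contraComp g φ z)⁻¹) j s k y

/-- A collection of functions `Γ^{ij}_k`, given in every coordinate patch. The value for the indices
`φ k i j` is `Γ^{ij}_k` in the patch `φ`. -/
abbrev ContraConnection (𝕜 : Type*) [RCLike 𝕜] (n : ℕ) (M : Type*) [TopologicalSpace M] :=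
  CoordChart 𝕜 n M → Fin n → Fin n → Fin n → (Fin n → 𝕜) → 𝕜

/-- `Γ` is the contravariant Levi-Civita connection of `g`: its components are smooth on the whole
patch, and `Γ^{ij}_k = -g^{is} Γ^j_{sk}` on `M₀`. -/
structure IsContravariantLeviCivita (g : ContraForm 𝕜 n M) (Γ : ContraConnection 𝕜 n M) :
    Prop where
  smooth : ∀ φ, IsCoordinatePatch φ → ∀ k i j, ContDiffOn 𝕜 ∞ (Γ φ k i j) φ.target
  eq_on_locus : ∀ φ, IsCoordinatePatch φ → ∀ y ∈ φ.target, φ.symm y ∈ invertibleLocus g →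
    ∀ k i j, Γ φ k i j y = contraChristoffel g φ k i j y

/-- `f` is a flat coordinate of `g` on the open set `U ⊆ M₀`: `f` is smooth and `ξ = df` is
covariantly constant, `g^{is} ∂_s ξ_j + Γ^{is}_j ξ_s = 0` in all coordinate patches. -/
structure IsFlatCoordinateOn (g : ContraForm 𝕜 n M) (U : Set M) (f : M → 𝕜) : Prop where
  smooth : ContMDiffOn 𝓘(𝕜, Fin n → 𝕜) 𝓘(𝕜, 𝕜) ∞ f U
  const : ∀ φ, IsCoordinatePatch φ → ∀ y ∈ φ.target, φ.symm y ∈ U → ∀ i j,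
    ∑ s, contraComp g φ y i s * pd s (pd j (f ∘ φ.symm)) y
      + ∑ s, contraChristoffel g φ j i s y * pd s (f ∘ φ.symm) y = 0

/-- A contravariant metric is flat if on `M₀` there locally exist `n` independent flat
coordinates. -/
def IsFlatContra (g : ContraForm 𝕜 n M) : Prop :=
  ∀ x ∈ invertibleLocus g, ∃ U : Set M, IsOpen U ∧ x ∈ U ∧ U ⊆ invertibleLocus g ∧
    ∃ f : Fin n → M → 𝕜, (∀ a, IsFlatCoordinateOn g U (f a)) ∧
      ∀ z ∈ U, LinearIndependent 𝕜 (fun a => (dif (f a) z : Cotan 𝕜 n z))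

/-- The pencil `(,)₁ - lam (,)₂`. -/
def pencil (g₁ g₂ : ContraForm 𝕜 n M) (lam : 𝕜) : ContraForm 𝕜 n M :=
  fun x => g₁ x - lam • g₂ x

/-- Flat pencil of contravariant metrics. -/
def IsFlatPencil (g₁ g₂ : ContraForm 𝕜 n M) : Prop :=
  IsContravariantMetric g₁ ∧ IsContravariantMetric g₂ ∧
  (∀ lam : 𝕜, IsContravariantMetric (pencil g₁ g₂ lam)) ∧
  (∃ Γ₁ Γ₂ : ContraConnection 𝕜 n M,
    IsContravariantLeviCivita g₁ Γ₁ ∧ IsContravariantLeviCivita g₂ Γ₂ ∧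
    ∀ lam : 𝕜, IsContravariantLeviCivita (pencil g₁ g₂ lam)
      (fun φ k i j y => Γ₁ φ k i j y - lam * Γ₂ φ k i j y)) ∧
  (∀ lam : 𝕜, IsFlatContra (pencil g₁ g₂ lam))

/-- The component `(L_X g)^{ij}` of the Lie derivative of a bilinear form on the cotangent
bundle. -/
def lieContra (X : VField 𝕜 n M) (g : ContraForm 𝕜 n M) (φ : CoordChart 𝕜 n M) (i j : Fin n)
    (y : Fin n → 𝕜) : 𝕜 :=
  ∑ k, (vecComp X φ k y * pd k (fun z => contraComp g φ z i j) y
    - contraComp g φ y k j * pd k (vecComp X φ i) y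
    - contraComp g φ y i k * pd k (vecComp X φ j) y)

/-- On the open set `U` the function `τ`, with gradients `E = ∇₁τ` and `e = ∇₂τ`, makes the pair
`g₁, g₂` quasihomogeneous of degree `d`. -/
structure IsQuasihomogeneousWith (U : Set M) (g₁ g₂ : ContraForm 𝕜 n M) (d : 𝕜)
    (τ : M → 𝕜) (E e : VField 𝕜 n M) : Prop where
  smooth : ContMDiffOn 𝓘(𝕜, Fin n → 𝕜) 𝓘(𝕜, 𝕜) ∞ τ U
  grad₁ : ∀ x ∈ U, ∀ u : Cotan 𝕜 n x, u (E x) = g₁ x u (dif τ x)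
  grad₂ : ∀ x ∈ U, ∀ u : Cotan 𝕜 n x, u (e x) = g₂ x u (dif τ x)
  bracket : ∀ x ∈ U, VectorField.mlieBracket 𝓘(𝕜, Fin n → 𝕜) e E x = e x
  lie_E₁ : ∀ φ, IsCoordinatePatch φ → ∀ y ∈ φ.target, φ.symm y ∈ U → ∀ i j,
    lieContra E g₁ φ i j y = (d - 1) * contraComp g₁ φ y i j
  lie_e₁ : ∀ φ, IsCoordinatePatch φ → ∀ y ∈ φ.target, φ.symm y ∈ U → ∀ i j,
    lieContra e g₁ φ i j y = contraComp g₂ φ y i j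
  lie_e₂ : ∀ φ, IsCoordinatePatch φ → ∀ y ∈ φ.target, φ.symm y ∈ U → ∀ i j,
    lieContra e g₂ φ i j y = 0

end Manifold

/-- The data of a Frobenius structure: on every tangent space a bilinear multiplication, a vector
(the unity), a bilinear form; the Euler vector field; the charge `d`. -/
structure FrobeniusData (𝕜 : Type*) [RCLike 𝕜] (n : ℕ) (M : Type*) [TopologicalSpace M]
    [ChartedSpace (Fin n → 𝕜) M] where
  mul : ∀ x : M, Tan 𝕜 n x →ₗ[𝕜] Tan 𝕜 n x →ₗ[𝕜] Tan 𝕜 n x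
  unit : VField 𝕜 n M
  η : ∀ x : M, LinearMap.BilinForm 𝕜 (Tan 𝕜 n x)
  euler : VField 𝕜 n M
  d : 𝕜

namespace FrobeniusData

variable {𝕜 : Type*} [RCLike 𝕜] {n : ℕ} {M : Type*} [TopologicalSpace M]
  [ChartedSpace (Fin n → 𝕜) M] (F : FrobeniusData 𝕜 n M) (φ : CoordChart 𝕜 n M)

/-- `η_{ij} = <∂_i, ∂_j>`. -/
def ηComp (y : Fin n → 𝕜) : Matrix (Fin n) (Fin n) 𝕜 :=
  Matrix.of fun i j => F.η (φ.symm y) (frame φ i y) (frame φ j y)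

/-- `c_{ij}^k`, where `∂_i · ∂_j = c_{ij}^k ∂_k`. -/
def mulComp (i j k : Fin n) (y : Fin n → 𝕜) : 𝕜 :=
  coframe φ k y (F.mul (φ.symm y) (frame φ i y) (frame φ j y))

/-- `c_{ijk} = c(∂_i, ∂_j, ∂_k) = <∂_i · ∂_j, ∂_k>`. -/
def cComp (i j k : Fin n) (y : Fin n → 𝕜) : 𝕜 :=
  F.η (φ.symm y) (F.mul (φ.symm y) (frame φ i y) (frame φ j y)) (frame φ k y)

/-- The Christoffel symbol `Γ^k_{ij}` of the Levi-Civita connection `∇` of `<,>`. -/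
def Γη (k i j : Fin n) (y : Fin n → 𝕜) : 𝕜 :=
  christoffel (F.ηComp φ) k i j y

/-- `(∇ X)^i_j = ∂_j X^i + Γ^i_{jm} X^m`. -/
def nablaVec (X : VField 𝕜 n M) (i j : Fin n) (y : Fin n → 𝕜) : 𝕜 :=
  pd j (vecComp X φ i) y + ∑ m, F.Γη φ i j m y * vecComp X φ m y

/-- `(∇∇X)^i_{kj} = ∇_k (∇X)^i_j`. -/
def nablaNablaVec (X : VField 𝕜 n M) (i k j : Fin n) (y : Fin n → 𝕜) : 𝕜 :=
  pd k (F.nablaVec φ X i j) y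
    + ∑ m, (F.Γη φ i k m y * F.nablaVec φ X m j y - F.Γη φ m k j y * F.nablaVec φ X i m y)

/-- `(∇_{∂_l} c)(∂_i, ∂_j, ∂_k)`. -/
def nablaC (l i j k : Fin n) (y : Fin n → 𝕜) : 𝕜 :=
  pd l (F.cComp φ i j k) y
    - ∑ m, (F.Γη φ m l i y * F.cComp φ m j k y + F.Γη φ m l j y * F.cComp φ i m k y
      + F.Γη φ m l k y * F.cComp φ i j m y)

/-- `(L_E c)_{ij}^k`. -/
def lieMul (i j k : Fin n) (y : Fin n → 𝕜) : 𝕜 :=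
  ∑ l, (vecComp F.euler φ l y * pd l (F.mulComp φ i j k) y
    - F.mulComp φ i j l y * pd l (vecComp F.euler φ k) y
    + F.mulComp φ l j k y * pd i (vecComp F.euler φ l) y
    + F.mulComp φ i l k y * pd j (vecComp F.euler φ l) y)

/-- `(L_E <,>)_{ij}`. -/
def lieη (i j : Fin n) (y : Fin n → 𝕜) : 𝕜 :=
  ∑ l, (vecComp F.euler φ l y * pd l (fun z => F.ηComp φ z i j) y
    + F.ηComp φ y l j * pd i (vecComp F.euler φ l) y
    + F.ηComp φ y i l * pd j (vecComp F.euler φ l) y)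

/-- Flat coordinates of `<,>`: a coordinate patch in which the matrix `η_{αβ}` is constant. -/
def IsFlatChart : Prop :=
  IsCoordinatePatch φ ∧ ∀ y ∈ φ.target, ∀ y' ∈ φ.target, F.ηComp φ y = F.ηComp φ y'

/-- Flat coordinates of `<,>` in which the unity is the coordinate vector field with index `o`
(usually `e = ∂/∂t¹`). -/
def IsNormalizedFlatChart (o : Fin n) : Prop :=
  F.IsFlatChart φ ∧ ∀ y ∈ φ.target, F.unit (φ.symm y) = frame φ o y

end FrobeniusData

/-- A Frobenius manifold of charge `d`. -/
structure FrobeniusManifold (𝕜 : Type*) [RCLike 𝕜] (n : ℕ) (M : Type*) [TopologicalSpace M]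
    [ChartedSpace (Fin n → 𝕜) M] extends FrobeniusData 𝕜 n M where
  -- the tangent spaces are Frobenius algebras
  mul_comm : ∀ x u v, mul x u v = mul x v u
  mul_assoc : ∀ x u v w, mul x (mul x u v) w = mul x u (mul x v w)
  one_mul : ∀ x u, mul x (unit x) u = u
  η_symm : ∀ x u v, η x u v = η x v u
  η_nondeg : ∀ x, (η x).Nondegenerate
  η_inv : ∀ x u v w, η x (mul x u v) w = η x u (mul x v w)
  -- smooth dependence on the point
  smooth_mul : ∀ φ, IsCoordinatePatch φ → ∀ i j k,
    ContDiffOn 𝕜 ∞ (toFrobeniusData.mulComp φ i j k) φ.target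
  smooth_η : ∀ φ, IsCoordinatePatch φ → ∀ i j,
    ContDiffOn 𝕜 ∞ (fun y => toFrobeniusData.ηComp φ y i j) φ.target
  smooth_unit : ∀ φ, IsCoordinatePatch φ → ∀ i, ContDiffOn 𝕜 ∞ (vecComp unit φ i) φ.target
  smooth_euler : ∀ φ, IsCoordinatePatch φ → ∀ i, ContDiffOn 𝕜 ∞ (vecComp euler φ i) φ.target
  /-- the metric is flat -/
  flat : ∀ x : M, ∃ φ, toFrobeniusData.IsFlatChart φ ∧ x ∈ φ.source
  /-- `∇ e = 0` -/
  nabla_unit : ∀ φ, IsCoordinatePatch φ → ∀ y ∈ φ.target, ∀ i j,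
    toFrobeniusData.nablaVec φ unit i j y = 0
  /-- `(∇_z c)(u, v, w)` is symmetric in its four arguments (the symmetry in `u, v, w` is
  automatic) -/
  nabla_c_symm : ∀ φ, IsCoordinatePatch φ → ∀ y ∈ φ.target, ∀ l i j k,
    toFrobeniusData.nablaC φ l i j k y = toFrobeniusData.nablaC φ i l j k y
  /-- `∇∇E = 0` -/
  nabla_nabla_euler : ∀ φ, IsCoordinatePatch φ → ∀ y ∈ φ.target, ∀ i k j,
    toFrobeniusData.nablaNablaVec φ euler i k j y = 0
  /-- `L_E c = c`, that is, `Q(ab) = Q(a)b + aQ(b)` for `Q = id + ad_E` -/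
  lie_mul : ∀ φ, IsCoordinatePatch φ → ∀ y ∈ φ.target, ∀ i j k,
    toFrobeniusData.lieMul φ i j k y = toFrobeniusData.mulComp φ i j k y
  /-- `L_E <,> = (2 - d) <,>`, that is, `E<a,b> + d<a,b> = <Q(a),b> + <a,Q(b)>` -/
  lie_η : ∀ φ, IsCoordinatePatch φ → ∀ y ∈ φ.target, ∀ i j,
    toFrobeniusData.lieη φ i j y = (2 - d) * toFrobeniusData.ηComp φ y i j

namespace FrobeniusManifold

variable {𝕜 : Type*} [RCLike 𝕜] {n : ℕ} {M : Type*} [TopologicalSpace M]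
  [ChartedSpace (Fin n → 𝕜) M] (F : FrobeniusManifold 𝕜 n M)

/-- The isomorphism of the tangent and cotangent spaces given by `<,>`. -/
def flatIso (x : M) : Tan 𝕜 n x ≃ₗ[𝕜] Cotan 𝕜 n x :=
  LinearMap.BilinForm.toDual (F.η x) (F.η_nondeg x)

/-- The multiplication of covectors, dual to the multiplication of vectors by means of `<,>`. -/
def cotMul (x : M) (u v : Cotan 𝕜 n x) : Cotan 𝕜 n x :=
  F.flatIso x (F.mul x ((F.flatIso x).symm u) ((F.flatIso x).symm v))

/-- The bilinear form `<,>` on the cotangent bundle. -/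
def cotMetric : ContraForm 𝕜 n M := fun x =>
  LinearMap.mk₂ 𝕜 (fun u v => F.η x ((F.flatIso x).symm u) ((F.flatIso x).symm v))
    (by intro u u' v; simp) (by intro a u v; simp) (by intro u v v'; simp) (by intro a u v; simp)

/-- The intersection form `(ω₁, ω₂) = i_E (ω₁ · ω₂)`. -/
def intersectionForm : ContraForm 𝕜 n M := fun x =>
  LinearMap.mk₂ 𝕜 (fun u v => F.cotMul x u v (F.euler x))
    (by intro u u' v; simp [cotMul]) (by intro a u v; simp [cotMul])
    (by intro u v v'; simp [cotMul]) (by intro a u v; simp [cotMul])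

/-- `c^{αβ}_γ = η^{αε} c_{εγ}^β`. -/
def cUp (φ : CoordChart 𝕜 n M) (α β γ : Fin n) (y : Fin n → 𝕜) : 𝕜 :=
  ∑ ε, (F.ηComp φ y)⁻¹ α ε * F.mulComp φ ε γ β y

/-- `R^α_β = (d - 1)/2 δ^α_β + (∇E)^α_β`. -/
def R (φ : CoordChart 𝕜 n M) (α β : Fin n) (y : Fin n → 𝕜) : 𝕜 :=
  (F.d - 1) / 2 * (if α = β then 1 else 0) + F.nablaVec φ F.euler α β y

end FrobeniusManifold

end

/-!
Near any point choose flat coordinates of `<,>` and identify tangent and cotangent spaces by `<,>`.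
The pencil `(,) - λ <,>` is then the bilinear form `<U u, v>`, where `U` is multiplication by
`E - λ` (`pencilOp`), and everything follows from the derivative of `U` in flat coordinates,
`(∂_w U) a = w·a + R(w·a) - w·R a`, where `R = (d - 1)/2 + ∇E` is constant and `R + R^* = 1`
(`fderiv_pencilOp`, `ηLoc_rOp`). This formula is `L_E c = c` combined with the symmetry of `∇c`, and
the adjoint of `R` is computed by `L_E <,> = (2 - d) <,>`.

* The derivative of `U` along the unity `e` is the identity, so moving by `t e` replaces `λ` by
  `λ - t`; since `U` fails to be invertible only for the eigenvalues `λ` of multiplication by `E`,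
  the pencil is invertible on a dense set (`dense_invertibleLocus_metricPencil`).
* The Koszul formula gives the Levi-Civita connection of the pencil where it is invertible,
  `Γ(U a, v) = -R(a·v)` (`christoffelVec_metricPencil`). Raising an index gives
  `Γ^{αβ}_γ = c^{αε}_γ R^β_ε`, independent of `λ` and smooth everywhere. In other coordinates the
  transformation law adds a term that is linear in the contravariant metric, hence affine in `λ`, so
  the Christoffel symbols extend smoothly and compatibly (`exists_smooth_contraChristoffel`).
* The gradients `x` of flat coordinates of the pencil solve the linear system
  `∂_u x = -u·U⁻¹(1 - R) x`. It is completely integrable because `∂c` is symmetric and `U` commutes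
  with multiplications (`gaussManin_integrable`). Its solutions are closed `1`-forms, and their
  primitives are the required `n` independent flat coordinates (`exists_flat_functions`). Both the
  Frobenius theorem for linear systems and the Poincaré lemma come from the homotopy operator on a
  ball (`exists_hasFDerivAt_eq_apply`, `exists_primitive_of_symm`).
* If `dτ = <e, ·>`, the gradients of `τ` are `E` and `e`, and the Lie derivatives in question are
  computed from those of `c` and `<,>` along `E` and `e` (`isQuasihomogeneousWith`). Locally
  `τ = <e, t>`; on a simply connected manifold the local functions `τ` are glued by means of a
  section of the covering space formed by their additive constants (`exists_dif_eq_unit`).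
-/

noncomputable section

open Set Filter Topology

/-! ### Integration of `1`-forms along rays -/

section RadialPrimitive

open Metric

variable {𝕜 : Type*} [RCLike 𝕜] {V : Type*} [NormedAddCommGroup V] [NormedSpace 𝕜 V]
  {W : Type*} [NormedAddCommGroup W] [NormedSpace ℝ W]

/-- The integral over `[0, 1]` of a family that is continuous on `ball 0 r × [0, 1]` depends
continuously on the parameter. -/
theorem continuousOn_integral_unitInterval {r : ℝ} {F : V → ℝ → W}
    (hF : ContinuousOn (Function.uncurry F) (ball 0 r ×ˢ Icc 0 1)) :
    ContinuousOn (fun y => ∫ t in (0 : ℝ)..1, F y t) (ball 0 r) := by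
  rw [continuousOn_iff_continuous_domRestrict]
  have hc : Continuous (Function.uncurry fun (y : ball (0 : V) r) (t : ℝ) =>
      F y (max 0 (min 1 t))) := by
    have : Continuous fun p : ball (0 : V) r × ℝ => ((p.1 : V), max 0 (min 1 p.2)) := by fun_prop
    exact hF.comp_continuous this fun p => ⟨p.1.2, by simp⟩
  refine (intervalIntegral.continuous_parametric_intervalIntegral_of_continuous'
    (μ := MeasureTheory.volume) hc 0 1).congr fun y => ?_
  refine intervalIntegral.integral_congr fun t ht => ?_
  rw [uIcc_of_le zero_le_one] at ht
  simp [ht.1, ht.2]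

variable [NormedSpace 𝕜 W]

/-- The primitive `y ↦ ∫₀¹ α(ty)(y) dt` of the `1`-form `α` along the rays from the origin. -/
def radialPrimitive (α : V → V →L[𝕜] W) (y : V) : W :=
  ∫ t in (0 : ℝ)..1, α ((t : 𝕜) • y) y

/-- `∫₀¹ t (α'(ty)(v)(y) - α'(ty)(y)(v)) dt`, the homotopy operator applied to the exterior derivative
of a `1`-form whose derivative is `α'`. -/
def radialCurl (α' : V → V →L[𝕜] V →L[𝕜] W) (y : V) : V →L[𝕜] W :=
  ∫ t in (0 : ℝ)..1, (t : 𝕜) • ((α' ((t : 𝕜) • y)).flip y - α' ((t : 𝕜) • y) y)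

theorem smul_mem_ball_of_mem_Icc {r t : ℝ} {y : V} (hy : y ∈ ball (0 : V) r)
    (ht : t ∈ Icc (0 : ℝ) 1) : (t : 𝕜) • y ∈ ball (0 : V) r := by
  rw [mem_ball_zero_iff] at hy ⊢
  rw [norm_smul, RCLike.norm_ofReal, abs_of_nonneg ht.1]
  exact (mul_le_of_le_one_left (norm_nonneg _) ht.2).trans_lt hy

theorem continuousOn_smul_uncurry {X : Type*} [TopologicalSpace X] {r : ℝ} {f : V → X}
    (hf : ContinuousOn f (ball 0 r)) :
    ContinuousOn (fun p : V × ℝ => f ((p.2 : 𝕜) • p.1)) (ball 0 r ×ˢ Icc 0 1) := by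
  refine hf.comp (Continuous.continuousOn ?_) fun p hp => smul_mem_ball_of_mem_Icc hp.1 hp.2
  exact (RCLike.continuous_ofReal.comp continuous_snd).smul continuous_fst

theorem continuousOn_radialCurl {r : ℝ} {α' : V → V →L[𝕜] V →L[𝕜] W}
    (hα' : ContinuousOn α' (ball 0 r)) : ContinuousOn (radialCurl α') (ball 0 r) := by
  apply continuousOn_integral_unitInterval
  have h := continuousOn_smul_uncurry (𝕜 := 𝕜) hα'
  have h1 : Continuous fun L : V →L[𝕜] V →L[𝕜] W => L.flip :=
    (ContinuousLinearMap.flipₗᵢ 𝕜 V V W).continuous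
  have h2 := h1.comp_continuousOn h
  have h3 : ContinuousOn (fun p : V × ℝ => (p.2 : 𝕜)) (ball 0 r ×ˢ Icc 0 1) :=
    (RCLike.continuous_ofReal.comp continuous_snd).continuousOn
  exact h3.smul ((h2.clm_apply continuousOn_fst).sub (h.clm_apply continuousOn_fst))

omit [NormedSpace ℝ W] in
theorem intervalIntegrable_slice {r : ℝ} {F : V → ℝ → W} {y : V} (hy : y ∈ ball (0 : V) r)
    (hF : ContinuousOn (Function.uncurry F) (ball 0 r ×ˢ Icc 0 1)) :
    IntervalIntegrable (F y) MeasureTheory.volume 0 1 := by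
  apply ContinuousOn.intervalIntegrable
  rw [uIcc_of_le zero_le_one]
  have h : ContinuousOn (fun t : ℝ => (y, t)) (Icc 0 1) := by fun_prop
  exact hF.comp h fun t ht => ⟨hy, ht⟩

/-- `d/dt (t α(ty)) = α(ty) + t α'(ty)(y)`. -/
theorem hasDerivAt_smul_comp_smul [IsScalarTower ℝ 𝕜 W] {β : V → W} {β' : V →L[𝕜] W} {t : ℝ}
    {y : V} (h : HasFDerivAt β β' ((t : 𝕜) • y)) :
    HasDerivAt (fun t : ℝ => (t : 𝕜) • β ((t : 𝕜) • y)) (β ((t : 𝕜) • y) + (t : 𝕜) • β' y) t := by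
  have e2 : HasDerivAt (fun t : 𝕜 => t • y) y (t : 𝕜) := by
    simpa using (hasDerivAt_id (t : 𝕜)).smul_const y
  have e3 : HasDerivAt (fun t : 𝕜 => β (t • y)) (β' y) (t : 𝕜) := h.comp_hasDerivAt (t : 𝕜) e2
  have h1 : HasDerivAt (fun s : ℝ => (s : 𝕜)) 1 t := by
    simpa using (RCLike.ofRealCLM (K := 𝕜)).hasDerivAt (x := t)
  have e1 := (hasDerivAt_id (t : 𝕜)).smul e3
  have e4 := e1.scomp_of_eq (𝕜 := ℝ) (h := fun s : ℝ => (s : 𝕜)) t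
    (h' := (1 : 𝕜)) h1 rfl
  refine e4.congr_deriv ?_
  rw [one_smul, one_smul, add_comm]
  rfl

variable [ProperSpace V] [CompleteSpace W] [IsScalarTower ℝ 𝕜 W]

/-- The homotopy formula for `1`-forms on a ball. -/
theorem hasFDerivAt_radialPrimitive {r : ℝ} {α : V → V →L[𝕜] W} {α' : V → V →L[𝕜] V →L[𝕜] W}
    (hα : ∀ y ∈ ball (0 : V) r, HasFDerivAt α (α' y) y) (hα' : ContinuousOn α' (ball 0 r))
    {y : V} (hy : y ∈ ball (0 : V) r) :
    HasFDerivAt (radialPrimitive α) (α y + radialCurl α' y) y := by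
  have hαc : ContinuousOn α (ball 0 r) := fun z hz => (hα z hz).continuousAt.continuousWithinAt
  set F' : V → ℝ → V →L[𝕜] W := fun z t => (t : 𝕜) • (α' ((t : 𝕜) • z)).flip z + α ((t : 𝕜) • z)
    with hF'
  have h := continuousOn_smul_uncurry (𝕜 := 𝕜) hα'
  have h0 := continuousOn_smul_uncurry (𝕜 := 𝕜) hαc
  have h1 : Continuous fun L : V →L[𝕜] V →L[𝕜] W => L.flip :=
    (ContinuousLinearMap.flipₗᵢ 𝕜 V V W).continuous
  have h3 : ContinuousOn (fun p : V × ℝ => (p.2 : 𝕜)) (ball 0 r ×ˢ Icc 0 1) :=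
    (RCLike.continuous_ofReal.comp continuous_snd).continuousOn
  have hF'c : ContinuousOn (Function.uncurry F') (ball 0 r ×ˢ Icc 0 1) :=
    (h3.smul ((h1.comp_continuousOn h).clm_apply continuousOn_fst)).add h0
  have hFc : ContinuousOn (fun p : V × ℝ => α ((p.2 : 𝕜) • p.1) p.1) (ball 0 r ×ˢ Icc 0 1) :=
    h0.clm_apply continuousOn_fst
  have hslice : ∀ z ∈ ball (0 : V) r, ContinuousOn (fun t : ℝ => (z, t)) (Icc 0 1) :=
    fun z _ => by fun_prop
  have hFt : ∀ z ∈ ball (0 : V) r, ContinuousOn (fun t : ℝ => α ((t : 𝕜) • z) z) (Icc 0 1) :=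
    fun z hz => hFc.comp (hslice z hz) fun t ht => ⟨hz, ht⟩
  have hF't : ContinuousOn (fun t : ℝ => F' y t) (Icc 0 1) :=
    hF'c.comp (hslice y hy) fun t ht => ⟨hy, ht⟩
  obtain ⟨s, hys, hsr⟩ := exists_between (mem_ball_zero_iff.1 hy)
  have hsub : closedBall (0 : V) s ⊆ ball 0 r := closedBall_subset_ball hsr
  obtain ⟨K, hK⟩ := ((isCompact_closedBall (0 : V) s).prod
    (isCompact_Icc (a := (0 : ℝ)) (b := 1))).exists_bound_of_continuousOn
    (hF'c.mono (prod_mono_left hsub))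
  have key : HasFDerivAt (radialPrimitive α) (∫ t in (0 : ℝ)..1, F' y t) y := by
    refine intervalIntegral.hasFDerivAt_integral_of_dominated_of_fderiv_le (bound := fun _ => K)
      (F' := F') (s := ball 0 s) (isOpen_ball.mem_nhds (mem_ball_zero_iff.2 hys)) ?_ ?_ ?_ ?_
      (by simp) ?_
    · filter_upwards [isOpen_ball.mem_nhds hy] with z hz
      rw [uIoc_of_le zero_le_one]
      exact ((hFt z hz).mono Ioc_subset_Icc_self).aestronglyMeasurable measurableSet_Ioc
    · exact ContinuousOn.intervalIntegrable (by rw [uIcc_of_le zero_le_one]; exact hFt y hy)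
    · rw [uIoc_of_le zero_le_one]
      exact (hF't.mono Ioc_subset_Icc_self).aestronglyMeasurable measurableSet_Ioc
    · refine Eventually.of_forall fun t ht z hz => ?_
      rw [uIoc_of_le zero_le_one] at ht
      exact hK (z, t) ⟨ball_subset_closedBall hz, Ioc_subset_Icc_self ht⟩
    · refine Eventually.of_forall fun t ht z hz => ?_
      rw [uIoc_of_le zero_le_one] at ht
      have hz' := smul_mem_ball_of_mem_Icc (𝕜 := 𝕜) (hsub (ball_subset_closedBall hz))
        (Ioc_subset_Icc_self ht)
      have hd : HasFDerivAt (fun x : V => α ((t : 𝕜) • x))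
          ((α' ((t : 𝕜) • z)).comp ((t : 𝕜) • ContinuousLinearMap.id 𝕜 V)) z :=
        (hα _ hz').comp z ((hasFDerivAt_id z).const_smul (t : 𝕜))
      refine (hd.clm_apply (hasFDerivAt_id z)).congr_fderiv ?_
      ext v
      simp [hF', add_comm]
  have hi1 := intervalIntegrable_slice hy
    (F := fun y t => α ((t : 𝕜) • y) + (t : 𝕜) • α' ((t : 𝕜) • y) y)
    (h0.add (h3.smul (h.clm_apply continuousOn_fst)))
  have hi2 := intervalIntegrable_slice hy
    (F := fun y t => (t : 𝕜) • ((α' ((t : 𝕜) • y)).flip y - α' ((t : 𝕜) • y) y))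
    (h3.smul (((h1.comp_continuousOn h).clm_apply continuousOn_fst).sub
      (h.clm_apply continuousOn_fst)))
  -- `α y = ∫₀¹ d/dt (t α(ty)) dt`
  have ftc : ∫ t in (0 : ℝ)..1, (α ((t : 𝕜) • y) + (t : 𝕜) • α' ((t : 𝕜) • y) y) = α y := by
    rw [intervalIntegral.integral_eq_sub_of_hasDerivAt
      (f := fun t : ℝ => (t : 𝕜) • α ((t : 𝕜) • y))
      (fun t ht => hasDerivAt_smul_comp_smul (hα _ (smul_mem_ball_of_mem_Icc hy
        (by rwa [uIcc_of_le zero_le_one] at ht)))) hi1]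
    rw [RCLike.ofReal_one, RCLike.ofReal_zero, one_smul, one_smul, zero_smul, sub_zero]
  have hsum : ∫ t in (0 : ℝ)..1, F' y t = α y + radialCurl α' y := by
    have e := intervalIntegral.integral_add hi1 hi2
    rw [ftc] at e
    refine Eq.trans (intervalIntegral.integral_congr fun t _ => ?_) e
    simp only [hF', smul_sub]
    abel
  exact hsum ▸ key

omit [ProperSpace V] [CompleteSpace W] [IsScalarTower ℝ 𝕜 W] in
theorem norm_radialPrimitive_le {r K : ℝ} {α : V → V →L[𝕜] W} {y : V} (hy : y ∈ ball (0 : V) r)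
    (h : ∀ z ∈ ball (0 : V) r, ‖α z‖ ≤ K) : ‖radialPrimitive α y‖ ≤ K * r := by
  have hK : 0 ≤ K := (norm_nonneg _).trans (h y hy)
  have := intervalIntegral.norm_integral_le_of_norm_le_const (a := 0) (b := 1) (C := K * r)
    (f := fun t : ℝ => α ((t : 𝕜) • y) y) fun t ht => by
      rw [uIoc_of_le zero_le_one] at ht
      refine (ContinuousLinearMap.le_opNorm _ _).trans ?_
      exact mul_le_mul (h _ (smul_mem_ball_of_mem_Icc hy (Ioc_subset_Icc_self ht)))
        (mem_ball_zero_iff.1 hy).le (norm_nonneg _) hK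
  simpa [radialPrimitive] using this

end RadialPrimitive

/-! ### Completely integrable linear systems and the Poincaré lemma -/

section Pfaffian

open Metric

variable {𝕜 : Type*} [RCLike 𝕜] {V : Type*} [NormedAddCommGroup V] [NormedSpace 𝕜 V]
  {W : Type*} [NormedAddCommGroup W] [NormedSpace ℝ W] [NormedSpace 𝕜 W]

theorem norm_radialCurl_le {r K : ℝ} {α' : V → V →L[𝕜] V →L[𝕜] W} {y : V}
    (hy : y ∈ ball (0 : V) r) (hK : 0 ≤ K)
    (h : ∀ z ∈ ball (0 : V) r, ∀ v, ‖α' z v y - α' z y v‖ ≤ K * ‖v‖) :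
    ‖radialCurl α' y‖ ≤ K := by
  have := intervalIntegral.norm_integral_le_of_norm_le_const (a := 0) (b := 1) (C := K)
    (f := fun t : ℝ => (t : 𝕜) • ((α' ((t : 𝕜) • y)).flip y - α' ((t : 𝕜) • y) y)) fun t ht => by
      rw [uIoc_of_le zero_le_one] at ht
      have h1 : ‖(α' ((t : 𝕜) • y)).flip y - α' ((t : 𝕜) • y) y‖ ≤ K :=
        ContinuousLinearMap.opNorm_le_bound _ hK fun v =>
          h _ (smul_mem_ball_of_mem_Icc hy (Ioc_subset_Icc_self ht)) v
      rw [norm_smul, RCLike.norm_ofReal, abs_of_nonneg ht.1.le]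
      exact (mul_le_of_le_one_left (norm_nonneg _) ht.2).trans h1
  simpa [radialCurl] using this

theorem radialPrimitive_sub {r : ℝ} {α β : V → V →L[𝕜] W} {y : V} (hy : y ∈ ball (0 : V) r)
    (hα : ContinuousOn α (ball 0 r)) (hβ : ContinuousOn β (ball 0 r)) :
    radialPrimitive (fun z => α z - β z) y = radialPrimitive α y - radialPrimitive β y := by
  have hi : ∀ γ : V → V →L[𝕜] W, ContinuousOn γ (ball 0 r) → IntervalIntegrable
      (fun t : ℝ => γ ((t : 𝕜) • y) y) MeasureTheory.volume 0 1 := fun γ hγ =>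
    intervalIntegrable_slice hy (F := fun y t => γ ((t : 𝕜) • y) y)
      ((continuousOn_smul_uncurry hγ).clm_apply continuousOn_fst)
  exact intervalIntegral.integral_sub (hi α hα) (hi β hβ)

/-- Picard iterates for `dψ = B ψ`, `ψ(0) = w`. -/
def pfaffIter (B : V → W →L[𝕜] V →L[𝕜] W) (w : W) : ℕ → V → W
  | 0 => fun _ => w
  | k + 1 => fun y => w + radialPrimitive (fun z => B z (pfaffIter B w k z)) y

/-- The derivatives of the Picard iterates. -/
def pfaffIterDeriv (B : V → W →L[𝕜] V →L[𝕜] W) (B' : V → V →L[𝕜] W →L[𝕜] V →L[𝕜] W) (w : W) :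
    ℕ → V → V →L[𝕜] W
  | 0 => fun _ => 0
  | k + 1 => fun y => B y (pfaffIter B w k y) + radialCurl
      (fun z => (B z).comp (pfaffIterDeriv B B' w k z) + (B' z).flip (pfaffIter B w k z)) y

variable {B : V → W →L[𝕜] V →L[𝕜] W} {B' : V → V →L[𝕜] W →L[𝕜] V →L[𝕜] W} {w : W} {r : ℝ}

section

variable [ProperSpace V] [CompleteSpace W] [IsScalarTower ℝ 𝕜 W]

theorem pfaffIter_hasFDerivAt (hB : ∀ y ∈ ball (0 : V) r, HasFDerivAt B (B' y) y)
    (hB' : ContinuousOn B' (ball 0 r)) (k : ℕ) :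
    (∀ y ∈ ball (0 : V) r, HasFDerivAt (pfaffIter B w k) (pfaffIterDeriv B B' w k y) y) ∧
      ContinuousOn (pfaffIterDeriv B B' w k) (ball 0 r) := by
  induction k with
  | zero => exact ⟨fun y _ => hasFDerivAt_const _ _, continuousOn_const⟩
  | succ k ih =>
    obtain ⟨ih1, ih2⟩ := ih
    have hBc : ContinuousOn B (ball 0 r) := fun z hz => (hB z hz).continuousAt.continuousWithinAt
    have hψc : ContinuousOn (pfaffIter B w k) (ball 0 r) :=
      fun z hz => (ih1 z hz).continuousAt.continuousWithinAt
    have hd : ∀ y ∈ ball (0 : V) r, HasFDerivAt (fun z => B z (pfaffIter B w k z))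
        ((B y).comp (pfaffIterDeriv B B' w k y) + (B' y).flip (pfaffIter B w k y)) y :=
      fun y hy => (hB y hy).clm_apply (ih1 y hy)
    have hflip : Continuous fun L : V →L[𝕜] W →L[𝕜] V →L[𝕜] W => L.flip :=
      (ContinuousLinearMap.flipₗᵢ 𝕜 V W (V →L[𝕜] W)).continuous
    have hc : ContinuousOn (fun y => (B y).comp (pfaffIterDeriv B B' w k y)
        + (B' y).flip (pfaffIter B w k y)) (ball 0 r) :=
      (hBc.clm_comp ih2).add ((hflip.comp_continuousOn hB').clm_apply hψc)
    exact ⟨fun y hy => (hasFDerivAt_radialPrimitive hd hc hy).const_add w,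
      (hBc.clm_apply hψc).add (continuousOn_radialCurl hc)⟩

/-- The defect `dψₖ - B ψₖ` of the `k`-th iterate obeys a contracting recursion because, by the
integrability condition, the exterior derivative of `B ψₖ` is `B` applied to the defect. -/
theorem pfaffIter_bounds (hB : ∀ y ∈ ball (0 : V) r, HasFDerivAt B (B' y) y)
    (hB' : ContinuousOn B' (ball 0 r)) {K : ℝ} (hK : 0 ≤ K) (hr : K * r ≤ 1 / 8) (hr0 : 0 ≤ r)
    (hBK : ∀ y ∈ ball (0 : V) r, ‖B y‖ ≤ K)
    (hint : ∀ y ∈ ball (0 : V) r, ∀ u v w,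
      B' y u w v + B y (B y w u) v = B' y v w u + B y (B y w v) u) (k : ℕ) :
    (∀ y ∈ ball (0 : V) r,
        ‖pfaffIter B w (k + 1) y - pfaffIter B w k y‖ ≤ ‖w‖ * (1 / 4) ^ k) ∧
      ∀ y ∈ ball (0 : V) r,
        ‖pfaffIterDeriv B B' w k y - B y (pfaffIter B w k y)‖ ≤ 4 * K * ‖w‖ * (1 / 2) ^ k := by
  have hBc : ContinuousOn B (ball 0 r) := fun z hz => (hB z hz).continuousAt.continuousWithinAt
  have hψc : ∀ k, ContinuousOn (fun z => B z (pfaffIter B w k z)) (ball 0 r) := fun k =>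
    hBc.clm_apply fun z hz =>
      ((pfaffIter_hasFDerivAt hB hB' k).1 z hz).continuousAt.continuousWithinAt
  induction k with
  | zero =>
    refine ⟨fun y hy => ?_, fun y hy => ?_⟩
    · have h : ‖radialPrimitive (fun z => B z w) y‖ ≤ K * ‖w‖ * r :=
        norm_radialPrimitive_le hy fun z hz =>
          (ContinuousLinearMap.le_opNorm _ _).trans
            (mul_le_mul_of_nonneg_right (hBK z hz) (norm_nonneg _))
      have h2 : K * ‖w‖ * r ≤ ‖w‖ * (1 / 4) ^ 0 := by nlinarith [norm_nonneg w]
      simpa [pfaffIter] using h.trans h2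
    · have h : ‖B y w‖ ≤ K * ‖w‖ := (ContinuousLinearMap.le_opNorm _ _).trans
        (mul_le_mul_of_nonneg_right (hBK y hy) (norm_nonneg _))
      have h2 : K * ‖w‖ ≤ 4 * K * ‖w‖ * (1 / 2) ^ 0 := by nlinarith [mul_nonneg hK (norm_nonneg w)]
      simpa [pfaffIter, pfaffIterDeriv] using h.trans h2
  | succ k ih =>
    obtain ⟨ih1, ih2⟩ := ih
    refine ⟨fun y hy => ?_, fun y hy => ?_⟩
    · have e : pfaffIter B w (k + 1 + 1) y - pfaffIter B w (k + 1) y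
          = radialPrimitive (fun z => B z (pfaffIter B w (k + 1) z) - B z (pfaffIter B w k z)) y := by
        rw [radialPrimitive_sub hy (hψc (k + 1)) (hψc k)]
        exact add_sub_add_left_eq_sub _ _ _
      rw [e]
      have h : ‖radialPrimitive (fun z => B z (pfaffIter B w (k + 1) z)
          - B z (pfaffIter B w k z)) y‖ ≤ K * (‖w‖ * (1 / 4) ^ k) * r := by
        refine norm_radialPrimitive_le hy fun z hz => ?_
        rw [← map_sub]
        exact (ContinuousLinearMap.le_opNorm _ _).trans
          (mul_le_mul (hBK z hz) (ih1 z hz) (norm_nonneg _) hK)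
      refine h.trans ?_
      have h0 : 0 ≤ ‖w‖ * (1 / 4) ^ k := by positivity
      calc K * (‖w‖ * (1 / 4) ^ k) * r = (K * r) * (‖w‖ * (1 / 4) ^ k) := by ring
        _ ≤ 1 / 8 * (‖w‖ * (1 / 4) ^ k) := mul_le_mul_of_nonneg_right hr h0
        _ ≤ ‖w‖ * (1 / 4) ^ (k + 1) := by rw [pow_succ]; linarith
    · set D := fun z => pfaffIterDeriv B B' w k z - B z (pfaffIter B w k z) with hD
      have hcurl : ‖radialCurl (fun z => (B z).comp (pfaffIterDeriv B B' w k z)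
          + (B' z).flip (pfaffIter B w k z)) y‖ ≤ 2 * K * (4 * K * ‖w‖ * (1 / 2) ^ k) * r := by
        refine norm_radialCurl_le hy (by positivity) fun z hz v => ?_
        have e : ((B z).comp (pfaffIterDeriv B B' w k z) + (B' z).flip (pfaffIter B w k z)) v y
            - ((B z).comp (pfaffIterDeriv B B' w k z) + (B' z).flip (pfaffIter B w k z)) y v
            = B z (D z v) y - B z (D z y) v := by
          have := hint z hz v y (pfaffIter B w k z)
          simp only [hD, add_apply, ContinuousLinearMap.comp_apply,
            ContinuousLinearMap.flip_apply, sub_apply, map_sub]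
          rw [← sub_eq_zero] at this ⊢
          rw [← this]
          abel
        rw [e]
        have hy' := (mem_ball_zero_iff.1 hy).le
        have hb : ∀ a b, ‖B z (D z a) b‖ ≤ K * (4 * K * ‖w‖ * (1 / 2) ^ k * ‖a‖) * ‖b‖ := by
          intro a b
          refine (ContinuousLinearMap.le_opNorm _ _).trans (mul_le_mul_of_nonneg_right ?_
            (norm_nonneg _))
          refine (ContinuousLinearMap.le_opNorm _ _).trans (mul_le_mul (hBK z hz) ?_
            (norm_nonneg _) hK)
          exact (ContinuousLinearMap.le_opNorm _ _).trans
            (mul_le_mul_of_nonneg_right (ih2 z hz) (norm_nonneg _))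
        refine (norm_sub_le _ _).trans ((add_le_add (hb v y) (hb y v)).trans ?_)
        have hq : 0 ≤ K * (4 * K * ‖w‖ * (1 / 2) ^ k) * ‖v‖ := by positivity
        nlinarith [mul_le_mul_of_nonneg_left hy' hq]
      have e : pfaffIterDeriv B B' w (k + 1) y - B y (pfaffIter B w (k + 1) y)
          = -(B y (pfaffIter B w (k + 1) y - pfaffIter B w k y)) + radialCurl (fun z =>
            (B z).comp (pfaffIterDeriv B B' w k z) + (B' z).flip (pfaffIter B w k z)) y := by
        rw [map_sub, pfaffIterDeriv, neg_sub, add_sub_right_comm]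
      rw [e]
      have h1 : ‖B y (pfaffIter B w (k + 1) y - pfaffIter B w k y)‖ ≤ K * (‖w‖ * (1 / 4) ^ k) :=
        (ContinuousLinearMap.le_opNorm _ _).trans
          (mul_le_mul (hBK y hy) (ih1 y hy) (norm_nonneg _) hK)
      refine (norm_add_le _ _).trans ((add_le_add ((norm_neg _).trans_le h1) hcurl).trans ?_)
      have h2 : ((1 : ℝ) / 4) ^ k ≤ (1 / 2) ^ k := by gcongr; norm_num
      have h3 : 2 * K * (4 * K * ‖w‖ * (1 / 2) ^ k) * r ≤ K * ‖w‖ * (1 / 2) ^ k := by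
        have h0 : 0 ≤ 8 * (K * ‖w‖ * (1 / 2) ^ k) := by positivity
        calc 2 * K * (4 * K * ‖w‖ * (1 / 2) ^ k) * r
            = (K * r) * (8 * (K * ‖w‖ * (1 / 2) ^ k)) := by ring
          _ ≤ 1 / 8 * (8 * (K * ‖w‖ * (1 / 2) ^ k)) := mul_le_mul_of_nonneg_right hr h0
          _ = _ := by ring
      calc K * (‖w‖ * (1 / 4) ^ k) + 2 * K * (4 * K * ‖w‖ * (1 / 2) ^ k) * r
          ≤ K * (‖w‖ * (1 / 2) ^ k) + K * ‖w‖ * (1 / 2) ^ k := by gcongr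
        _ = 4 * K * ‖w‖ * (1 / 2) ^ (k + 1) := by rw [pow_succ]; ring

/-- **Frobenius integrability for linear systems.** A linear total differential equation
`dψ = B ψ` that satisfies the integrability condition near `y₀` has a local solution with any
prescribed value at `y₀`. -/
theorem exists_hasFDerivAt_eq_apply {y₀ : V} (hB : ContDiffAt 𝕜 1 B y₀)
    (hint : ∀ᶠ y in 𝓝 y₀, ∀ u v w, fderiv 𝕜 B y u w v + B y (B y w u) v
      = fderiv 𝕜 B y v w u + B y (B y w v) u) (w : W) :
    ∃ ψ : V → W, ψ y₀ = w ∧ ∀ᶠ y in 𝓝 y₀, HasFDerivAt ψ (B y (ψ y)) y := by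
  -- a ball around `y₀` on which everything holds and the iteration contracts
  obtain ⟨K, hK0, hK⟩ : ∃ K : ℝ, 0 < K ∧ ‖B y₀‖ < K :=
    ⟨‖B y₀‖ + 1, by positivity, by linarith⟩
  have hcont : ContinuousAt B y₀ := hB.continuousAt
  have hcontn : Tendsto (fun y => ‖B y‖) (𝓝 y₀) (𝓝 ‖B y₀‖) :=
    ((continuous_norm (E := W →L[𝕜] V →L[𝕜] W)).tendsto (B y₀)).comp hcont
  have hev1 : ∀ᶠ y in 𝓝 y₀, ‖B y‖ < K := hcontn.eventually_lt_const hK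
  have hev2 : ∀ᶠ y in 𝓝 y₀, ContDiffAt 𝕜 1 B y := hB.eventually (by simp)
  obtain ⟨r₁, hr₁, hball⟩ := Metric.eventually_nhds_iff_ball.1 (hev1.and (hev2.and hint))
  set r := min r₁ (1 / (8 * K)) with hrdef
  have hr : 0 < r := lt_min hr₁ (by positivity)
  have hKr : K * r ≤ 1 / 8 := by
    calc K * r ≤ K * (1 / (8 * K)) := by gcongr; exact min_le_right _ _
      _ = 1 / 8 := by field_simp
  have hmem : ∀ y ∈ ball (0 : V) r, y + y₀ ∈ ball y₀ r₁ := fun y hy => by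
    rw [mem_ball_iff_norm, add_sub_cancel_right]
    exact (mem_ball_zero_iff.1 hy).trans_le (min_le_left _ _)
  set C : V → W →L[𝕜] V →L[𝕜] W := fun y => B (y + y₀) with hC
  set C' : V → V →L[𝕜] W →L[𝕜] V →L[𝕜] W := fun y => fderiv 𝕜 B (y + y₀) with hC'
  have hCd : ∀ y ∈ ball (0 : V) r, HasFDerivAt C (C' y) y := fun y hy => by
    have h := ((hball _ (hmem y hy)).2.1.differentiableAt one_ne_zero).hasFDerivAt
    exact h.comp y ((hasFDerivAt_id y).add_const y₀)
  have hCc : ContinuousOn C' (ball 0 r) := fun y hy => by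
    have h := (hball _ (hmem y hy)).2.1.fderiv_right (m := 0) (by simp)
    exact (ContinuousAt.comp (f := fun y => y + y₀) (x := y) h.continuousAt
      (by fun_prop)).continuousWithinAt
  have hCK : ∀ y ∈ ball (0 : V) r, ‖C y‖ ≤ K := fun y hy => (hball _ (hmem y hy)).1.le
  have hbd := pfaffIter_bounds (w := w) hCd hCc hK0.le hKr hr.le hCK
    fun y hy => (hball _ (hmem y hy)).2.2
  have hlim : ∀ y ∈ ball (0 : V) r, ∃ a, Tendsto (fun k => pfaffIter C w k y) atTop (𝓝 a) :=
    fun y hy => cauchySeq_tendsto_of_complete (cauchySeq_of_le_geometric (1 / 4) ‖w‖ (by norm_num)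
      fun k => by rw [dist_comm, dist_eq_norm]; exact (hbd k).1 y hy)
  choose! ψ hψ using hlim
  have hclose : ∀ k, ∀ y ∈ ball (0 : V) r,
      ‖pfaffIter C w k y - ψ y‖ ≤ ‖w‖ * (1 / 4) ^ k / (1 - 1 / 4) := fun k y hy => by
    rw [← dist_eq_norm]
    exact dist_le_of_le_geometric_of_tendsto (1 / 4) ‖w‖ (by norm_num)
      (fun k => by rw [dist_comm, dist_eq_norm]; exact (hbd k).1 y hy) (hψ y hy) k
  have hunif : TendstoUniformlyOn (pfaffIterDeriv C C' w) (fun y => C y (ψ y)) atTop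
      (ball 0 r) := by
    have hz : Tendsto (fun k : ℕ => 4 * K * ‖w‖ * (1 / 2) ^ k
        + K * (‖w‖ * (1 / 4) ^ k / (1 - 1 / 4))) atTop (𝓝 0) := by
      have h1 := tendsto_pow_atTop_nhds_zero_of_lt_one (r := (1 : ℝ) / 2) (by norm_num)
        (by norm_num)
      have h2 := tendsto_pow_atTop_nhds_zero_of_lt_one (r := (1 : ℝ) / 4) (by norm_num)
        (by norm_num)
      simpa using (h1.const_mul (4 * K * ‖w‖)).add
        (((h2.const_mul ‖w‖).div_const (1 - 1 / 4)).const_mul K)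
    rw [Metric.tendstoUniformlyOn_iff]
    intro ε hε
    filter_upwards [hz.eventually_lt_const hε] with k hk y hy
    rw [dist_comm, dist_eq_norm]
    refine lt_of_le_of_lt ?_ hk
    have e : pfaffIterDeriv C C' w k y - C y (ψ y)
        = (pfaffIterDeriv C C' w k y - C y (pfaffIter C w k y))
          + C y (pfaffIter C w k y - ψ y) := by rw [map_sub]; abel
    rw [e]
    refine (norm_add_le _ _).trans (add_le_add ((hbd k).2 y hy) ?_)
    exact (ContinuousLinearMap.le_opNorm _ _).trans
      (mul_le_mul (hCK y hy) (hclose k y hy) (norm_nonneg _) hK0.le)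
  have hsol : ∀ y ∈ ball (0 : V) r, HasFDerivAt ψ (C y (ψ y)) y := fun y hy =>
    hasFDerivAt_of_tendstoUniformlyOn isOpen_ball hunif
      (fun k => (pfaffIter_hasFDerivAt hCd hCc k).1) hψ hy
  refine ⟨fun y => ψ (y - y₀), ?_, ?_⟩
  · have h0 : ∀ k, pfaffIter C w k 0 = w := by
      intro k
      cases k <;> simp [pfaffIter, radialPrimitive]
    have := hψ 0 (mem_ball_self hr)
    simp only [h0] at this
    simpa using (tendsto_nhds_unique this tendsto_const_nhds)
  · filter_upwards [ball_mem_nhds y₀ hr] with y hy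
    have hy' : y - y₀ ∈ ball (0 : V) r := by
      rw [mem_ball_zero_iff]; exact mem_ball_iff_norm.1 hy
    have h := (hsol _ hy').comp y ((hasFDerivAt_id y).sub_const y₀)
    simpa [hC, Function.comp_def] using h

/-- **Poincaré lemma** for `1`-forms, near a point. -/
theorem exists_primitive_of_symm {α : V → V →L[𝕜] W} {y₀ : V} (hα : ContDiffAt 𝕜 1 α y₀)
    (hsymm : ∀ᶠ y in 𝓝 y₀, ∀ u v, fderiv 𝕜 α y u v = fderiv 𝕜 α y v u) :
    ∃ f : V → W, ∀ᶠ y in 𝓝 y₀, HasFDerivAt f (α y) y := by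
  obtain ⟨r, hr, hball⟩ := Metric.eventually_nhds_iff_ball.1
    ((hα.eventually (by simp)).and hsymm)
  have hmem : ∀ y ∈ ball (0 : V) r, y + y₀ ∈ ball y₀ r := fun y hy => by
    rw [mem_ball_iff_norm, add_sub_cancel_right]
    exact mem_ball_zero_iff.1 hy
  set β : V → V →L[𝕜] W := fun y => α (y + y₀) with hβ
  set β' : V → V →L[𝕜] V →L[𝕜] W := fun y => fderiv 𝕜 α (y + y₀) with hβ'
  have hd : ∀ y ∈ ball (0 : V) r, HasFDerivAt β (β' y) y := fun y hy => by
    have h := ((hball _ (hmem y hy)).1.differentiableAt one_ne_zero).hasFDerivAt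
    exact h.comp y ((hasFDerivAt_id y).add_const y₀)
  have hc : ContinuousOn β' (ball 0 r) := fun y hy => by
    have h := (hball _ (hmem y hy)).1.fderiv_right (m := 0) (by simp)
    exact (ContinuousAt.comp (f := fun y => y + y₀) (x := y) h.continuousAt
      (by fun_prop)).continuousWithinAt
  have hcurl : ∀ y ∈ ball (0 : V) r, radialCurl β' y = 0 := fun y hy => by
    refine norm_le_zero_iff.1 (norm_radialCurl_le hy le_rfl fun z hz v => ?_)
    have h : β' z v y = β' z y v := (hball _ (hmem z hz)).2 v y
    rw [h]
    simp
  refine ⟨fun y => radialPrimitive β (y - y₀), ?_⟩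
  filter_upwards [ball_mem_nhds y₀ hr] with y hy
  have hy' : y - y₀ ∈ ball (0 : V) r := by
    rw [mem_ball_zero_iff]; exact mem_ball_iff_norm.1 hy
  have h := (hasFDerivAt_radialPrimitive hd hc hy').comp y ((hasFDerivAt_id y).sub_const y₀)
  simpa [hβ, hcurl _ hy', Function.comp_def] using h

end
end Pfaffian

/-! ### Coordinate patches and the Frobenius structure in coordinates -/

section Charts

variable {𝕜 : Type*} [RCLike 𝕜] {n : ℕ}

/-- The standard basis vector `e_i` of the coordinate space. -/
abbrev stdVec (𝕜 : Type*) [RCLike 𝕜] {n : ℕ} (i : Fin n) : Fin n → 𝕜 := Pi.single i 1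

theorem sum_smul_stdVec (v : Fin n → 𝕜) : ∑ i, v i • stdVec 𝕜 i = v := by
  ext j
  simp [Finset.sum_apply, Pi.single_apply]

theorem map_eq_sum_stdVec {W : Type*} [AddCommGroup W] [Module 𝕜 W] (L : (Fin n → 𝕜) →ₗ[𝕜] W)
    (v : Fin n → 𝕜) : L v = ∑ i, v i • L (stdVec 𝕜 i) := by
  conv_lhs => rw [← sum_smul_stdVec v]
  simp

theorem sum_mul_pd (f : (Fin n → 𝕜) → 𝕜) (y v : Fin n → 𝕜) :
    ∑ i, v i * pd i f y = fderiv 𝕜 f y v := by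
  have := map_eq_sum_stdVec (fderiv 𝕜 f y).toLinearMap v
  simpa [pd] using this.symm

/-- Bilinear maps are determined by their values on pairs of standard basis vectors. -/
theorem eq_of_eq_on_stdVec {W : Type*} [AddCommGroup W] [Module 𝕜 W]
    {f g : (Fin n → 𝕜) → (Fin n → 𝕜) → W} (hf : IsBilinearMap 𝕜 f) (hg : IsBilinearMap 𝕜 g)
    (h : ∀ i j, f (stdVec 𝕜 i) (stdVec 𝕜 j) = g (stdVec 𝕜 i) (stdVec 𝕜 j)) (u v : Fin n → 𝕜) :
    f u v = g u v := by
  have : hf.toLinearMap = hg.toLinearMap :=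
    LinearMap.ext_basis (Pi.basisFun 𝕜 (Fin n)) (Pi.basisFun 𝕜 (Fin n)) fun i j => by
      rw [Pi.basisFun_apply, Pi.basisFun_apply]
      exact h i j
  exact LinearMap.congr_fun₂ this u v

variable {M : Type*} [TopologicalSpace M] [ChartedSpace (Fin n → 𝕜) M]

/-- The isomorphism of the coordinate space with the tangent space given by the coordinate vector
fields. -/
def toTan (φ : CoordChart 𝕜 n M) (y : Fin n → 𝕜) : (Fin n → 𝕜) →ₗ[𝕜] Tan 𝕜 n (φ.symm y) :=
  (mfderiv 𝓘(𝕜, Fin n → 𝕜) 𝓘(𝕜, Fin n → 𝕜) φ.symm y).toLinearMap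

/-- The components of a tangent vector in the coordinates `φ`. -/
def ofTan (φ : CoordChart 𝕜 n M) (y : Fin n → 𝕜) : Tan 𝕜 n (φ.symm y) →ₗ[𝕜] (Fin n → 𝕜) :=
  (mfderiv 𝓘(𝕜, Fin n → 𝕜) 𝓘(𝕜, Fin n → 𝕜) φ (φ.symm y)).toLinearMap

theorem frame_eq_toTan (φ : CoordChart 𝕜 n M) (i : Fin n) (y : Fin n → 𝕜) :
    frame φ i y = toTan φ y (stdVec 𝕜 i) := rfl

variable {φ ψ : CoordChart 𝕜 n M}

theorem IsCoordinatePatch.mdifferentiable (hφ : IsCoordinatePatch φ) :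
    φ.MDifferentiable 𝓘(𝕜, Fin n → 𝕜) 𝓘(𝕜, Fin n → 𝕜) :=
  ⟨fun _ hx => ((contMDiffOn_of_mem_maximalAtlas hφ _ hx).mdifferentiableWithinAt (by simp)),
    fun _ hy => ((contMDiffOn_symm_of_mem_maximalAtlas hφ _ hy).mdifferentiableWithinAt (by simp))⟩

theorem ofTan_toTan (hφ : IsCoordinatePatch φ) {y : Fin n → 𝕜} (hy : y ∈ φ.target)
    (v : Fin n → 𝕜) : ofTan φ y (toTan φ y v) = v :=
  DFunLike.congr_fun (hφ.mdifferentiable.comp_symm_deriv hy) v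

theorem toTan_ofTan (hφ : IsCoordinatePatch φ) {y : Fin n → 𝕜} (hy : y ∈ φ.target)
    (v : Tan 𝕜 n (φ.symm y)) : toTan φ y (ofTan φ y v) = v := by
  have h := DFunLike.congr_fun (hφ.mdifferentiable.symm_comp_deriv (φ.map_target hy)) v
  rw [φ.right_inv hy] at h
  exact h

theorem dif_coord (hφ : IsCoordinatePatch φ) {x : M} (hx : x ∈ φ.source) (i : Fin n)
    (v : Tan 𝕜 n x) : dif (fun z : M => φ z i) x v
      = (mfderiv 𝓘(𝕜, Fin n → 𝕜) 𝓘(𝕜, Fin n → 𝕜) φ x v : Fin n → 𝕜) i := by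
  have h1 := (hφ.mdifferentiable.mdifferentiableAt hx).hasMFDerivAt
  have h2 : HasMFDerivAt 𝓘(𝕜, Fin n → 𝕜) 𝓘(𝕜, 𝕜) (fun v : Fin n → 𝕜 => v i) (φ x)
      (ContinuousLinearMap.proj (R := 𝕜) (φ := fun _ : Fin n => 𝕜) i) :=
    (ContinuousLinearMap.proj (R := 𝕜) (φ := fun _ : Fin n => 𝕜) i).hasMFDerivAt
  have h3 := (h2.comp x h1).mfderiv
  exact DFunLike.congr_fun h3 v

theorem coframe_apply (hφ : IsCoordinatePatch φ) {y : Fin n → 𝕜} (hy : y ∈ φ.target) (i : Fin n)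
    (v : Tan 𝕜 n (φ.symm y)) : coframe φ i y v = ofTan φ y v i :=
  dif_coord hφ (φ.map_target hy) i v

theorem dif_apply_toTan (hφ : IsCoordinatePatch φ) {y : Fin n → 𝕜} (hy : y ∈ φ.target)
    {f : M → 𝕜} (hf : MDifferentiableAt 𝓘(𝕜, Fin n → 𝕜) 𝓘(𝕜, 𝕜) f (φ.symm y)) (v : Fin n → 𝕜) :
    dif f (φ.symm y) (toTan φ y v) = fderiv 𝕜 (f ∘ φ.symm) y v := by
  have h1 := (hφ.mdifferentiable.mdifferentiableAt_symm hy).hasMFDerivAt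
  have h3 := (hf.hasMFDerivAt.comp y h1).mfderiv
  rw [mfderiv_eq_fderiv] at h3
  exact (DFunLike.congr_fun h3 v).symm

/-- `df = ∑ ∂f/∂x^a dx^a`. -/
theorem dif_eq_sum (hφ : IsCoordinatePatch φ) {y : Fin n → 𝕜} (hy : y ∈ φ.target)
    {f : M → 𝕜} (hf : MDifferentiableAt 𝓘(𝕜, Fin n → 𝕜) 𝓘(𝕜, 𝕜) f (φ.symm y)) :
    dif f (φ.symm y) = ∑ a, pd a (f ∘ φ.symm) y • coframe φ a y := by
  ext v
  rw [← toTan_ofTan hφ hy v, dif_apply_toTan hφ hy hf, ← sum_mul_pd]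
  simp [coframe_apply hφ hy, ofTan_toTan hφ hy, mul_comm]

theorem contMDiffAt_coord (hφ : IsCoordinatePatch φ) {x : M} (hx : x ∈ φ.source) (i : Fin n) :
    ContMDiffAt 𝓘(𝕜, Fin n → 𝕜) 𝓘(𝕜, 𝕜) ∞ (fun z : M => φ z i) x := by
  have h2 : ContMDiffAt 𝓘(𝕜, Fin n → 𝕜) 𝓘(𝕜, 𝕜) ∞ (fun v : Fin n → 𝕜 => v i) (φ x) :=
    (ContinuousLinearMap.proj (R := 𝕜) (φ := fun _ : Fin n => 𝕜) i).contDiff.contDiffAt.contMDiffAt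
  exact h2.comp x (contMDiffAt_of_mem_maximalAtlas hφ hx)

/-- The transition map between two coordinate patches is smooth. -/
theorem contDiffAt_transition (hφ : IsCoordinatePatch φ) (hψ : IsCoordinatePatch ψ)
    {y : Fin n → 𝕜} (hy : y ∈ φ.target) (hy' : φ.symm y ∈ ψ.source) :
    ContDiffAt 𝕜 ∞ (fun z => ψ (φ.symm z)) y := by
  rw [← contMDiffAt_iff_contDiffAt]
  exact (contMDiffAt_of_mem_maximalAtlas hψ hy').comp y
    (contMDiffAt_symm_of_mem_maximalAtlas hφ hy)

end Charts

section LocalModel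

variable {𝕜 : Type*} [RCLike 𝕜] {n : ℕ} {M : Type*} [TopologicalSpace M]
  [ChartedSpace (Fin n → 𝕜) M] (F : FrobeniusManifold 𝕜 n M) (φ : CoordChart 𝕜 n M)

/-- The components `X(y) ∈ 𝕜ⁿ` of a vector field in the coordinates `φ`. -/
def vecLoc (X : VField 𝕜 n M) (y : Fin n → 𝕜) : Fin n → 𝕜 := fun i => vecComp X φ i y

namespace FrobeniusManifold

/-- The multiplication read in the coordinates `φ`. -/
def mulLoc (y : Fin n → 𝕜) : (Fin n → 𝕜) →L[𝕜] (Fin n → 𝕜) →L[𝕜] (Fin n → 𝕜) :=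
  (((F.mul (φ.symm y)).compl₁₂ (toTan φ y) (toTan φ y)).compr₂ (ofTan φ y)).toContinuousBilinearMap

/-- The metric `<,>` read in the coordinates `φ`. -/
def ηLoc (y : Fin n → 𝕜) : (Fin n → 𝕜) →L[𝕜] (Fin n → 𝕜) →L[𝕜] 𝕜 :=
  ((F.η (φ.symm y)).compl₁₂ (toTan φ y) (toTan φ y)).toContinuousBilinearMap

/-- The components of the vector `(dx^i)^♯` dual to `dx^i` with respect to `<,>`. -/
def sharpLoc (i : Fin n) (y : Fin n → 𝕜) : Fin n → 𝕜 :=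
  ofTan φ y ((F.flatIso (φ.symm y)).symm (coframe φ i y))

theorem mulLoc_apply (y u v : Fin n → 𝕜) : F.mulLoc φ y u v
    = ofTan φ y (F.mul (φ.symm y) (toTan φ y u) (toTan φ y v)) := rfl

theorem ηLoc_apply (y u v : Fin n → 𝕜) : F.ηLoc φ y u v
    = F.η (φ.symm y) (toTan φ y u) (toTan φ y v) := rfl

theorem flatIso_apply (x : M) (u v : Tan 𝕜 n x) : F.flatIso x u v = F.η x u v := rfl

theorem η_flatIso_symm (x : M) (u : Cotan 𝕜 n x) (v : Tan 𝕜 n x) :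
    F.η x ((F.flatIso x).symm u) v = u v := by
  rw [← flatIso_apply, LinearEquiv.apply_symm_apply]

theorem cotMetric_apply (x : M) (u v : Cotan 𝕜 n x) :
    F.cotMetric x u v = v ((F.flatIso x).symm u) := by
  change F.η x _ _ = _
  rw [F.η_symm, η_flatIso_symm]

theorem intersectionForm_apply (x : M) (u v : Cotan 𝕜 n x) :
    F.intersectionForm x u v = v (F.mul x (F.euler x) ((F.flatIso x).symm u)) := by
  change F.η x (F.mul x _ _) _ = _
  rw [F.mul_comm, F.η_inv, η_flatIso_symm, F.mul_comm]

variable {φ}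
variable (hφ : IsCoordinatePatch φ) {y : Fin n → 𝕜} (hy : y ∈ φ.target)
include hφ hy

theorem ofTan_eq_vecLoc (X : VField 𝕜 n M) : ofTan φ y (X (φ.symm y)) = vecLoc φ X y := by
  ext i
  exact (coframe_apply hφ hy i _).symm

theorem toTan_vecLoc (X : VField 𝕜 n M) : toTan φ y (vecLoc φ X y) = X (φ.symm y) := by
  rw [← ofTan_eq_vecLoc hφ hy, toTan_ofTan hφ hy]

theorem toTan_mulLoc (u v : Fin n → 𝕜) : toTan φ y (F.mulLoc φ y u v)
    = F.mul (φ.symm y) (toTan φ y u) (toTan φ y v) := toTan_ofTan hφ hy _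

omit hφ hy in
theorem mulLoc_comm (u v : Fin n → 𝕜) : F.mulLoc φ y u v = F.mulLoc φ y v u := by
  rw [mulLoc_apply, F.mul_comm, mulLoc_apply]

theorem mulLoc_assoc (u v w : Fin n → 𝕜) : F.mulLoc φ y (F.mulLoc φ y u v) w
    = F.mulLoc φ y u (F.mulLoc φ y v w) := by
  rw [mulLoc_apply, F.toTan_mulLoc hφ hy, F.mul_assoc, ← F.toTan_mulLoc hφ hy,
    ← mulLoc_apply]

theorem mulLoc_left_comm (u v w : Fin n → 𝕜) : F.mulLoc φ y u (F.mulLoc φ y v w)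
    = F.mulLoc φ y v (F.mulLoc φ y u w) := by
  rw [← F.mulLoc_assoc hφ hy, F.mulLoc_comm u v, F.mulLoc_assoc hφ hy]

theorem unit_mulLoc (u : Fin n → 𝕜) : F.mulLoc φ y (vecLoc φ F.unit y) u = u := by
  rw [mulLoc_apply, toTan_vecLoc hφ hy, F.one_mul, ofTan_toTan hφ hy]

omit hφ hy in
theorem ηLoc_symm (u v : Fin n → 𝕜) : F.ηLoc φ y u v = F.ηLoc φ y v u := F.η_symm _ _ _

theorem ηLoc_mulLoc (u v w : Fin n → 𝕜) : F.ηLoc φ y (F.mulLoc φ y u v) w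
    = F.ηLoc φ y v (F.mulLoc φ y u w) := by
  rw [ηLoc_apply, F.toTan_mulLoc hφ hy, F.mul_comm, F.η_inv, ← F.toTan_mulLoc hφ hy, ηLoc_apply]

theorem ηLoc_sharpLoc (i : Fin n) (v : Fin n → 𝕜) : F.ηLoc φ y (F.sharpLoc φ i y) v = v i := by
  rw [ηLoc_apply, sharpLoc, toTan_ofTan hφ hy, η_flatIso_symm, coframe_apply hφ hy,
    ofTan_toTan hφ hy]

theorem ηLoc_ext {u u' : Fin n → 𝕜} (h : ∀ v, F.ηLoc φ y u v = F.ηLoc φ y u' v) : u = u' := by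
  ext i
  rw [← F.ηLoc_sharpLoc hφ hy i u, ← F.ηLoc_sharpLoc hφ hy i u', F.ηLoc_symm, h, F.ηLoc_symm]

theorem sharpLoc_expand (u : Fin n → 𝕜) :
    u = ∑ i, F.ηLoc φ y u (stdVec 𝕜 i) • F.sharpLoc φ i y := by
  refine F.ηLoc_ext hφ hy fun v => ?_
  have h := map_eq_sum_stdVec (F.ηLoc φ y u).toLinearMap v
  simp only [ContinuousLinearMap.coe_coe] at h
  rw [h]
  simp only [map_sum, map_smul, sum_apply, smul_apply, F.ηLoc_sharpLoc hφ hy, smul_eq_mul]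
  exact Finset.sum_congr rfl fun _ _ => _root_.mul_comm _ _

theorem contraComp_cotMetric (i j : Fin n) :
    contraComp F.cotMetric φ y i j = F.sharpLoc φ i y j := by
  change F.cotMetric _ _ _ = _
  rw [cotMetric_apply, coframe_apply hφ hy, sharpLoc]

theorem contraComp_intersectionForm (i j : Fin n) :
    contraComp F.intersectionForm φ y i j
      = F.mulLoc φ y (vecLoc φ F.euler y) (F.sharpLoc φ i y) j := by
  change F.intersectionForm _ _ _ = _
  rw [intersectionForm_apply, coframe_apply hφ hy, mulLoc_apply, toTan_vecLoc hφ hy, sharpLoc,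
    toTan_ofTan hφ hy]

theorem inv_ηComp (i j : Fin n) : (F.ηComp φ y)⁻¹ i j = F.sharpLoc φ i y j := by
  have h : (Matrix.of fun i j => F.sharpLoc φ i y j) * F.ηComp φ y = 1 := by
    ext i j
    have h1 := map_eq_sum_stdVec ((F.ηLoc φ y).flip (stdVec 𝕜 j)).toLinearMap (F.sharpLoc φ i y)
    simp only [ContinuousLinearMap.coe_coe, ContinuousLinearMap.flip_apply,
      F.ηLoc_sharpLoc hφ hy] at h1
    rw [Matrix.mul_apply, Matrix.one_apply]
    simp only [Pi.single_apply] at h1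
    rw [h1]
    rfl
  rw [Matrix.inv_eq_left_inv h]
  rfl

end FrobeniusManifold
end LocalModel

/-! ### Christoffel symbols as bilinear maps -/

section Christoffel

variable {𝕜 : Type*} [RCLike 𝕜] {n : ℕ}

theorem contDiffOn_det {s : Set (Fin n → 𝕜)} {A : (Fin n → 𝕜) → Matrix (Fin n) (Fin n) 𝕜}
    (hA : ∀ i j, ContDiffOn 𝕜 ∞ (fun y => A y i j) s) :
    ContDiffOn 𝕜 ∞ (fun y => (A y).det) s := by
  simp only [Matrix.det_apply]
  exact ContDiffOn.sum fun σ _ => (contDiffOn_prod fun i _ => hA _ _).const_smul _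

/-- The entries of the inverse of a smooth family of invertible matrices are smooth. -/
theorem contDiffOn_inv_apply {s : Set (Fin n → 𝕜)} {A : (Fin n → 𝕜) → Matrix (Fin n) (Fin n) 𝕜}
    (hA : ∀ i j, ContDiffOn 𝕜 ∞ (fun y => A y i j) s) (hdet : ∀ y ∈ s, (A y).det ≠ 0)
    (i j : Fin n) : ContDiffOn 𝕜 ∞ (fun y => (A y)⁻¹ i j) s := by
  simp only [Matrix.inv_def, Ring.inverse_eq_inv', Matrix.smul_apply, smul_eq_mul,
    Matrix.adjugate_apply]
  refine ((contDiffOn_det hA).inv hdet).mul (contDiffOn_det fun k l => ?_)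
  simp only [Matrix.updateRow_apply]
  split_ifs
  · exact contDiffOn_const
  · exact hA _ _

/-- The bilinear form `u, v ↦ ∑ u_i A_{ij} v_j` of a matrix. -/
def formOfMatrix (A : Matrix (Fin n) (Fin n) 𝕜) :
    (Fin n → 𝕜) →L[𝕜] (Fin n → 𝕜) →L[𝕜] 𝕜 :=
  (Matrix.toLinearMap₂' 𝕜 A).toContinuousBilinearMap

theorem formOfMatrix_apply (A : Matrix (Fin n) (Fin n) 𝕜) (u v : Fin n → 𝕜) :
    formOfMatrix A u v = u ⬝ᵥ A.mulVec v :=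
  Matrix.toLinearMap₂'_apply' A u v

theorem formOfMatrix_stdVec (A : Matrix (Fin n) (Fin n) 𝕜) (i j : Fin n) :
    formOfMatrix A (stdVec 𝕜 i) (stdVec 𝕜 j) = A i j := by
  simp [formOfMatrix_apply]

theorem formOfMatrix_symm {A : Matrix (Fin n) (Fin n) 𝕜} (hA : A.IsSymm) (u v : Fin n → 𝕜) :
    formOfMatrix A u v = formOfMatrix A v u := by
  rw [formOfMatrix_apply, formOfMatrix_apply, dotProduct_comm, Matrix.dotProduct_mulVec,
    ← Matrix.mulVec_transpose, hA.eq, dotProduct_comm, dotProduct_comm]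

theorem isBilinearMap_clm {V W : Type*} [NormedAddCommGroup V] [NormedSpace 𝕜 V]
    [NormedAddCommGroup W] [NormedSpace 𝕜 W] (B : V →L[𝕜] V →L[𝕜] W) :
    IsBilinearMap 𝕜 fun u v => B u v := by
  constructor <;> intros <;> simp

section

variable {V W X : Type*} [NormedAddCommGroup V] [NormedSpace 𝕜 V] [NormedAddCommGroup W]
  [NormedSpace 𝕜 W] [NormedAddCommGroup X] [NormedSpace 𝕜 X]

theorem differentiableAt_comp {f : V → W} {Φ : X → V} {x : X} (hf : DifferentiableAt 𝕜 f (Φ x))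
    (hΦ : DifferentiableAt 𝕜 Φ x) : DifferentiableAt 𝕜 (fun z => f (Φ z)) x :=
  DifferentiableAt.comp x hf hΦ

theorem fderiv_comp_eq {f : V → W} {Φ : X → V} {x : X} (hf : DifferentiableAt 𝕜 f (Φ x))
    (hΦ : DifferentiableAt 𝕜 Φ x) :
    fderiv 𝕜 (fun z => f (Φ z)) x = (fderiv 𝕜 f (Φ x)).comp (fderiv 𝕜 Φ x) :=
  fderiv_comp x hf hΦ

theorem two_le_smooth : (2 : ℕ∞ω) ≤ ∞ := by
  change ((2 : ℕ∞) : ℕ∞ω) ≤ ((⊤ : ℕ∞) : ℕ∞ω)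
  exact WithTop.coe_le_coe.2 le_top

/-- The Leibniz rule for `B(a, b)`, where `B` is a varying bilinear map. -/
theorem fderiv_clm_apply₂ {B : X → V →L[𝕜] V →L[𝕜] W} {a b : X → V} {x : X}
    (hB : DifferentiableAt 𝕜 B x) (ha : DifferentiableAt 𝕜 a x) (hb : DifferentiableAt 𝕜 b x)
    (u : X) : fderiv 𝕜 (fun z => B z (a z) (b z)) x u
      = fderiv 𝕜 B x u (a x) (b x) + B x (fderiv 𝕜 a x u) (b x) + B x (a x) (fderiv 𝕜 b x u) := by
  rw [((hB.hasFDerivAt.clm_apply ha.hasFDerivAt).clm_apply hb.hasFDerivAt).fderiv]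
  simp only [add_apply, ContinuousLinearMap.comp_apply, ContinuousLinearMap.flip_apply]
  abel

end

theorem eq_formOfMatrix {B : (Fin n → 𝕜) →L[𝕜] (Fin n → 𝕜) →L[𝕜] 𝕜}
    {A : Matrix (Fin n) (Fin n) 𝕜} (h : ∀ i j, B (stdVec 𝕜 i) (stdVec 𝕜 j) = A i j) :
    B = formOfMatrix A := by
  ext1 u
  ext1 v
  exact eq_of_eq_on_stdVec (isBilinearMap_clm B) (isBilinearMap_clm _)
    (fun i j => by rw [h, formOfMatrix_stdVec]) u v

theorem contDiffOn_formOfMatrix {s : Set (Fin n → 𝕜)}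
    {A : (Fin n → 𝕜) → Matrix (Fin n) (Fin n) 𝕜}
    (hA : ∀ i j, ContDiffOn 𝕜 ∞ (fun y => A y i j) s) :
    ContDiffOn 𝕜 ∞ (fun y => formOfMatrix (A y)) s := by
  refine contDiffOn_clm_apply.2 fun u => contDiffOn_clm_apply.2 fun v => ?_
  simp only [formOfMatrix_apply, dotProduct, Matrix.mulVec]
  exact ContDiffOn.sum fun i _ => contDiffOn_const.mul
    (ContDiffOn.sum fun j _ => (hA i j).mul contDiffOn_const)

/-- `Γ(u, v)^k = ∑ Γ^k_{ij} u^i v^j` for the Christoffel symbols of the metric with matrix `h`. -/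
def christoffelVec (h : (Fin n → 𝕜) → Matrix (Fin n) (Fin n) 𝕜) (y u v : Fin n → 𝕜) :
    Fin n → 𝕜 :=
  fun k => ∑ i, ∑ j, u i * v j * christoffel h k i j y

theorem isBilinearMap_christoffelVec (h : (Fin n → 𝕜) → Matrix (Fin n) (Fin n) 𝕜)
    (y : Fin n → 𝕜) : IsBilinearMap 𝕜 (christoffelVec h y) := by
  constructor <;> intros <;> ext k <;>
    simp only [christoffelVec, Pi.add_apply, Pi.smul_apply, smul_eq_mul, add_mul, mul_add,
      Finset.sum_add_distrib, Finset.mul_sum, mul_assoc, mul_left_comm]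

theorem christoffelVec_stdVec (h : (Fin n → 𝕜) → Matrix (Fin n) (Fin n) 𝕜) (y : Fin n → 𝕜)
    (i j k : Fin n) : christoffelVec h y (stdVec 𝕜 i) (stdVec 𝕜 j) k = christoffel h k i j y := by
  simp [christoffelVec, Pi.single_apply]

variable {h : (Fin n → 𝕜) → Matrix (Fin n) (Fin n) 𝕜} {y : Fin n → 𝕜}

theorem fderiv_form_stdVec (hd : DifferentiableAt 𝕜 (fun z => formOfMatrix (h z)) y)
    (u : Fin n → 𝕜) (i j : Fin n) :
    fderiv 𝕜 (fun z => formOfMatrix (h z)) y u (stdVec 𝕜 i) (stdVec 𝕜 j)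
      = fderiv 𝕜 (fun z => h z i j) y u := by
  have e := ((hd.hasFDerivAt.clm_apply (hasFDerivAt_const (stdVec 𝕜 i) y)).clm_apply
    (hasFDerivAt_const (stdVec 𝕜 j) y)).fderiv
  simp only [formOfMatrix_stdVec] at e
  rw [e]
  simp

theorem fderiv_form_symm (hd : DifferentiableAt 𝕜 (fun z => formOfMatrix (h z)) y)
    (hs : ∀ᶠ z in 𝓝 y, (h z).IsSymm) (u v w : Fin n → 𝕜) :
    fderiv 𝕜 (fun z => formOfMatrix (h z)) y u v w
      = fderiv 𝕜 (fun z => formOfMatrix (h z)) y u w v := by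
  have e : ∀ v w, fderiv 𝕜 (fun z => formOfMatrix (h z)) y u v w
      = fderiv 𝕜 (fun z => formOfMatrix (h z) v w) y u := fun v w => by
    rw [((hd.hasFDerivAt.clm_apply (hasFDerivAt_const v y)).clm_apply
      (hasFDerivAt_const w y)).fderiv]
    simp
  rw [e, e]
  congr 1
  refine Filter.EventuallyEq.fderiv_eq ?_
  filter_upwards [hs] with z hz
  exact formOfMatrix_symm hz _ _

/-- The Koszul formula. -/
theorem form_christoffelVec (hd : DifferentiableAt 𝕜 (fun z => formOfMatrix (h z)) y)
    (hs : ∀ᶠ z in 𝓝 y, (h z).IsSymm) (hdet : (h y).det ≠ 0) (u v w : Fin n → 𝕜) :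
    formOfMatrix (h y) (christoffelVec h y u v) w
      = 2⁻¹ * (fderiv 𝕜 (fun z => formOfMatrix (h z)) y u v w
        + fderiv 𝕜 (fun z => formOfMatrix (h z)) y v u w
        - fderiv 𝕜 (fun z => formOfMatrix (h z)) y w u v) := by
  set h' := fderiv 𝕜 (fun z => formOfMatrix (h z)) y with hh'
  have hsym := fderiv_form_symm hd hs
  have key : ∀ u v, christoffelVec h y u v = (h y)⁻¹.mulVec fun l =>
      2⁻¹ * (h' u v (stdVec 𝕜 l) + h' v u (stdVec 𝕜 l) - h' (stdVec 𝕜 l) u v) := by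
    intro u v
    refine eq_of_eq_on_stdVec (g := fun u v => (h y)⁻¹.mulVec fun l =>
      2⁻¹ * (h' u v (stdVec 𝕜 l) + h' v u (stdVec 𝕜 l) - h' (stdVec 𝕜 l) u v))
      (isBilinearMap_christoffelVec h y) ?_ (fun i j => ?_) u v
    · constructor <;> intros <;> ext k <;>
        simp only [Matrix.mulVec, dotProduct, Pi.add_apply, Pi.smul_apply, smul_eq_mul, map_add,
          map_smul, add_apply, smul_apply, Finset.mul_sum, ← Finset.sum_add_distrib] <;>
        exact Finset.sum_congr rfl fun _ _ => by ring
    · ext k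
      rw [christoffelVec_stdVec, christoffel, Matrix.mulVec, dotProduct, Finset.mul_sum]
      refine Finset.sum_congr rfl fun l _ => ?_
      rw [hsym (stdVec 𝕜 i), fderiv_form_stdVec hd, fderiv_form_stdVec hd, fderiv_form_stdVec hd]
      simp only [pd]
      ring
  have hu : IsUnit (h y).det := hdet.isUnit
  rw [formOfMatrix_symm hs.self_of_nhds, formOfMatrix_apply, key, Matrix.mulVec_mulVec,
    Matrix.mul_nonsing_inv _ hu, Matrix.one_mulVec]
  have e : ∀ L : (Fin n → 𝕜) →ₗ[𝕜] 𝕜, L w = ∑ l, w l * L (stdVec 𝕜 l) := fun L => by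
    rw [map_eq_sum_stdVec L w]; rfl
  have e1 := e (h' u v).toLinearMap
  have e2 := e (h' v u).toLinearMap
  have e3 := e ((h'.flip u).flip v).toLinearMap
  simp only [ContinuousLinearMap.coe_coe, ContinuousLinearMap.flip_apply] at e1 e2 e3
  rw [e1, e2, e3, ← Finset.sum_add_distrib, ← Finset.sum_sub_distrib, Finset.mul_sum, dotProduct]
  exact Finset.sum_congr rfl fun _ _ => by ring

theorem form_ext (hdet : (h y).det ≠ 0) (hs : (h y).IsSymm) {a b : Fin n → 𝕜}
    (hab : ∀ w, formOfMatrix (h y) a w = formOfMatrix (h y) b w) : a = b := by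
  have h1 : (h y).mulVec a = (h y).mulVec b := by
    ext i
    have := hab (stdVec 𝕜 i)
    rw [formOfMatrix_symm hs, formOfMatrix_symm hs b] at this
    simpa [formOfMatrix_apply] using this
  exact Matrix.mulVec_injective_of_isUnit ((Matrix.isUnit_iff_isUnit_det _).2 hdet.isUnit) h1

theorem christoffelVec_symm (hd : DifferentiableAt 𝕜 (fun z => formOfMatrix (h z)) y)
    (hs : ∀ᶠ z in 𝓝 y, (h z).IsSymm) (hdet : (h y).det ≠ 0) (u v : Fin n → 𝕜) :
    christoffelVec h y u v = christoffelVec h y v u := by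
  refine form_ext hdet hs.self_of_nhds fun w => ?_
  rw [form_christoffelVec hd hs hdet, form_christoffelVec hd hs hdet,
    fderiv_form_symm hd hs w u v]
  ring

/-- Compatibility of the Levi-Civita connection with the metric. -/
theorem fderiv_form_eq (hd : DifferentiableAt 𝕜 (fun z => formOfMatrix (h z)) y)
    (hs : ∀ᶠ z in 𝓝 y, (h z).IsSymm) (hdet : (h y).det ≠ 0) (u v w : Fin n → 𝕜) :
    fderiv 𝕜 (fun z => formOfMatrix (h z)) y u v w
      = formOfMatrix (h y) (christoffelVec h y u v) w
        + formOfMatrix (h y) v (christoffelVec h y u w) := by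
  rw [formOfMatrix_symm hs.self_of_nhds v, form_christoffelVec hd hs hdet,
    form_christoffelVec hd hs hdet, fderiv_form_symm hd hs w u v, fderiv_form_symm hd hs u w v]
  have := fderiv_form_symm hd hs w v u
  rw [fderiv_form_symm hd hs v u w]
  rw [this]
  ring

/-- The transformation law of the Christoffel symbols under a change of coordinates `Φ`. -/
theorem fderiv_christoffelVec {k : (Fin n → 𝕜) → Matrix (Fin n) (Fin n) 𝕜}
    {Φ : (Fin n → 𝕜) → Fin n → 𝕜} (hΦ : ContDiffAt 𝕜 ∞ Φ y)
    (hd : DifferentiableAt 𝕜 (fun z => formOfMatrix (h z)) (Φ y))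
    (hs : ∀ᶠ z in 𝓝 (Φ y), (h z).IsSymm) (hdet : (h (Φ y)).det ≠ 0)
    (hd' : DifferentiableAt 𝕜 (fun z => formOfMatrix (k z)) y)
    (hs' : ∀ᶠ z in 𝓝 y, (k z).IsSymm) (hdet' : (k y).det ≠ 0)
    (hk : ∀ᶠ z in 𝓝 y, ∀ u v, formOfMatrix (k z) u v
      = formOfMatrix (h (Φ z)) (fderiv 𝕜 Φ z u) (fderiv 𝕜 Φ z v))
    (hsurj : Function.Surjective (fderiv 𝕜 Φ y)) (u v : Fin n → 𝕜) :
    fderiv 𝕜 Φ y (christoffelVec k y u v)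
      = fderiv 𝕜 (fderiv 𝕜 Φ) y u v
        + christoffelVec h (Φ y) (fderiv 𝕜 Φ y u) (fderiv 𝕜 Φ y v) := by
  have hΦd : HasFDerivAt Φ (fderiv 𝕜 Φ y) y := (hΦ.differentiableAt (by simp)).hasFDerivAt
  have hΦ2 : HasFDerivAt (fderiv 𝕜 Φ) (fderiv 𝕜 (fderiv 𝕜 Φ) y) y :=
    ((hΦ.fderiv_right (m := 1) (by norm_cast)).differentiableAt (by simp)).hasFDerivAt
  have hsymm : ∀ u v, fderiv 𝕜 (fderiv 𝕜 Φ) y u v = fderiv 𝕜 (fderiv 𝕜 Φ) y v u :=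
    fun u v => hΦ.isSymmSndFDerivAt
      (by rw [minSmoothness_of_isRCLikeNormedField]; exact two_le_smooth) u v
  set Φ' := fderiv 𝕜 Φ y with hΦ'
  set Φ'' := fderiv 𝕜 (fderiv 𝕜 Φ) y with hΦ''
  set h' := fderiv 𝕜 (fun z => formOfMatrix (h z)) (Φ y) with hh'
  -- the derivative of the pulled-back metric
  have hder : ∀ a b c, fderiv 𝕜 (fun z => formOfMatrix (k z)) y a b c
      = h' (Φ' a) (Φ' b) (Φ' c) + formOfMatrix (h (Φ y)) (Φ'' a b) (Φ' c)
        + formOfMatrix (h (Φ y)) (Φ' b) (Φ'' a c) := by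
    intro a b c
    have e1 := fderiv_clm_apply₂ hd' (differentiableAt_const b) (differentiableAt_const c) a
    have hc : DifferentiableAt 𝕜 (fun z => formOfMatrix (h (Φ z))) y :=
      differentiableAt_comp (f := fun z => formOfMatrix (h z)) hd hΦd.differentiableAt
    have e2 := fderiv_clm_apply₂ hc
      (hΦ2.differentiableAt.clm_apply (differentiableAt_const b))
      (hΦ2.differentiableAt.clm_apply (differentiableAt_const c)) a
    have e3 : fderiv 𝕜 (fun z => formOfMatrix (h (Φ z))) y = h'.comp Φ' :=
      fderiv_comp_eq (f := fun z => formOfMatrix (h z)) hd hΦd.differentiableAt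
    have e5 : ∀ b, fderiv 𝕜 (fun z => fderiv 𝕜 Φ z b) y a = Φ'' a b := fun b => by
      rw [(hΦ2.clm_apply (hasFDerivAt_const b y)).fderiv]
      simp
    have e4 : fderiv 𝕜 (fun z => formOfMatrix (k z) b c) y
        = fderiv 𝕜 (fun z => formOfMatrix (h (Φ z)) (fderiv 𝕜 Φ z b) (fderiv 𝕜 Φ z c)) y :=
      Filter.EventuallyEq.fderiv_eq (by filter_upwards [hk] with z hz using hz b c)
    rw [e3, e5, e5] at e2
    rw [e4, e2] at e1
    simpa using e1.symm
  have hk0 := hk.self_of_nhds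
  refine form_ext hdet hs.self_of_nhds fun w => ?_
  obtain ⟨w, rfl⟩ := hsurj w
  rw [← hk0, form_christoffelVec hd' hs' hdet', map_add, add_apply,
    form_christoffelVec hd hs hdet, hder, hder, hder, hsymm w u, hsymm w v, hsymm v u,
    formOfMatrix_symm hs.self_of_nhds (Φ' v) (Φ'' u w),
    formOfMatrix_symm hs.self_of_nhds (Φ' u) (Φ'' v w)]
  ring

end Christoffel

/-! ### The axioms of a Frobenius manifold in coordinates -/

section LocalAxioms

variable {𝕜 : Type*} [RCLike 𝕜] {n : ℕ} {M : Type*} [TopologicalSpace M]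
  [ChartedSpace (Fin n → 𝕜) M] (F : FrobeniusManifold 𝕜 n M) {φ : CoordChart 𝕜 n M}

namespace FrobeniusManifold

theorem ηLoc_eq_formOfMatrix (y : Fin n → 𝕜) : F.ηLoc φ y = formOfMatrix (F.ηComp φ y) :=
  eq_formOfMatrix fun _ _ => rfl

theorem isSymm_ηComp (y : Fin n → 𝕜) : (F.ηComp φ y).IsSymm := by
  ext i j
  exact F.η_symm _ _ _

section

variable (hφ : IsCoordinatePatch φ)
include hφ

theorem det_ηComp_ne_zero {y : Fin n → 𝕜} (hy : y ∈ φ.target) : (F.ηComp φ y).det ≠ 0 := by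
  intro h
  obtain ⟨v, hv, hv0⟩ := Matrix.exists_mulVec_eq_zero_iff.2 h
  refine hv (F.ηLoc_ext hφ hy fun w => ?_)
  rw [F.ηLoc_symm, ηLoc_eq_formOfMatrix, formOfMatrix_apply, hv0]
  simp

theorem contDiffOn_ηLoc : ContDiffOn 𝕜 ∞ (F.ηLoc φ) φ.target :=
  (contDiffOn_formOfMatrix (F.smooth_η φ hφ)).congr fun y _ => F.ηLoc_eq_formOfMatrix y

theorem contDiffOn_mulLoc : ContDiffOn 𝕜 ∞ (F.mulLoc φ) φ.target := by
  refine contDiffOn_clm_apply.2 fun u => contDiffOn_clm_apply.2 fun v => contDiffOn_pi.2 fun k => ?_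
  have h : ∀ y, F.mulLoc φ y u v k = ∑ i, ∑ j, u i * v j *
      ofTan φ y (F.mul (φ.symm y) (frame φ i y) (frame φ j y)) k := by
    intro y
    have h1 := map_eq_sum_stdVec ((F.mulLoc φ y).flip v).toLinearMap u
    simp only [ContinuousLinearMap.coe_coe, ContinuousLinearMap.flip_apply] at h1
    rw [h1, Finset.sum_apply]
    refine Finset.sum_congr rfl fun i _ => ?_
    have h2 := map_eq_sum_stdVec (F.mulLoc φ y (stdVec 𝕜 i)).toLinearMap v
    simp only [ContinuousLinearMap.coe_coe] at h2
    rw [h2, Pi.smul_apply, Finset.sum_apply, Finset.smul_sum]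
    refine Finset.sum_congr rfl fun j _ => ?_
    rw [Pi.smul_apply, smul_smul]
    rfl
  refine ContDiffOn.congr (f := fun y => ∑ i, ∑ j, u i * v j *
    F.mulComp φ i j k y) ?_ fun y hy => ?_
  · exact ContDiffOn.sum fun i _ => ContDiffOn.sum fun j _ =>
      contDiffOn_const.mul (F.smooth_mul φ hφ i j k)
  · rw [h]
    refine Finset.sum_congr rfl fun i _ => Finset.sum_congr rfl fun j _ => ?_
    rw [FrobeniusData.mulComp, coframe_apply hφ hy]

theorem contDiffOn_vecLoc_unit : ContDiffOn 𝕜 ∞ (vecLoc φ F.unit) φ.target :=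
  contDiffOn_pi.2 (F.smooth_unit φ hφ)

theorem contDiffOn_vecLoc_euler : ContDiffOn 𝕜 ∞ (vecLoc φ F.euler) φ.target :=
  contDiffOn_pi.2 (F.smooth_euler φ hφ)

theorem contDiffOn_sharpLoc (i : Fin n) : ContDiffOn 𝕜 ∞ (F.sharpLoc φ i) φ.target := by
  refine contDiffOn_pi.2 fun j => ?_
  exact (contDiffOn_inv_apply (F.smooth_η φ hφ) (fun y hy => F.det_ηComp_ne_zero hφ hy) i j).congr
    fun y hy => (F.inv_ηComp hφ hy i j).symm

variable {y : Fin n → 𝕜} (hy : y ∈ φ.target)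
include hy

omit [ChartedSpace (Fin n → 𝕜) M] hφ in
theorem _root_.ContDiffOn.differentiableAt_of_mem_target {W : Type*} [NormedAddCommGroup W]
    [NormedSpace 𝕜 W] {f : (Fin n → 𝕜) → W} (hf : ContDiffOn 𝕜 ∞ f φ.target) :
    DifferentiableAt 𝕜 f y :=
  (hf.contDiffAt (φ.open_target.mem_nhds hy)).differentiableAt (by simp)

theorem differentiableAt_ηLoc : DifferentiableAt 𝕜 (F.ηLoc φ) y :=
  (F.contDiffOn_ηLoc hφ).differentiableAt_of_mem_target hy

theorem differentiableAt_mulLoc : DifferentiableAt 𝕜 (F.mulLoc φ) y :=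
  (F.contDiffOn_mulLoc hφ).differentiableAt_of_mem_target hy

theorem differentiableAt_unit : DifferentiableAt 𝕜 (vecLoc φ F.unit) y :=
  (F.contDiffOn_vecLoc_unit hφ).differentiableAt_of_mem_target hy

theorem differentiableAt_euler : DifferentiableAt 𝕜 (vecLoc φ F.euler) y :=
  (F.contDiffOn_vecLoc_euler hφ).differentiableAt_of_mem_target hy

theorem differentiableAt_sharpLoc (i : Fin n) : DifferentiableAt 𝕜 (F.sharpLoc φ i) y :=
  (F.contDiffOn_sharpLoc hφ i).differentiableAt_of_mem_target hy

theorem fderiv_mulComp (i j k : Fin n) (u : Fin n → 𝕜) :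
    fderiv 𝕜 (F.mulComp φ i j k) y u
      = fderiv 𝕜 (F.mulLoc φ) y u (stdVec 𝕜 i) (stdVec 𝕜 j) k := by
  have h1 := fderiv_clm_apply₂ (F.differentiableAt_mulLoc hφ hy)
    (differentiableAt_const (stdVec 𝕜 i)) (differentiableAt_const (stdVec 𝕜 j)) u
  have h2 : F.mulComp φ i j k =ᶠ[𝓝 y]
      fun z => F.mulLoc φ z (stdVec 𝕜 i) (stdVec 𝕜 j) k := by
    filter_upwards [φ.open_target.mem_nhds hy] with z hz
    exact coframe_apply hφ hz k _
  have h3 : DifferentiableAt 𝕜 (fun z => F.mulLoc φ z (stdVec 𝕜 i) (stdVec 𝕜 j)) y :=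
    ((F.differentiableAt_mulLoc hφ hy).clm_apply (differentiableAt_const _)).clm_apply
      (differentiableAt_const _)
  rw [h2.fderiv_eq, fderiv_apply (h3 : DifferentiableAt 𝕜 _ _)]
  simp only [ContinuousLinearMap.comp_apply, ContinuousLinearMap.proj_apply]
  rw [h1]
  simp

omit hφ hy in
theorem fderiv_vecComp {X : VField 𝕜 n M} (hX : DifferentiableAt 𝕜 (vecLoc φ X) y) (i : Fin n)
    (u : Fin n → 𝕜) : fderiv 𝕜 (vecComp X φ i) y u = fderiv 𝕜 (vecLoc φ X) y u i := by
  have h := fderiv_apply hX i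
  have h2 : (fun z => vecLoc φ X z i) = vecComp X φ i := rfl
  rw [h2] at h
  rw [h]
  simp

theorem mulComp_eq (i j k : Fin n) :
    F.mulComp φ i j k y = F.mulLoc φ y (stdVec 𝕜 i) (stdVec 𝕜 j) k :=
  coframe_apply hφ hy k _

omit hφ hy in
theorem pd_vecComp {X : VField 𝕜 n M} (hX : DifferentiableAt 𝕜 (vecLoc φ X) y) (i j : Fin n) :
    pd j (vecComp X φ i) y = fderiv 𝕜 (vecLoc φ X) y (stdVec 𝕜 j) i :=
  fderiv_vecComp hX i _

omit hφ hy in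
theorem sum_mul_pd_vecComp {X : VField 𝕜 n M} (hX : DifferentiableAt 𝕜 (vecLoc φ X) y)
    (v : Fin n → 𝕜) (i : Fin n) :
    ∑ l, v l * pd l (vecComp X φ i) y = fderiv 𝕜 (vecLoc φ X) y v i := by
  rw [sum_mul_pd, fderiv_vecComp hX]

omit hφ hy in
theorem sum_smul_map_stdVec {W : Type*} [NormedAddCommGroup W] [NormedSpace 𝕜 W]
    (L : (Fin n → 𝕜) →L[𝕜] W) (v : Fin n → 𝕜) : ∑ l, v l • L (stdVec 𝕜 l) = L v :=
  (map_eq_sum_stdVec L.toLinearMap v).symm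

/-- `L_E c = c` for the multiplication. -/
theorem lie_mulLoc (u v : Fin n → 𝕜) :
    fderiv 𝕜 (F.mulLoc φ) y (vecLoc φ F.euler y) u v
      - fderiv 𝕜 (vecLoc φ F.euler) y (F.mulLoc φ y u v)
      + F.mulLoc φ y (fderiv 𝕜 (vecLoc φ F.euler) y u) v
      + F.mulLoc φ y u (fderiv 𝕜 (vecLoc φ F.euler) y v) = F.mulLoc φ y u v := by
  have hE := F.differentiableAt_euler hφ hy
  refine eq_of_eq_on_stdVec (f := fun u v =>
    fderiv 𝕜 (F.mulLoc φ) y (vecLoc φ F.euler y) u v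
      - fderiv 𝕜 (vecLoc φ F.euler) y (F.mulLoc φ y u v)
      + F.mulLoc φ y (fderiv 𝕜 (vecLoc φ F.euler) y u) v
      + F.mulLoc φ y u (fderiv 𝕜 (vecLoc φ F.euler) y v))
    (g := fun u v => F.mulLoc φ y u v) ?_ (isBilinearMap_clm _) (fun i j => ?_) u v
  · constructor <;> intros <;>
      simp only [map_add, map_smul, add_apply, smul_apply, smul_add, smul_sub] <;> abel
  · ext k
    have h := F.lie_mul φ hφ y hy i j k
    rw [FrobeniusData.lieMul] at h
    simp only [Finset.sum_add_distrib, Finset.sum_sub_distrib, F.mulComp_eq hφ hy] at h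
    have h1 : ∑ l, vecComp F.euler φ l y * pd l (F.mulComp φ i j k) y
        = fderiv 𝕜 (F.mulLoc φ) y (vecLoc φ F.euler y) (stdVec 𝕜 i) (stdVec 𝕜 j) k := by
      rw [← F.fderiv_mulComp hφ hy, ← sum_mul_pd]
      rfl
    have h3 : ∑ l, F.mulLoc φ y (stdVec 𝕜 l) (stdVec 𝕜 j) k * pd i (vecComp F.euler φ l) y
        = F.mulLoc φ y (fderiv 𝕜 (vecLoc φ F.euler) y (stdVec 𝕜 i)) (stdVec 𝕜 j) k := by
      have := congrFun (sum_smul_map_stdVec ((F.mulLoc φ y).flip (stdVec 𝕜 j))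
        (fderiv 𝕜 (vecLoc φ F.euler) y (stdVec 𝕜 i))) k
      simp only [ContinuousLinearMap.flip_apply] at this
      rw [← this, Finset.sum_apply]
      exact Finset.sum_congr rfl fun l _ => by
        rw [pd_vecComp hE, Pi.smul_apply, smul_eq_mul, _root_.mul_comm]
    have h4 : ∑ l, F.mulLoc φ y (stdVec 𝕜 i) (stdVec 𝕜 l) k * pd j (vecComp F.euler φ l) y
        = F.mulLoc φ y (stdVec 𝕜 i) (fderiv 𝕜 (vecLoc φ F.euler) y (stdVec 𝕜 j)) k := by
      have := congrFun (sum_smul_map_stdVec (F.mulLoc φ y (stdVec 𝕜 i))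
        (fderiv 𝕜 (vecLoc φ F.euler) y (stdVec 𝕜 j))) k
      rw [← this, Finset.sum_apply]
      exact Finset.sum_congr rfl fun l _ => by
        rw [pd_vecComp hE, Pi.smul_apply, smul_eq_mul, _root_.mul_comm]
    rw [h1, sum_mul_pd_vecComp hE, h3, h4] at h
    exact h

theorem fderiv_ηComp (i j : Fin n) (u : Fin n → 𝕜) :
    fderiv 𝕜 (fun z => F.ηComp φ z i j) y u
      = fderiv 𝕜 (F.ηLoc φ) y u (stdVec 𝕜 i) (stdVec 𝕜 j) := by
  have h1 := fderiv_clm_apply₂ (F.differentiableAt_ηLoc hφ hy)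
    (differentiableAt_const (stdVec 𝕜 i)) (differentiableAt_const (stdVec 𝕜 j)) u
  exact h1.trans (by simp)

/-- `L_E <,> = (2 - d) <,>`. -/
theorem lie_ηLoc (u v : Fin n → 𝕜) :
    fderiv 𝕜 (F.ηLoc φ) y (vecLoc φ F.euler y) u v
      + F.ηLoc φ y (fderiv 𝕜 (vecLoc φ F.euler) y u) v
      + F.ηLoc φ y u (fderiv 𝕜 (vecLoc φ F.euler) y v) = (2 - F.d) * F.ηLoc φ y u v := by
  have hE := F.differentiableAt_euler hφ hy
  refine eq_of_eq_on_stdVec (f := fun u v =>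
    fderiv 𝕜 (F.ηLoc φ) y (vecLoc φ F.euler y) u v
      + F.ηLoc φ y (fderiv 𝕜 (vecLoc φ F.euler) y u) v
      + F.ηLoc φ y u (fderiv 𝕜 (vecLoc φ F.euler) y v))
    (g := fun u v => (2 - F.d) * F.ηLoc φ y u v) ?_ ?_ (fun i j => ?_) u v
  · constructor <;> intros <;>
      simp only [map_add, map_smul, add_apply, smul_apply, smul_eq_mul] <;> ring
  · constructor <;> intros <;>
      simp only [map_add, map_smul, add_apply, smul_apply, smul_eq_mul] <;> ring
  · have h := F.lie_η φ hφ y hy i j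
    rw [FrobeniusData.lieη] at h
    simp only [Finset.sum_add_distrib] at h
    have h1 : ∑ l, vecComp F.euler φ l y * pd l (fun z => F.ηComp φ z i j) y
        = fderiv 𝕜 (F.ηLoc φ) y (vecLoc φ F.euler y) (stdVec 𝕜 i) (stdVec 𝕜 j) := by
      rw [← F.fderiv_ηComp hφ hy, ← sum_mul_pd]
      rfl
    have h3 : ∑ l, F.ηComp φ y l j * pd i (vecComp F.euler φ l) y
        = F.ηLoc φ y (fderiv 𝕜 (vecLoc φ F.euler) y (stdVec 𝕜 i)) (stdVec 𝕜 j) := by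
      have := sum_smul_map_stdVec ((F.ηLoc φ y).flip (stdVec 𝕜 j))
        (fderiv 𝕜 (vecLoc φ F.euler) y (stdVec 𝕜 i))
      simp only [ContinuousLinearMap.flip_apply] at this
      rw [← this]
      exact Finset.sum_congr rfl fun l _ => by
        rw [pd_vecComp hE, smul_eq_mul, _root_.mul_comm]
        rfl
    have h4 : ∑ l, F.ηComp φ y i l * pd j (vecComp F.euler φ l) y
        = F.ηLoc φ y (stdVec 𝕜 i) (fderiv 𝕜 (vecLoc φ F.euler) y (stdVec 𝕜 j)) := by
      rw [← sum_smul_map_stdVec (F.ηLoc φ y (stdVec 𝕜 i))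
        (fderiv 𝕜 (vecLoc φ F.euler) y (stdVec 𝕜 j))]
      exact Finset.sum_congr rfl fun l _ => by
        rw [pd_vecComp hE, smul_eq_mul, _root_.mul_comm]
        rfl
    rw [h1, h3, h4] at h
    exact h

/-- `[e, E] = e`, since `L_E` is a derivation of degree one of the multiplication and `e · e = e`. -/
theorem lieBracket_unit_euler :
    fderiv 𝕜 (vecLoc φ F.euler) y (vecLoc φ F.unit y)
      - fderiv 𝕜 (vecLoc φ F.unit) y (vecLoc φ F.euler y) = vecLoc φ F.unit y := by
  have h1 := F.lie_mulLoc hφ hy (vecLoc φ F.unit y) (vecLoc φ F.unit y)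
  have he := F.differentiableAt_unit hφ hy
  have h2 := fderiv_clm_apply₂ (F.differentiableAt_mulLoc hφ hy) he he (vecLoc φ F.euler y)
  have h3 : (fun z => F.mulLoc φ z (vecLoc φ F.unit z) (vecLoc φ F.unit z))
      =ᶠ[𝓝 y] vecLoc φ F.unit := by
    filter_upwards [φ.open_target.mem_nhds hy] with z hz
    exact F.unit_mulLoc hφ hz _
  rw [h3.fderiv_eq] at h2
  rw [F.mulLoc_comm (fderiv 𝕜 (vecLoc φ F.euler) y (vecLoc φ F.unit y))] at h1
  rw [F.mulLoc_comm _ (vecLoc φ F.unit y)] at h2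
  simp only [F.unit_mulLoc hφ hy] at h1 h2
  linear_combination (exp := 1) h1 + h2

/-- The Christoffel symbols of `<,>` as a bilinear map. -/
abbrev ΓLoc (φ : CoordChart 𝕜 n M) (y u v : Fin n → 𝕜) : Fin n → 𝕜 :=
  christoffelVec (F.ηComp φ) y u v

omit hφ hy in
theorem sum_Γη_mul (i : Fin n) (j : Fin n) (v : Fin n → 𝕜) :
    ∑ m, F.Γη φ i j m y * v m = F.ΓLoc φ y (stdVec 𝕜 j) v i := by
  have h := map_eq_sum_stdVec ((isBilinearMap_christoffelVec (F.ηComp φ) y).toLinearMap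
    (stdVec 𝕜 j)) v
  have h' := congrFun h i
  rw [Finset.sum_apply] at h'
  refine Eq.trans (Finset.sum_congr rfl fun m _ => ?_) h'.symm
  rw [Pi.smul_apply, smul_eq_mul, _root_.mul_comm]
  congr 1
  exact (christoffelVec_stdVec _ _ _ _ _).symm

omit hφ hy in
theorem nablaVec_eq {X : VField 𝕜 n M} (hX : DifferentiableAt 𝕜 (vecLoc φ X) y) (i j : Fin n) :
    F.nablaVec φ X i j y = fderiv 𝕜 (vecLoc φ X) y (stdVec 𝕜 j) i
      + F.ΓLoc φ y (stdVec 𝕜 j) (vecLoc φ X y) i := by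
  rw [FrobeniusData.nablaVec, pd_vecComp hX, ← F.sum_Γη_mul]
  rfl

/-- `∇ e = 0`. -/
theorem fderiv_unit (u : Fin n → 𝕜) :
    fderiv 𝕜 (vecLoc φ F.unit) y u = -F.ΓLoc φ y u (vecLoc φ F.unit y) := by
  have h : ∀ j, fderiv 𝕜 (vecLoc φ F.unit) y (stdVec 𝕜 j)
      = -F.ΓLoc φ y (stdVec 𝕜 j) (vecLoc φ F.unit y) := fun j => by
    ext i
    have := F.nabla_unit φ hφ y hy i j
    rw [F.nablaVec_eq (F.differentiableAt_unit hφ hy)] at this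
    exact eq_neg_of_add_eq_zero_left this
  have h1 := map_eq_sum_stdVec (fderiv 𝕜 (vecLoc φ F.unit) y).toLinearMap u
  have h2 := map_eq_sum_stdVec ((isBilinearMap_christoffelVec (F.ηComp φ) y).toLinearMap.flip
    (vecLoc φ F.unit y)) u
  simp only [ContinuousLinearMap.coe_coe, h] at h1
  rw [h1]
  simp only [smul_neg, Finset.sum_neg_distrib]
  congr 1
  exact h2.symm

theorem differentiableAt_form : DifferentiableAt 𝕜 (fun z => formOfMatrix (F.ηComp φ z)) y := by
  simp_rw [← ηLoc_eq_formOfMatrix]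
  exact F.differentiableAt_ηLoc hφ hy

/-- `∇ <,> = 0`. -/
theorem fderiv_ηLoc (u v w : Fin n → 𝕜) : fderiv 𝕜 (F.ηLoc φ) y u v w
    = F.ηLoc φ y (F.ΓLoc φ y u v) w + F.ηLoc φ y v (F.ΓLoc φ y u w) := by
  have h := fderiv_form_eq (F.differentiableAt_form hφ hy)
    (Eventually.of_forall F.isSymm_ηComp) (F.det_ηComp_ne_zero hφ hy) u v w
  simp only [← ηLoc_eq_formOfMatrix] at h
  exact h

theorem ΓLoc_symm (u v : Fin n → 𝕜) : F.ΓLoc φ y u v = F.ΓLoc φ y v u :=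
  christoffelVec_symm (F.differentiableAt_form hφ hy)
    (Eventually.of_forall F.isSymm_ηComp) (F.det_ηComp_ne_zero hφ hy) u v

/-- The unity is a Killing vector field, `L_e <,> = 0`. -/
theorem lie_unit_ηLoc (u v : Fin n → 𝕜) :
    fderiv 𝕜 (F.ηLoc φ) y (vecLoc φ F.unit y) u v
      + F.ηLoc φ y (fderiv 𝕜 (vecLoc φ F.unit) y u) v
      + F.ηLoc φ y u (fderiv 𝕜 (vecLoc φ F.unit) y v) = 0 := by
  rw [F.fderiv_ηLoc hφ hy, F.fderiv_unit hφ hy, F.fderiv_unit hφ hy, F.ΓLoc_symm hφ hy u,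
    F.ΓLoc_symm hφ hy v]
  simp

theorem cComp_eq (i j k : Fin n) : F.cComp φ i j k y
    = F.ηLoc φ y (F.mulLoc φ y (stdVec 𝕜 i) (stdVec 𝕜 j)) (stdVec 𝕜 k) := by
  rw [ηLoc_apply, F.toTan_mulLoc hφ hy]
  rfl

theorem fderiv_cComp (i j k : Fin n) (u : Fin n → 𝕜) :
    fderiv 𝕜 (F.cComp φ i j k) y u
      = fderiv 𝕜 (F.ηLoc φ) y u (F.mulLoc φ y (stdVec 𝕜 i) (stdVec 𝕜 j)) (stdVec 𝕜 k)
        + F.ηLoc φ y (fderiv 𝕜 (F.mulLoc φ) y u (stdVec 𝕜 i) (stdVec 𝕜 j)) (stdVec 𝕜 k) := by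
  have h2 : F.cComp φ i j k =ᶠ[𝓝 y]
      fun z => F.ηLoc φ z (F.mulLoc φ z (stdVec 𝕜 i) (stdVec 𝕜 j)) (stdVec 𝕜 k) := by
    filter_upwards [φ.open_target.mem_nhds hy] with z hz
    exact F.cComp_eq hφ hz i j k
  have hm := F.differentiableAt_mulLoc hφ hy
  have h3 : DifferentiableAt 𝕜 (fun z => F.mulLoc φ z (stdVec 𝕜 i) (stdVec 𝕜 j)) y :=
    (hm.clm_apply (differentiableAt_const _)).clm_apply (differentiableAt_const _)
  have h4 := fderiv_clm_apply₂ hm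
    (differentiableAt_const (stdVec 𝕜 i)) (differentiableAt_const (stdVec 𝕜 j)) u
  rw [h2.fderiv_eq, fderiv_clm_apply₂ (F.differentiableAt_ηLoc hφ hy) h3
    (differentiableAt_const (stdVec 𝕜 k)) u, h4]
  simp

/-- The components `(∇_z c)(u, v, w)` of the covariant derivative of `c`. -/
def nablaCLoc (φ : CoordChart 𝕜 n M) (y z u v w : Fin n → 𝕜) : 𝕜 :=
  fderiv 𝕜 (F.ηLoc φ) y z (F.mulLoc φ y u v) w
    + F.ηLoc φ y (fderiv 𝕜 (F.mulLoc φ) y z u v) w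
    - (F.ηLoc φ y (F.mulLoc φ y (F.ΓLoc φ y z u) v) w
      + F.ηLoc φ y (F.mulLoc φ y u (F.ΓLoc φ y z v)) w
      + F.ηLoc φ y (F.mulLoc φ y u v) (F.ΓLoc φ y z w))

omit hφ hy in
theorem sum_Γη_mul_apply (i j : Fin n) (L : (Fin n → 𝕜) →ₗ[𝕜] 𝕜) :
    ∑ m, F.Γη φ m i j y * L (stdVec 𝕜 m) = L (F.ΓLoc φ y (stdVec 𝕜 i) (stdVec 𝕜 j)) := by
  rw [map_eq_sum_stdVec L]
  refine Finset.sum_congr rfl fun m _ => ?_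
  rw [show F.ΓLoc φ y (stdVec 𝕜 i) (stdVec 𝕜 j) m = F.Γη φ m i j y from
    christoffelVec_stdVec _ _ _ _ _, smul_eq_mul]

theorem nablaC_eq (l i j k : Fin n) : F.nablaC φ l i j k y
    = F.nablaCLoc φ y (stdVec 𝕜 l) (stdVec 𝕜 i) (stdVec 𝕜 j) (stdVec 𝕜 k) := by
  rw [FrobeniusData.nablaC, nablaCLoc]
  simp only [Finset.sum_add_distrib, F.cComp_eq hφ hy]
  have h1 := F.sum_Γη_mul_apply (φ := φ) (y := y) l i
    ((F.ηLoc φ y).flip (stdVec 𝕜 k) ∘L (F.mulLoc φ y).flip (stdVec 𝕜 j)).toLinearMap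
  have h2 := F.sum_Γη_mul_apply (φ := φ) (y := y) l j
    ((F.ηLoc φ y).flip (stdVec 𝕜 k) ∘L (F.mulLoc φ y) (stdVec 𝕜 i)).toLinearMap
  have h3 := F.sum_Γη_mul_apply (φ := φ) (y := y) l k
    (F.ηLoc φ y (F.mulLoc φ y (stdVec 𝕜 i) (stdVec 𝕜 j))).toLinearMap
  simp only [ContinuousLinearMap.coe_coe, ContinuousLinearMap.comp_apply,
    ContinuousLinearMap.flip_apply] at h1 h2 h3
  rw [h1, h2, h3, pd, F.fderiv_cComp hφ hy]

/-- `(∇_z c)(u, v, w) = (∇_u c)(z, v, w)`. -/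
theorem nablaCLoc_symm (z u v w : Fin n → 𝕜) :
    F.nablaCLoc φ y z u v w = F.nablaCLoc φ y u z v w := by
  have hΓ := isBilinearMap_christoffelVec (F.ηComp φ) y
  have hb1 : ∀ v w, IsBilinearMap 𝕜 fun z u => F.nablaCLoc φ y z u v w := by
    intro v w
    constructor <;> intros <;>
      simp only [nablaCLoc, hΓ.add_left, hΓ.add_right, hΓ.smul_left, hΓ.smul_right, map_add,
        map_smul, add_apply, smul_apply, smul_eq_mul] <;> ring
  have hb1' : ∀ v w, IsBilinearMap 𝕜 fun z u => F.nablaCLoc φ y u z v w := fun v w =>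
    ⟨fun _ _ _ => (hb1 v w).add_right _ _ _, fun _ _ _ => (hb1 v w).smul_right _ _ _,
      fun _ _ _ => (hb1 v w).add_left _ _ _, fun _ _ _ => (hb1 v w).smul_left _ _ _⟩
  have hb2 : ∀ z u, IsBilinearMap 𝕜 fun v w => F.nablaCLoc φ y z u v w := by
    intro z u
    constructor <;> intros <;>
      simp only [nablaCLoc, hΓ.add_right, hΓ.smul_right, map_add,
        map_smul, add_apply, smul_apply, smul_eq_mul] <;> ring
  refine eq_of_eq_on_stdVec (hb2 z u) (hb2 u z) (fun j k => ?_) v w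
  refine eq_of_eq_on_stdVec (hb1 _ _) (hb1' _ _) (fun l i => ?_) z u
  rw [← F.nablaC_eq hφ hy, ← F.nablaC_eq hφ hy]
  exact F.nabla_c_symm φ hφ y hy l i j k

/-- `L_e c = 0` for the multiplication: this is `∇_e c`, which vanishes because by symmetry it is the
derivative of `c(e, ·, ·) = <,>`. -/
theorem lie_unit_mulLoc (u v : Fin n → 𝕜) :
    fderiv 𝕜 (F.mulLoc φ) y (vecLoc φ F.unit y) u v
      - fderiv 𝕜 (vecLoc φ F.unit) y (F.mulLoc φ y u v)
      + F.mulLoc φ y (fderiv 𝕜 (vecLoc φ F.unit) y u) v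
      + F.mulLoc φ y u (fderiv 𝕜 (vecLoc φ F.unit) y v) = 0 := by
  refine F.ηLoc_ext hφ hy fun w => ?_
  have h := F.nablaCLoc_symm hφ hy (vecLoc φ F.unit y) u v w
  have he := F.differentiableAt_unit hφ hy
  -- the derivative of `e · v = v`
  have h2 := fderiv_clm_apply₂ (F.differentiableAt_mulLoc hφ hy) he (differentiableAt_const v) u
  have h3 : (fun z => F.mulLoc φ z (vecLoc φ F.unit z) v) =ᶠ[𝓝 y] fun _ => v := by
    filter_upwards [φ.open_target.mem_nhds hy] with z hz
    exact F.unit_mulLoc hφ hz _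
  rw [h3.fderiv_eq] at h2
  have h4 := F.lie_unit_ηLoc hφ hy (F.mulLoc φ y u v) w
  have h5 := F.fderiv_ηLoc hφ hy u v w
  have h6 := congrArg (fun x => F.ηLoc φ y x w) h2
  have hs := F.ΓLoc_symm hφ hy
  have hun := F.unit_mulLoc hφ hy
  have hde := F.fderiv_unit hφ hy
  simp only [nablaCLoc, hun, hs (vecLoc φ F.unit y)] at h
  simp only [fderiv_fun_const, hde, map_neg, neg_apply, add_apply, map_add, map_zero,
    Pi.zero_apply, zero_apply, add_zero] at h4 h6
  simp only [hde, map_neg, neg_apply, map_add, map_sub, add_apply, sub_apply, map_zero, zero_apply]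
  linear_combination h - h4 + h5 - h6

end
end FrobeniusManifold
end LocalAxioms

/-! ### Lie derivatives and quasihomogeneity -/

section Quasihomogeneous

variable {𝕜 : Type*} [RCLike 𝕜] {n : ℕ} {M : Type*} [TopologicalSpace M]
  [ChartedSpace (Fin n → 𝕜) M] (F : FrobeniusManifold 𝕜 n M) {φ : CoordChart 𝕜 n M}

namespace FrobeniusManifold

section

variable (hφ : IsCoordinatePatch φ) {y : Fin n → 𝕜} (hy : y ∈ φ.target)
include hφ hy

/-- `∑_k ∂_k X^i (dx^k)^♯`, the dual vector of `dx^i ∘ ∇X`. -/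
def sharpDeriv (φ : CoordChart 𝕜 n M) (X : VField 𝕜 n M) (i : Fin n) (y : Fin n → 𝕜) :
    Fin n → 𝕜 :=
  ∑ k, pd k (vecComp X φ i) y • F.sharpLoc φ k y

theorem ηLoc_sharpDeriv {X : VField 𝕜 n M} (hX : DifferentiableAt 𝕜 (vecLoc φ X) y) (i : Fin n)
    (v : Fin n → 𝕜) : F.ηLoc φ y (F.sharpDeriv φ X i y) v
      = F.ηLoc φ y (F.sharpLoc φ i y) (fderiv 𝕜 (vecLoc φ X) y v) := by
  rw [F.ηLoc_sharpLoc hφ hy, ← sum_mul_pd_vecComp hX, sharpDeriv]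
  simp only [map_sum, map_smul, sum_apply, smul_apply, F.ηLoc_sharpLoc hφ hy, smul_eq_mul]
  exact Finset.sum_congr rfl fun _ _ => _root_.mul_comm _ _

/-- If `L_X <,> = κ <,>`, this computes the derivative of `(dx^i)^♯` along `X`. -/
theorem fderiv_sharpLoc {X : VField 𝕜 n M} (hX : DifferentiableAt 𝕜 (vecLoc φ X) y) {κ : 𝕜}
    (hκ : ∀ u v, fderiv 𝕜 (F.ηLoc φ) y (vecLoc φ X y) u v
      + F.ηLoc φ y (fderiv 𝕜 (vecLoc φ X) y u) v
      + F.ηLoc φ y u (fderiv 𝕜 (vecLoc φ X) y v) = κ * F.ηLoc φ y u v) (i : Fin n) :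
    fderiv 𝕜 (F.sharpLoc φ i) y (vecLoc φ X y)
      = fderiv 𝕜 (vecLoc φ X) y (F.sharpLoc φ i y) + F.sharpDeriv φ X i y
        - κ • F.sharpLoc φ i y := by
  refine F.ηLoc_ext hφ hy fun v => ?_
  have h1 := fderiv_clm_apply₂ (F.differentiableAt_ηLoc hφ hy)
    (F.differentiableAt_sharpLoc hφ hy i) (differentiableAt_const v) (vecLoc φ X y)
  have h3 : (fun z => F.ηLoc φ z (F.sharpLoc φ i z) v) =ᶠ[𝓝 y] fun _ => v i := by
    filter_upwards [φ.open_target.mem_nhds hy] with z hz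
    exact F.ηLoc_sharpLoc hφ hz i v
  rw [h3.fderiv_eq] at h1
  simp only [fderiv_fun_const, Pi.zero_apply, zero_apply, map_zero, add_zero] at h1
  have h2 := hκ (F.sharpLoc φ i y) v
  have h4 := F.ηLoc_sharpDeriv hφ hy hX i v
  simp only [map_add, map_sub, map_smul, add_apply, sub_apply, smul_apply, smul_eq_mul, h4]
  linear_combination -h2 - h1

theorem lieContra_eq {X : VField 𝕜 n M} (hX : DifferentiableAt 𝕜 (vecLoc φ X) y)
    {g : ContraForm 𝕜 n M} {A : (Fin n → 𝕜) → (Fin n → 𝕜) →L[𝕜] (Fin n → 𝕜)}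
    (hA : DifferentiableAt 𝕜 A y)
    (hg : ∀ z ∈ φ.target, ∀ i j, contraComp g φ z i j = A z (F.sharpLoc φ i z) j) (i j : Fin n) :
    lieContra X g φ i j y = (fderiv 𝕜 A y (vecLoc φ X y) (F.sharpLoc φ i y)
      + A y (fderiv 𝕜 (F.sharpLoc φ i) y (vecLoc φ X y))
      - A y (F.sharpDeriv φ X i y) - fderiv 𝕜 (vecLoc φ X) y (A y (F.sharpLoc φ i y))) j := by
  rw [lieContra]
  simp only [Finset.sum_sub_distrib]
  have hS := F.differentiableAt_sharpLoc hφ hy i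
  have h1 : ∑ k, vecComp X φ k y * pd k (fun z => contraComp g φ z i j) y
      = (fderiv 𝕜 A y (vecLoc φ X y) (F.sharpLoc φ i y)
        + A y (fderiv 𝕜 (F.sharpLoc φ i) y (vecLoc φ X y))) j := by
    have e : (fun z => contraComp g φ z i j) =ᶠ[𝓝 y] fun z => A z (F.sharpLoc φ i z) j := by
      filter_upwards [φ.open_target.mem_nhds hy] with z hz
      exact hg z hz i j
    have e1 : ∑ k, vecComp X φ k y * pd k (fun z => contraComp g φ z i j) y
        = fderiv 𝕜 (fun z => contraComp g φ z i j) y (vecLoc φ X y) := by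
      rw [← sum_mul_pd]
      rfl
    have e2 : DifferentiableAt 𝕜 (fun z => A z (F.sharpLoc φ i z)) y := hA.clm_apply hS
    rw [e1, e.fderiv_eq, fderiv_apply e2, (hA.hasFDerivAt.clm_apply hS.hasFDerivAt).fderiv]
    simp [add_comm]
  have h2 : ∑ k, contraComp g φ y k j * pd k (vecComp X φ i) y
      = A y (F.sharpDeriv φ X i y) j := by
    simp only [sharpDeriv, map_sum, map_smul, Finset.sum_apply, Pi.smul_apply, smul_eq_mul,
      hg y hy]
    exact Finset.sum_congr rfl fun _ _ => _root_.mul_comm _ _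
  have h3 : ∑ k, contraComp g φ y i k * pd k (vecComp X φ j) y
      = fderiv 𝕜 (vecLoc φ X) y (A y (F.sharpLoc φ i y)) j := by
    simp only [hg y hy]
    exact sum_mul_pd_vecComp hX _ _
  rw [h1, h2, h3]
  rfl

theorem lie_unit_cotMetric (i j : Fin n) : lieContra F.unit F.cotMetric φ i j y = 0 := by
  have hX := F.differentiableAt_unit hφ hy
  rw [F.lieContra_eq hφ hy hX (A := fun _ => ContinuousLinearMap.id 𝕜 (Fin n → 𝕜))
    (differentiableAt_const _) (fun z hz i j => F.contraComp_cotMetric hφ hz i j),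
    F.fderiv_sharpLoc hφ hy hX (κ := 0) (by simpa using F.lie_unit_ηLoc hφ hy)]
  simp

theorem differentiableAt_mulLoc_euler :
    DifferentiableAt 𝕜 (fun z => F.mulLoc φ z (vecLoc φ F.euler z)) y :=
  (F.differentiableAt_mulLoc hφ hy).clm_apply (F.differentiableAt_euler hφ hy)

theorem fderiv_mulLoc_euler (u v : Fin n → 𝕜) :
    fderiv 𝕜 (fun z => F.mulLoc φ z (vecLoc φ F.euler z)) y u v
      = fderiv 𝕜 (F.mulLoc φ) y u (vecLoc φ F.euler y) v
        + F.mulLoc φ y (fderiv 𝕜 (vecLoc φ F.euler) y u) v := by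
  rw [((F.differentiableAt_mulLoc hφ hy).hasFDerivAt.clm_apply
    (F.differentiableAt_euler hφ hy).hasFDerivAt).fderiv]
  simp [add_comm]

theorem lie_unit_intersectionForm (i j : Fin n) :
    lieContra F.unit F.intersectionForm φ i j y = contraComp F.cotMetric φ y i j := by
  have hX := F.differentiableAt_unit hφ hy
  rw [F.lieContra_eq hφ hy hX (F.differentiableAt_mulLoc_euler hφ hy)
    (fun z hz i j => F.contraComp_intersectionForm hφ hz i j),
    F.fderiv_sharpLoc hφ hy hX (κ := 0) (by simpa using F.lie_unit_ηLoc hφ hy),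
    F.contraComp_cotMetric hφ hy, F.fderiv_mulLoc_euler hφ hy]
  have h1 := congrFun (F.lie_unit_mulLoc hφ hy (vecLoc φ F.euler y) (F.sharpLoc φ i y)) j
  have h2 := congrArg (fun x => F.mulLoc φ y x (F.sharpLoc φ i y)) (F.lieBracket_unit_euler hφ hy)
  simp only [F.unit_mulLoc hφ hy, map_sub, sub_apply] at h2
  have h3 := congrFun h2 j
  simp only [zero_smul, sub_zero, map_add, Pi.add_apply, Pi.sub_apply, Pi.zero_apply] at h1 h3 ⊢
  linear_combination h1 + h3

theorem lie_euler_intersectionForm (i j : Fin n) :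
    lieContra F.euler F.intersectionForm φ i j y
      = (F.d - 1) * contraComp F.intersectionForm φ y i j := by
  have hX := F.differentiableAt_euler hφ hy
  rw [F.lieContra_eq hφ hy hX (F.differentiableAt_mulLoc_euler hφ hy)
    (fun z hz i j => F.contraComp_intersectionForm hφ hz i j),
    F.fderiv_sharpLoc hφ hy hX (F.lie_ηLoc hφ hy),
    F.contraComp_intersectionForm hφ hy, F.fderiv_mulLoc_euler hφ hy]
  have h1 := congrFun (F.lie_mulLoc hφ hy (vecLoc φ F.euler y) (F.sharpLoc φ i y)) j
  simp only [map_add, map_sub, map_smul, Pi.add_apply, Pi.sub_apply, Pi.smul_apply,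
    smul_eq_mul] at h1 ⊢
  linear_combination h1

end

theorem mul_unit (x : M) (u : Tan 𝕜 n x) :
    F.mul x u (F.unit x) = u := by rw [F.mul_comm, F.one_mul]

theorem inverse_mfderiv_symm {φ : CoordChart 𝕜 n M} (hφ : IsCoordinatePatch φ) {y : Fin n → 𝕜}
    (hy : y ∈ φ.target) (v : Tan 𝕜 n (φ.symm y)) :
    (mfderiv 𝓘(𝕜, Fin n → 𝕜) 𝓘(𝕜, Fin n → 𝕜) φ.symm y).inverse v = ofTan φ y v := by
  have h := ContinuousLinearMap.inverse_eq
    (f := mfderiv 𝓘(𝕜, Fin n → 𝕜) 𝓘(𝕜, Fin n → 𝕜) φ.symm y)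
    (g := mfderiv 𝓘(𝕜, Fin n → 𝕜) 𝓘(𝕜, Fin n → 𝕜) φ (φ.symm y))
    (by ext1 v; exact toTan_ofTan hφ hy v) (by ext1 v; exact ofTan_toTan hφ hy v)
  exact DFunLike.congr_fun h v

/-- `[e, E] = e` on the manifold. -/
theorem mlieBracket_unit_euler [IsManifold 𝓘(𝕜, Fin n → 𝕜) ∞ M] (x : M) :
    VectorField.mlieBracket 𝓘(𝕜, Fin n → 𝕜) F.unit F.euler x = F.unit x := by
  set φ : CoordChart 𝕜 n M := chartAt (Fin n → 𝕜) x with hφdef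
  have hφ : IsCoordinatePatch φ := IsManifold.chart_mem_maximalAtlas x
  have hx : x ∈ φ.source := mem_chart_source _ x
  have hy : φ x ∈ φ.target := φ.map_source hx
  have hpull : ∀ X : VField 𝕜 n M, VectorField.mpullbackWithin 𝓘(𝕜, Fin n → 𝕜)
      𝓘(𝕜, Fin n → 𝕜) (extChartAt 𝓘(𝕜, Fin n → 𝕜) x).symm X (range 𝓘(𝕜, Fin n → 𝕜))
      =ᶠ[𝓝 (φ x)] vecLoc φ X := by
    intro X
    filter_upwards [φ.open_target.mem_nhds hy] with z hz
    change (mfderivWithin 𝓘(𝕜, Fin n → 𝕜) 𝓘(𝕜, Fin n → 𝕜) φ.symm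
      (range 𝓘(𝕜, Fin n → 𝕜)) z).inverse (X (φ.symm z)) = _
    rw [ModelWithCorners.range_eq_univ, mfderivWithin_univ, inverse_mfderiv_symm hφ hz,
      ofTan_eq_vecLoc hφ hz]
  rw [← VectorField.mlieBracketWithin_univ, VectorField.mlieBracketWithin_apply]
  have hset : (extChartAt 𝓘(𝕜, Fin n → 𝕜) x).symm ⁻¹' univ ∩ range 𝓘(𝕜, Fin n → 𝕜) = univ := by
    simp
  have hbr : ∀ (A B : (Fin n → 𝕜) → Fin n → 𝕜) (s : Set (Fin n → 𝕜)),
      A =ᶠ[𝓝 (φ x)] vecLoc φ F.unit → B =ᶠ[𝓝 (φ x)] vecLoc φ F.euler → s = univ →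
      VectorField.lieBracketWithin 𝕜 A B s (φ x) = vecLoc φ F.unit (φ x) := by
    rintro A B _ hA hB rfl
    rw [VectorField.lieBracketWithin_univ, hA.lieBracket_vectorField_eq hB]
    exact F.lieBracket_unit_euler hφ hy
  refine Eq.trans (congrArg (mfderiv 𝓘(𝕜, Fin n → 𝕜) 𝓘(𝕜, Fin n → 𝕜) φ x).inverse
    (hbr _ _ _ (hpull F.unit) (hpull F.euler) hset)) ?_
  have hl : (mfderiv 𝓘(𝕜, Fin n → 𝕜) 𝓘(𝕜, Fin n → 𝕜) φ x).inverse
      = mfderiv 𝓘(𝕜, Fin n → 𝕜) 𝓘(𝕜, Fin n → 𝕜) φ.symm (φ x) := by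
    refine ContinuousLinearMap.inverse_eq ?_ (hφ.mdifferentiable.symm_comp_deriv hx)
    have := hφ.mdifferentiable.comp_symm_deriv hy
    rwa [φ.left_inv hx] at this
  rw [hl]
  have h := toTan_vecLoc hφ hy F.unit
  rw [φ.left_inv hx] at h
  exact h

/-- A function `τ` with `dτ = <e, ·>` makes the pencil quasihomogeneous. -/
theorem isQuasihomogeneousWith [IsManifold 𝓘(𝕜, Fin n → 𝕜) ∞ M] {U : Set M} {τ : M → 𝕜}
    (hτ : ContMDiffOn 𝓘(𝕜, Fin n → 𝕜) 𝓘(𝕜, 𝕜) ∞ τ U)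
    (hd : ∀ x ∈ U, dif τ x = F.η x (F.unit x)) :
    IsQuasihomogeneousWith U F.intersectionForm F.cotMetric F.d τ F.euler F.unit := by
  have hs : ∀ x ∈ U, (F.flatIso x).symm (dif τ x) = F.unit x := fun x hx => by
    rw [LinearEquiv.symm_apply_eq, hd x hx]
    rfl
  refine ⟨hτ, fun x hx u => ?_, fun x hx u => ?_, fun x _ => F.mlieBracket_unit_euler x,
    fun φ hφ y hy _ i j => F.lie_euler_intersectionForm hφ hy i j,
    fun φ hφ y hy _ i j => F.lie_unit_intersectionForm hφ hy i j,
    fun φ hφ y hy _ i j => F.lie_unit_cotMetric hφ hy i j⟩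
  · change _ = F.η x (F.mul x _ _) (F.euler x)
    rw [hs x hx, mul_unit, η_flatIso_symm]
  · change _ = F.η x _ _
    rw [hs x hx, η_flatIso_symm]

end FrobeniusManifold
end Quasihomogeneous

/-! ### The pencil as multiplication by `E - λ` -/

section ContravariantMetric

variable {𝕜 : Type*} [RCLike 𝕜] {n : ℕ} {M : Type*} [TopologicalSpace M]
  [ChartedSpace (Fin n → 𝕜) M] {φ : CoordChart 𝕜 n M}

/-- A form on the cotangent space is invertible iff its matrix in a coordinate patch is. -/
theorem mem_invertibleLocus_iff (hφ : IsCoordinatePatch φ) {y : Fin n → 𝕜} (hy : y ∈ φ.target)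
    (g : ContraForm 𝕜 n M) :
    φ.symm y ∈ invertibleLocus g ↔ (contraComp g φ y).det ≠ 0 := by
  let e : Tan 𝕜 n (φ.symm y) ≃ₗ[𝕜] (Fin n → 𝕜) :=
    { ofTan φ y with
      invFun := toTan φ y
      left_inv := toTan_ofTan hφ hy
      right_inv := ofTan_toTan hφ hy }
  let b : Module.Basis (Fin n) 𝕜 (Tan 𝕜 n (φ.symm y)) := Module.Basis.ofEquivFun e
  have hb : ∀ i, b.dualBasis i = coframe φ i y := by
    intro i
    ext v
    rw [coframe_apply hφ hy, Module.Basis.coe_dualBasis, Module.Basis.coord_apply]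
    rfl
  have hm : LinearMap.BilinForm.toMatrix b.dualBasis (g (φ.symm y)) = contraComp g φ y := by
    ext i j
    rw [LinearMap.BilinForm.toMatrix_apply, hb, hb]
    rfl
  rw [← hm]
  exact LinearMap.BilinForm.nondegenerate_iff_det_ne_zero b.dualBasis

theorem isOpen_invertibleLocus [IsManifold 𝓘(𝕜, Fin n → 𝕜) ∞ M] {g : ContraForm 𝕜 n M}
    (hg : ∀ φ, IsCoordinatePatch φ → ∀ i j,
      ContDiffOn 𝕜 ∞ (fun y => contraComp g φ y i j) φ.target) : IsOpen (invertibleLocus g) := by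
  rw [isOpen_iff_mem_nhds]
  intro x hx
  set φ : CoordChart 𝕜 n M := chartAt (Fin n → 𝕜) x with hφdef
  have hφ : IsCoordinatePatch φ := IsManifold.chart_mem_maximalAtlas x
  have hxs : x ∈ φ.source := mem_chart_source _ x
  have hiff : ∀ z ∈ φ.source, z ∈ invertibleLocus g ↔ (contraComp g φ (φ z)).det ≠ 0 := by
    intro z hz
    rw [← mem_invertibleLocus_iff hφ (φ.map_source hz) g, φ.left_inv hz]
  have hc : ContinuousAt (fun z => (contraComp g φ (φ z)).det) x := by
    have h1 := ((contDiffOn_det (hg φ hφ)).contDiffAt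
      (φ.open_target.mem_nhds (φ.map_source hxs))).continuousAt
    exact ContinuousAt.comp (f := φ) h1 (φ.continuousAt hxs)
  filter_upwards [φ.open_source.mem_nhds hxs,
    hc.eventually_ne ((hiff x hxs).1 hx)] with z hz hz'
  exact (hiff z hz).2 hz'

theorem contraComp_isSymm {g : ContraForm 𝕜 n M} (hg : ∀ x u v, g x u v = g x v u)
    (y : Fin n → 𝕜) : (contraComp g φ y).IsSymm := by
  ext i j
  exact hg _ _ _

variable (F : FrobeniusManifold 𝕜 n M)

namespace FrobeniusManifold

/-- The pencil `(,) - lam <,>`. -/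
abbrev metricPencil (lam : 𝕜) : ContraForm 𝕜 n M := pencil F.intersectionForm F.cotMetric lam

/-- Multiplication by `E - lam`, read in the coordinates `φ`. It turns `<,>` into the pencil. -/
def pencilOp (φ : CoordChart 𝕜 n M) (lam : 𝕜) (y : Fin n → 𝕜) :
    (Fin n → 𝕜) →L[𝕜] (Fin n → 𝕜) :=
  F.mulLoc φ y (vecLoc φ F.euler y) - lam • ContinuousLinearMap.id 𝕜 (Fin n → 𝕜)

theorem pencilOp_apply (lam : 𝕜) (y u : Fin n → 𝕜) : F.pencilOp φ lam y u
    = F.mulLoc φ y (vecLoc φ F.euler y) u - lam • u := rfl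

theorem metricPencil_symm (lam : 𝕜) (x : M) (u v : Cotan 𝕜 n x) :
    F.metricPencil lam x u v = F.metricPencil lam x v u := by
  have h1 : F.intersectionForm x u v = F.intersectionForm x v u := by
    change F.η x (F.mul x _ _) _ = F.η x (F.mul x _ _) _
    rw [F.mul_comm]
  have h2 : F.cotMetric x u v = F.cotMetric x v u := F.η_symm x _ _
  change F.intersectionForm x u v - lam * F.cotMetric x u v
    = F.intersectionForm x v u - lam * F.cotMetric x v u
  rw [h1, h2]

section

variable (hφ : IsCoordinatePatch φ)
include hφ

theorem contraComp_metricPencil {y : Fin n → 𝕜} (hy : y ∈ φ.target) (lam : 𝕜) (i j : Fin n) :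
    contraComp (F.metricPencil lam) φ y i j = F.pencilOp φ lam y (F.sharpLoc φ i y) j := by
  have h : contraComp (F.metricPencil lam) φ y i j
    = contraComp F.intersectionForm φ y i j - lam * contraComp F.cotMetric φ y i j := rfl
  rw [h, F.contraComp_intersectionForm hφ hy, F.contraComp_cotMetric hφ hy]
  rfl

theorem contDiffOn_pencilOp (lam : 𝕜) : ContDiffOn 𝕜 ∞ (F.pencilOp φ lam) φ.target :=
  ((F.contDiffOn_mulLoc hφ).clm_apply (F.contDiffOn_vecLoc_euler hφ)).sub contDiffOn_const

theorem contDiffOn_contraComp_metricPencil (lam : 𝕜) (i j : Fin n) :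
    ContDiffOn 𝕜 ∞ (fun y => contraComp (F.metricPencil lam) φ y i j) φ.target := by
  have h := (F.contDiffOn_pencilOp hφ lam).clm_apply (F.contDiffOn_sharpLoc hφ i)
  exact (contDiffOn_pi.1 h j).congr fun y hy => F.contraComp_metricPencil hφ hy lam i j

theorem contDiffOn_contraComp_cotMetric (i j : Fin n) :
    ContDiffOn 𝕜 ∞ (fun y => contraComp F.cotMetric φ y i j) φ.target :=
  (contDiffOn_pi.1 (F.contDiffOn_sharpLoc hφ i) j).congr
    fun _ hy => F.contraComp_cotMetric hφ hy i j

theorem det_contraComp_cotMetric_ne_zero {y : Fin n → 𝕜} (hy : y ∈ φ.target) :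
    (contraComp F.cotMetric φ y).det ≠ 0 := by
  have h : contraComp F.cotMetric φ y = (F.ηComp φ y)⁻¹ := by
    ext i j
    rw [F.inv_ηComp hφ hy, F.contraComp_cotMetric hφ hy]
  rw [h]
  exact (Matrix.isUnit_nonsing_inv_det _ (F.det_ηComp_ne_zero hφ hy).isUnit).ne_zero

end

theorem metricPencil_zero : F.metricPencil 0 = F.intersectionForm := by
  funext x
  simp only [pencil, zero_smul]
  exact sub_zero (F.intersectionForm x)

end FrobeniusManifold
end ContravariantMetric

section FlatChart

variable {𝕜 : Type*} [RCLike 𝕜] {n : ℕ} {M : Type*} [TopologicalSpace M]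
  [ChartedSpace (Fin n → 𝕜) M] (F : FrobeniusManifold 𝕜 n M) {φ : CoordChart 𝕜 n M}

namespace FrobeniusManifold

variable (hφ : F.IsFlatChart φ) {y : Fin n → 𝕜} (hy : y ∈ φ.target)
include hφ hy

theorem ηLoc_const {z : Fin n → 𝕜} (hz : z ∈ φ.target) : F.ηLoc φ z = F.ηLoc φ y := by
  rw [ηLoc_eq_formOfMatrix, ηLoc_eq_formOfMatrix, hφ.2 z hz y hy]

theorem sharpLoc_const {z : Fin n → 𝕜} (hz : z ∈ φ.target) (i : Fin n) :
    F.sharpLoc φ i z = F.sharpLoc φ i y := by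
  ext j
  rw [← F.inv_ηComp hφ.1 hz, ← F.inv_ηComp hφ.1 hy, hφ.2 z hz y hy]

theorem fderiv_ηLoc_flat : fderiv 𝕜 (F.ηLoc φ) y = 0 := by
  have h : F.ηLoc φ =ᶠ[𝓝 y] fun _ => F.ηLoc φ y := by
    filter_upwards [φ.open_target.mem_nhds hy] with z hz using F.ηLoc_const hφ hy hz
  rw [h.fderiv_eq]
  exact fderiv_const_apply _

theorem ΓLoc_flat (u v : Fin n → 𝕜) : F.ΓLoc φ y u v = 0 := by
  refine F.ηLoc_ext hφ.1 hy fun w => ?_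
  have h := form_christoffelVec (F.differentiableAt_form hφ.1 hy)
    (Eventually.of_forall F.isSymm_ηComp) (F.det_ηComp_ne_zero hφ.1 hy) u v w
  have h0 := F.fderiv_ηLoc_flat hφ hy
  simp only [← ηLoc_eq_formOfMatrix] at h
  rw [h, h0]
  simp

theorem fderiv_unit_flat : fderiv 𝕜 (vecLoc φ F.unit) y = 0 := by
  ext1 u
  rw [F.fderiv_unit hφ.1 hy, F.ΓLoc_flat hφ hy]
  simp

/-- In flat coordinates `∂_u c` is symmetric, `(∂_u c)(v, w) = (∂_v c)(u, w)`. -/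
theorem fderiv_mulLoc_symm (u v w : Fin n → 𝕜) :
    fderiv 𝕜 (F.mulLoc φ) y u v w = fderiv 𝕜 (F.mulLoc φ) y v u w := by
  refine F.ηLoc_ext hφ.1 hy fun x => ?_
  have h := F.nablaCLoc_symm hφ.1 hy u v w x
  simpa [nablaCLoc, F.fderiv_ηLoc_flat hφ hy, F.ΓLoc_flat hφ hy] using h

theorem fderiv_mulLoc_comm (u v w : Fin n → 𝕜) :
    fderiv 𝕜 (F.mulLoc φ) y u v w = fderiv 𝕜 (F.mulLoc φ) y u w v := by
  have h := fun a b => fderiv_clm_apply₂ (F.differentiableAt_mulLoc hφ.1 hy)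
    (differentiableAt_const a) (differentiableAt_const b) u
  have h1 := h v w
  have h2 := h w v
  have h3 : (fun z => F.mulLoc φ z v w) = fun z => F.mulLoc φ z w v :=
    funext fun z => F.mulLoc_comm v w
  simp only [fderiv_fun_const, Pi.zero_apply, zero_apply, map_zero, add_zero] at h1 h2
  rw [← h1, ← h2, h3]

/-- By the symmetry of `∂c` and of `c`, `(∂_u c)(q, v)` is symmetric in `u, v`. -/
theorem fderiv_mulLoc_symm_right (u q v : Fin n → 𝕜) :
    fderiv 𝕜 (F.mulLoc φ) y u q v = fderiv 𝕜 (F.mulLoc φ) y v q u := by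
  rw [F.fderiv_mulLoc_symm hφ hy u q v, F.fderiv_mulLoc_comm hφ hy q u v,
    F.fderiv_mulLoc_symm hφ hy q v u]

/-- `∇∇E = 0`: the derivative of `E` is locally constant in flat coordinates. -/
theorem hasFDerivAt_fderiv_euler : HasFDerivAt (𝕜 := 𝕜) (fderiv 𝕜 (vecLoc φ F.euler))
    (0 : (Fin n → 𝕜) →L[𝕜] (Fin n → 𝕜) →L[𝕜] (Fin n → 𝕜)) y := by
  have hsm : ContDiffAt 𝕜 ∞ (vecLoc φ F.euler) y :=
    (F.contDiffOn_vecLoc_euler hφ.1).contDiffAt (φ.open_target.mem_nhds hy)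
  have hd : DifferentiableAt 𝕜 (fderiv 𝕜 (vecLoc φ F.euler)) y :=
    (hsm.fderiv_right (m := 1) (by norm_cast)).differentiableAt (by simp)
  have h0 : fderiv 𝕜 (fderiv 𝕜 (vecLoc φ F.euler)) y = 0 := by
    have hb : ∀ u v, fderiv 𝕜 (fderiv 𝕜 (vecLoc φ F.euler)) y u v = 0 := by
      refine eq_of_eq_on_stdVec (g := fun _ _ => 0) (isBilinearMap_clm _)
        ⟨by simp, by simp, by simp, by simp⟩ fun k j => ?_
      ext i
      have h := F.nabla_nabla_euler φ hφ.1 y hy i k j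
      have hΓ : ∀ i j k, F.Γη φ i j k y = 0 := fun i j k => by
        have := congrFun (F.ΓLoc_flat hφ hy (stdVec 𝕜 j) (stdVec 𝕜 k)) i
        rw [show F.ΓLoc φ y (stdVec 𝕜 j) (stdVec 𝕜 k) i = F.Γη φ i j k y from
          christoffelVec_stdVec _ _ _ _ _] at this
        exact this
      simp only [FrobeniusData.nablaNablaVec, hΓ, zero_mul, sub_zero, Finset.sum_const_zero,
        add_zero] at h
      have he : F.nablaVec φ F.euler i j =ᶠ[𝓝 y]
          fun z => fderiv 𝕜 (vecLoc φ F.euler) z (stdVec 𝕜 j) i := by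
        filter_upwards [φ.open_target.mem_nhds hy] with z hz
        rw [F.nablaVec_eq (F.differentiableAt_euler hφ.1 hz), F.ΓLoc_flat hφ hz]
        simp
      have hd' : DifferentiableAt 𝕜 (fun z => fderiv 𝕜 (vecLoc φ F.euler) z (stdVec 𝕜 j)) y :=
        hd.clm_apply (differentiableAt_const _)
      rw [pd, he.fderiv_eq, fderiv_apply hd',
        (hd.hasFDerivAt.clm_apply (hasFDerivAt_const (stdVec 𝕜 j) y)).fderiv] at h
      simpa using h
    ext1 u
    ext1 v
    exact hb u v
  exact h0 ▸ hd.hasFDerivAt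

omit hφ hy in
/-- The operator `R = (d - 1) / 2 + ∇E` in flat coordinates. -/
def rOp (φ : CoordChart 𝕜 n M) (y : Fin n → 𝕜) : (Fin n → 𝕜) →L[𝕜] (Fin n → 𝕜) :=
  ((F.d - 1) / 2) • ContinuousLinearMap.id 𝕜 (Fin n → 𝕜) + fderiv 𝕜 (vecLoc φ F.euler) y

omit hφ hy in
theorem rOp_apply (u : Fin n → 𝕜) : F.rOp φ y u
    = ((F.d - 1) / 2) • u + fderiv 𝕜 (vecLoc φ F.euler) y u := rfl

theorem hasFDerivAt_rOp : HasFDerivAt (𝕜 := 𝕜) (F.rOp φ)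
    (0 : (Fin n → 𝕜) →L[𝕜] (Fin n → 𝕜) →L[𝕜] (Fin n → 𝕜)) y := by
  have h := (hasFDerivAt_const (((F.d - 1) / 2) • ContinuousLinearMap.id 𝕜 (Fin n → 𝕜)) y).add
    (F.hasFDerivAt_fderiv_euler hφ hy)
  rw [add_zero] at h
  exact h

/-- The adjoint of `R` with respect to `<,>` is `1 - R`. -/
theorem ηLoc_rOp (u v : Fin n → 𝕜) :
    F.ηLoc φ y (F.rOp φ y u) v = F.ηLoc φ y u v - F.ηLoc φ y u (F.rOp φ y v) := by
  have h := F.lie_ηLoc hφ.1 hy u v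
  simp only [F.fderiv_ηLoc_flat hφ hy, zero_apply, zero_add] at h
  simp only [rOp_apply, map_add, map_smul, add_apply, smul_apply, smul_eq_mul]
  linear_combination h

theorem differentiableAt_pencilOp (lam : 𝕜) : DifferentiableAt 𝕜 (F.pencilOp φ lam) y :=
  (F.contDiffOn_pencilOp hφ.1 lam).differentiableAt_of_mem_target hy

/-- The derivative of multiplication by `E - lam` in flat coordinates. -/
theorem fderiv_pencilOp (lam : 𝕜) (u w : Fin n → 𝕜) :
    fderiv 𝕜 (F.pencilOp φ lam) y u w = F.mulLoc φ y u w
      + F.rOp φ y (F.mulLoc φ y u w) - F.mulLoc φ y u (F.rOp φ y w) := by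
  have h0 : fderiv 𝕜 (F.pencilOp φ lam) y
      = fderiv 𝕜 (fun z => F.mulLoc φ z (vecLoc φ F.euler z)) y :=
    fderiv_sub_const (f := fun z => F.mulLoc φ z (vecLoc φ F.euler z)) _
  have h1 := F.lie_mulLoc hφ.1 hy u w
  rw [h0, F.fderiv_mulLoc_euler hφ.1 hy, F.fderiv_mulLoc_symm hφ hy]
  simp only [rOp_apply, map_add, map_smul]
  linear_combination (exp := 1) h1

end FrobeniusManifold
end FlatChart

/-! ### Density of the invertible locus and the Christoffel symbols in flat coordinates -/

section Density

variable {𝕜 : Type*} [RCLike 𝕜] {n : ℕ} {M : Type*} [TopologicalSpace M]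
  [ChartedSpace (Fin n → 𝕜) M] (F : FrobeniusManifold 𝕜 n M) {φ : CoordChart 𝕜 n M}

namespace FrobeniusManifold

theorem ηLoc_sum_sharpLoc (hφ : IsCoordinatePatch φ) {y : Fin n → 𝕜} (hy : y ∈ φ.target)
    (a v : Fin n → 𝕜) : F.ηLoc φ y (∑ i, a i • F.sharpLoc φ i y) v = a ⬝ᵥ v := by
  simp [F.ηLoc_sharpLoc hφ hy, dotProduct]

theorem vecMul_contraComp_metricPencil (hφ : IsCoordinatePatch φ) {y : Fin n → 𝕜}
    (hy : y ∈ φ.target) (lam : 𝕜) (a : Fin n → 𝕜) :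
    Matrix.vecMul a (contraComp (F.metricPencil lam) φ y)
      = F.pencilOp φ lam y (∑ i, a i • F.sharpLoc φ i y) := by
  ext j
  simp [Matrix.vecMul, dotProduct, F.contraComp_metricPencil hφ hy, map_sum, Finset.sum_apply]

/-- The pencil is invertible at a point iff `E - lam` is invertible in the tangent algebra. -/
theorem mem_invertibleLocus_metricPencil_iff (hφ : IsCoordinatePatch φ) {y : Fin n → 𝕜}
    (hy : y ∈ φ.target) (lam : 𝕜) : φ.symm y ∈ invertibleLocus (F.metricPencil lam)
      ↔ Function.Injective (F.pencilOp φ lam y) := by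
  rw [mem_invertibleLocus_iff hφ hy, ← isUnit_iff_ne_zero, ← Matrix.isUnit_iff_isUnit_det,
    ← Matrix.vecMul_injective_iff_isUnit]
  constructor
  · intro h
    refine (injective_iff_map_eq_zero _).2 fun w hw => ?_
    have hw' := F.sharpLoc_expand hφ hy w
    have h0 : (fun i => F.ηLoc φ y w (stdVec 𝕜 i)) = 0 := by
      refine h ?_
      simp only [Matrix.zero_vecMul]
      rw [F.vecMul_contraComp_metricPencil hφ hy, ← hw', hw]
    rw [hw']
    exact Finset.sum_eq_zero fun i _ => by rw [show F.ηLoc φ y w (stdVec 𝕜 i) = 0 from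
      congrFun h0 i, zero_smul]
  · intro h a b hab
    simp only [F.vecMul_contraComp_metricPencil hφ hy] at hab
    have h1 := h hab
    refine dotProduct_eq _ _ fun v => ?_
    rw [← F.ηLoc_sum_sharpLoc hφ hy, ← F.ηLoc_sum_sharpLoc hφ hy, h1]

theorem surjective_pencilOp (hφ : IsCoordinatePatch φ) {y : Fin n → 𝕜} (hy : y ∈ φ.target)
    {lam : 𝕜} (h : φ.symm y ∈ invertibleLocus (F.metricPencil lam)) :
    Function.Surjective (F.pencilOp φ lam y) :=
  LinearMap.surjective_of_injective (f := (F.pencilOp φ lam y).toLinearMap)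
    ((F.mem_invertibleLocus_metricPencil_iff hφ hy lam).1 h)

/-- In flat coordinates the components of the unity field are locally constant. -/
theorem vecLoc_unit_eq_of_mem_ball (hφ : F.IsFlatChart φ) {y z : Fin n → 𝕜} {r : ℝ}
    (hball : Metric.ball y r ⊆ φ.target) (hz : z ∈ Metric.ball y r) :
    vecLoc φ F.unit z = vecLoc φ F.unit y :=
  (convex_ball y r).is_const_of_fderivWithin_eq_zero (𝕜 := 𝕜)
    (fun _ hw => (F.differentiableAt_unit hφ.1 (hball hw)).differentiableWithinAt)
    (fun w hw => by
      rw [fderivWithin_of_isOpen Metric.isOpen_ball hw]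
      exact F.fderiv_unit_flat hφ (hball hw)) hz
    (Metric.mem_ball_self (dist_nonneg.trans_lt hz))

/-- Moving along the unity field shifts the parameter of the pencil. -/
theorem pencilOp_add_smul_unit (hφ : F.IsFlatChart φ) {y : Fin n → 𝕜} {r : ℝ} (hr : 0 < r)
    (hball : Metric.ball y r ⊆ φ.target) (lam : 𝕜) {t : 𝕜}
    (ht : y + t • vecLoc φ F.unit y ∈ Metric.ball y r) :
    F.pencilOp φ lam (y + t • vecLoc φ F.unit y) = F.pencilOp φ (lam - t) y := by
  set e := vecLoc φ F.unit y with he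
  have hunit := fun z (hz : z ∈ Metric.ball y r) => F.vecLoc_unit_eq_of_mem_ball hφ hball hz
  set s : Set 𝕜 := {t | y + t • e ∈ Metric.ball y r} with hs
  have hso : IsOpen s := Metric.isOpen_ball.preimage (by fun_prop)
  have hsc : Convex ℝ s := by
    have : s = (fun t : 𝕜 => t • e) ⁻¹' Metric.ball 0 r := by
      ext t
      simp [s, Metric.mem_ball, dist_eq_norm]
    rw [this]
    exact (convex_ball (0 : Fin n → 𝕜) r).linear_preimage
      ((LinearMap.toSpanSingleton 𝕜 (Fin n → 𝕜) e).restrictScalars ℝ)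
  ext1 w
  have hder : ∀ t ∈ s, HasDerivAt (fun t => F.pencilOp φ lam (y + t • e) w - t • w) 0 t := by
    intro t ht
    have hz : y + t • e ∈ φ.target := hball ht
    have h1 : HasDerivAt (fun t : 𝕜 => y + t • e) e t := by
      simpa using ((hasDerivAt_id t).smul_const e).const_add y
    have h2 := ((F.differentiableAt_pencilOp hφ hz lam).hasFDerivAt.clm_apply
      (hasFDerivAt_const w _)).comp_hasDerivAt t h1
    have h3 := h2.sub ((hasDerivAt_id t).smul_const w)
    have hmul : ∀ u, F.mulLoc φ (y + t • e) e u = u := fun u => by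
      have := F.unit_mulLoc hφ.1 hz u
      rwa [hunit _ ht] at this
    refine h3.congr_deriv ?_
    simp [F.fderiv_pencilOp hφ hz, hmul]
  have h0 : (0 : 𝕜) ∈ s := by simp [s, hr]
  have hconst := hsc.is_const_of_fderivWithin_eq_zero (𝕜 := 𝕜)
      (fun w hw => (hder w hw).differentiableAt.differentiableWithinAt)
      (fun w hw => by
        rw [fderivWithin_of_isOpen hso hw]
        ext1
        simp [(hder w hw).hasFDerivAt.fderiv]) ht h0
  simp only [zero_smul, add_zero, sub_zero] at hconst
  rw [sub_eq_iff_eq_add] at hconst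
  rw [hconst, pencilOp_apply, pencilOp_apply, sub_smul]
  abel

theorem finite_not_injective_pencilOp (y : Fin n → 𝕜) :
    {lam | ¬ Function.Injective (F.pencilOp φ lam y)}.Finite := by
  refine (Module.End.finite_spectrum
    (F.mulLoc φ y (vecLoc φ F.euler y)).toLinearMap).subset fun lam h => ?_
  rw [← Module.End.hasEigenvalue_iff_mem_spectrum]
  by_contra hn
  refine h ((injective_iff_map_eq_zero _).2 fun w hw => ?_)
  by_contra hw0
  refine hn (Module.End.hasEigenvalue_of_hasEigenvector (x := w)
    ⟨Module.End.mem_eigenspace_iff.2 ?_, hw0⟩)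
  rw [pencilOp_apply, sub_eq_zero] at hw
  exact hw

/-- The pencil is invertible on a dense set: moving along the unity changes `lam`, and only the
eigenvalues of multiplication by `E` are excluded. -/
theorem dense_invertibleLocus_metricPencil (lam : 𝕜) :
    Dense (invertibleLocus (F.metricPencil lam)) := by
  rw [dense_iff_inter_open]
  rintro O hO ⟨x, hxO⟩
  obtain ⟨φ, hφ, hx⟩ := F.flat x
  have hnhds : φ.target ∩ φ.symm ⁻¹' O ∈ 𝓝 (φ x) :=
    (φ.symm.isOpen_inter_preimage hO).mem_nhds
      ⟨φ.map_source hx, by rw [mem_preimage, φ.left_inv hx]; exact hxO⟩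
  obtain ⟨r, hr, hball⟩ := Metric.mem_nhds_iff.1 hnhds
  set y := φ x
  have hline : ∀ᶠ t in 𝓝 (0 : 𝕜), y + t • vecLoc φ F.unit y ∈ Metric.ball y r := by
    have hc : ContinuousAt (fun t : 𝕜 => y + t • vecLoc φ F.unit y) 0 := by fun_prop
    refine hc.eventually (Metric.isOpen_ball.mem_nhds ?_)
    simpa using hr
  have hfin : {t : 𝕜 | ¬ Function.Injective (F.pencilOp φ (lam - t) y)}.Finite :=
    (F.finite_not_injective_pencilOp (φ := φ) y).preimage (f := fun t => lam - t)
      (sub_right_injective.injOn)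
  obtain ⟨t, ht, hti⟩ := ((infinite_of_mem_nhds (0 : 𝕜) hline).sdiff hfin).nonempty
  simp only [mem_ofPred_eq, not_not] at ht hti
  have hz := hball ht
  refine ⟨φ.symm (y + t • vecLoc φ F.unit y), hz.2, ?_⟩
  rw [F.mem_invertibleLocus_metricPencil_iff hφ.1 hz.1,
    F.pencilOp_add_smul_unit hφ hr (fun w hw => (hball hw).1) lam ht]
  exact hti

variable [IsManifold 𝓘(𝕜, Fin n → 𝕜) ∞ M]

theorem isContravariantMetric_metricPencil (lam : 𝕜) :
    IsContravariantMetric (F.metricPencil lam) where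
  symm := F.metricPencil_symm lam
  smooth _ hφ i j := F.contDiffOn_contraComp_metricPencil hφ lam i j
  isOpen := isOpen_invertibleLocus fun _ hφ i j => F.contDiffOn_contraComp_metricPencil hφ lam i j
  dense := F.dense_invertibleLocus_metricPencil lam

omit [IsManifold 𝓘(𝕜, Fin n → 𝕜) ∞ M] in
theorem invertibleLocus_cotMetric : invertibleLocus F.cotMetric = univ := by
  refine eq_univ_of_forall fun x => ?_
  obtain ⟨φ, hφ, hx⟩ := F.flat x
  have h := (mem_invertibleLocus_iff hφ.1 (φ.map_source hx) F.cotMetric).2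
    (F.det_contraComp_cotMetric_ne_zero hφ.1 (φ.map_source hx))
  rwa [φ.left_inv hx] at h

omit [IsManifold 𝓘(𝕜, Fin n → 𝕜) ∞ M] in
theorem isContravariantMetric_cotMetric : IsContravariantMetric F.cotMetric where
  symm x u v := F.η_symm x _ _
  smooth _ hφ i j := F.contDiffOn_contraComp_cotMetric hφ i j
  isOpen := by rw [invertibleLocus_cotMetric]; exact isOpen_univ
  dense := by rw [invertibleLocus_cotMetric]; exact dense_univ

end FrobeniusManifold
end Density

section ContraChristoffel

variable {𝕜 : Type*} [RCLike 𝕜] {n : ℕ} {M : Type*} [TopologicalSpace M]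
  [ChartedSpace (Fin n → 𝕜) M] {φ : CoordChart 𝕜 n M} {g : ContraForm 𝕜 n M}

/-- The coordinates of the points of a patch that lie in `M₀`. -/
def regularTarget (g : ContraForm 𝕜 n M) (φ : CoordChart 𝕜 n M) : Set (Fin n → 𝕜) :=
  φ.target ∩ φ.symm ⁻¹' invertibleLocus g

theorem IsContravariantMetric.isOpen_regularTarget (hg : IsContravariantMetric g)
    (φ : CoordChart 𝕜 n M) : IsOpen (regularTarget g φ) :=
  φ.symm.isOpen_inter_preimage hg.isOpen

/-- `(Γ^{ij}_k)_j` is the vector `-Γ((dx^i)^♯, ∂_k)`. -/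
theorem contraChristoffel_eq (k i j : Fin n) (y : Fin n → 𝕜) :
    contraChristoffel g φ k i j y = -christoffelVec (fun z => (contraComp g φ z)⁻¹) y
      (contraComp g φ y i) (stdVec 𝕜 k) j := by
  simp [contraChristoffel, christoffelVec, Pi.single_apply]

theorem IsContravariantMetric.contDiffOn_inv (hg : IsContravariantMetric g)
    (hφ : IsCoordinatePatch φ) (i j : Fin n) :
    ContDiffOn 𝕜 ∞ (fun y => (contraComp g φ y)⁻¹ i j) (regularTarget g φ) :=
  contDiffOn_inv_apply (fun i j => (hg.smooth φ hφ i j).mono inter_subset_left)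
    (fun _ hy => (mem_invertibleLocus_iff hφ hy.1 g).1 hy.2) i j

theorem IsContravariantMetric.isSymm_inv (hg : IsContravariantMetric g) (φ : CoordChart 𝕜 n M)
    (y : Fin n → 𝕜) : ((contraComp g φ y)⁻¹).IsSymm := by
  rw [Matrix.IsSymm, Matrix.transpose_nonsing_inv, contraComp_isSymm hg.symm y]

theorem IsContravariantMetric.det_inv_ne_zero (hφ : IsCoordinatePatch φ) {y : Fin n → 𝕜}
    (hy : y ∈ regularTarget g φ) : ((contraComp g φ y)⁻¹).det ≠ 0 :=
  (Matrix.isUnit_nonsing_inv_det _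
    ((mem_invertibleLocus_iff hφ hy.1 g).1 hy.2).isUnit).ne_zero

theorem IsContravariantMetric.differentiableAt_form_inv (hg : IsContravariantMetric g)
    (hφ : IsCoordinatePatch φ) {y : Fin n → 𝕜} (hy : y ∈ regularTarget g φ) :
    DifferentiableAt 𝕜 (fun z => formOfMatrix ((contraComp g φ z)⁻¹)) y :=
  (((contDiffOn_formOfMatrix (hg.contDiffOn_inv hφ)).contDiffAt
    ((hg.isOpen_regularTarget φ).mem_nhds hy)).differentiableAt (by simp))

theorem IsContravariantMetric.contDiffOn_contraChristoffel (hg : IsContravariantMetric g)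
    (hφ : IsCoordinatePatch φ) (k i j : Fin n) :
    ContDiffOn 𝕜 ∞ (contraChristoffel g φ k i j) (regularTarget g φ) := by
  have hinv := hg.contDiffOn_inv hφ
  have hinv2 : ∀ i j, ContDiffOn 𝕜 ∞ (fun y => ((contraComp g φ y)⁻¹)⁻¹ i j)
      (regularTarget g φ) :=
    contDiffOn_inv_apply hinv fun _ hy => IsContravariantMetric.det_inv_ne_zero hφ hy
  have hpd : ∀ l i j, ContDiffOn 𝕜 ∞ (pd l fun z => (contraComp g φ z)⁻¹ i j)
      (regularTarget g φ) := fun l i j =>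
    ((hinv i j).fderiv_of_isOpen (hg.isOpen_regularTarget φ) le_rfl).clm_apply contDiffOn_const
  have hch : ∀ j s, ContDiffOn 𝕜 ∞ (christoffel (fun z => (contraComp g φ z)⁻¹) j s k)
      (regularTarget g φ) := fun j s =>
    contDiffOn_const.mul (ContDiffOn.sum fun l _ =>
      (hinv2 _ _).mul (((hpd _ _ _).add (hpd _ _ _)).sub (hpd _ _ _)))
  exact (ContDiffOn.sum fun s _ =>
    ((hg.smooth φ hφ i s).mono inter_subset_left).mul (hch j s)).neg

end ContraChristoffel

section FlatChristoffel

variable {𝕜 : Type*} [RCLike 𝕜] {n : ℕ} {M : Type*} [TopologicalSpace M]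
  [ChartedSpace (Fin n → 𝕜) M] [IsManifold 𝓘(𝕜, Fin n → 𝕜) ∞ M]
  (F : FrobeniusManifold 𝕜 n M) {φ : CoordChart 𝕜 n M}

namespace FrobeniusManifold

omit [IsManifold 𝓘(𝕜, Fin n → 𝕜) ∞ M] in
/-- Multiplication by `E - lam` relates the covariant form of the pencil to `<,>`. -/
theorem form_pencilOp (hφ : IsCoordinatePatch φ) {lam : 𝕜} {y : Fin n → 𝕜}
    (hy : y ∈ regularTarget (F.metricPencil lam) φ) (a v : Fin n → 𝕜) :
    formOfMatrix ((contraComp (F.metricPencil lam) φ y)⁻¹) (F.pencilOp φ lam y a) v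
      = F.ηLoc φ y a v := by
  have hdet := ((mem_invertibleLocus_iff hφ hy.1 (F.metricPencil lam)).1 hy.2).isUnit
  obtain ⟨α, rfl⟩ : ∃ α : Fin n → 𝕜, a = ∑ i, α i • F.sharpLoc φ i y :=
    ⟨_, F.sharpLoc_expand hφ hy.1 a⟩
  rw [F.ηLoc_sum_sharpLoc hφ hy.1, ← F.vecMul_contraComp_metricPencil hφ hy.1,
    formOfMatrix_apply, ← Matrix.dotProduct_mulVec, Matrix.mulVec_mulVec,
    Matrix.mul_nonsing_inv _ hdet, Matrix.one_mulVec]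

omit [IsManifold 𝓘(𝕜, Fin n → 𝕜) ∞ M] in
theorem mulLoc_pencilOp (hφ : IsCoordinatePatch φ) (lam : 𝕜) {y : Fin n → 𝕜} (hy : y ∈ φ.target)
    (a b : Fin n → 𝕜) : F.mulLoc φ y (F.pencilOp φ lam y a) b
      = F.pencilOp φ lam y (F.mulLoc φ y a b) := by
  simp [pencilOp_apply, F.mulLoc_assoc hφ hy]

variable (hφ : F.IsFlatChart φ) {lam : 𝕜} {y : Fin n → 𝕜}
  (hy : y ∈ regularTarget (F.metricPencil lam) φ)
include hφ hy

/-- The derivative of the covariant form of the pencil, from differentiating `form_pencilOp`. -/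
theorem fderiv_form_pencilOp (w a b : Fin n → 𝕜) :
    fderiv 𝕜 (fun z => formOfMatrix ((contraComp (F.metricPencil lam) φ z)⁻¹)) y w
      (F.pencilOp φ lam y a) (F.pencilOp φ lam y b)
    = -(F.ηLoc φ y (F.rOp φ y (F.mulLoc φ y w a)) b
      + F.ηLoc φ y (F.rOp φ y (F.mulLoc φ y w b)) a) := by
  have hg := F.isContravariantMetric_metricPencil lam
  set v := F.pencilOp φ lam y b with hv
  have hd := hg.differentiableAt_form_inv hφ.1 hy
  have hU := F.differentiableAt_pencilOp hφ hy.1 lam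
  have hUa : DifferentiableAt 𝕜 (fun z => F.pencilOp φ lam z a) y :=
    hU.clm_apply (differentiableAt_const _)
  have h1 := fderiv_clm_apply₂ hd hUa (differentiableAt_const v) w
  have hc : (fun z => formOfMatrix ((contraComp (F.metricPencil lam) φ z)⁻¹)
      (F.pencilOp φ lam z a) v) =ᶠ[𝓝 y] fun _ => F.ηLoc φ y a v := by
    filter_upwards [(hg.isOpen_regularTarget φ).mem_nhds hy] with z hz
    rw [F.form_pencilOp hφ.1 hz, F.ηLoc_const hφ hy.1 hz.1]
  rw [hc.fderiv_eq, (hU.hasFDerivAt.clm_apply (hasFDerivAt_const a y)).fderiv] at h1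
  simp only [fderiv_fun_const, Pi.zero_apply, zero_apply, map_zero, add_zero, add_apply,
    ContinuousLinearMap.comp_apply, ContinuousLinearMap.flip_apply, zero_add,
    F.fderiv_pencilOp hφ hy.1] at h1
  rw [formOfMatrix_symm (hg.isSymm_inv φ y), hv, F.form_pencilOp hφ.1 hy, ← hv] at h1
  have h2 := F.ηLoc_rOp hφ hy.1 (F.mulLoc φ y w b) a
  have h3 := F.ηLoc_mulLoc hφ.1 hy.1 w b a
  have h4 := F.ηLoc_mulLoc hφ.1 hy.1 w b (F.rOp φ y a)
  have h5 := F.ηLoc_symm (φ := φ) (y := y) b (F.rOp φ y (F.mulLoc φ y w a))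
  simp only [map_add, map_sub] at h1
  linear_combination (-1) * h1 + h2 + h3 - h4 - h5

/-- The Levi-Civita connection of the pencil in flat coordinates of `<,>`. -/
theorem christoffelVec_metricPencil (a v : Fin n → 𝕜) :
    christoffelVec (fun z => (contraComp (F.metricPencil lam) φ z)⁻¹) y (F.pencilOp φ lam y a) v
      = -F.rOp φ y (F.mulLoc φ y a v) := by
  have hg := F.isContravariantMetric_metricPencil lam
  have hsurj := F.surjective_pencilOp hφ.1 hy.1 hy.2
  have hdet := IsContravariantMetric.det_inv_ne_zero hφ.1 hy
  have hs := hg.isSymm_inv φ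
  refine form_ext (h := fun z => (contraComp (F.metricPencil lam) φ z)⁻¹) hdet (hs y) fun w => ?_
  obtain ⟨b, rfl⟩ := hsurj w
  obtain ⟨c, rfl⟩ := hsurj v
  rw [form_christoffelVec (hg.differentiableAt_form_inv hφ.1 hy) (Eventually.of_forall hs) hdet]
  rw [F.fderiv_form_pencilOp hφ hy, F.fderiv_form_pencilOp hφ hy, F.fderiv_form_pencilOp hφ hy,
    formOfMatrix_symm (hs y), F.form_pencilOp hφ.1 hy]
  simp only [F.mulLoc_pencilOp hφ.1 lam hy.1]
  rw [F.mulLoc_comm c a, F.mulLoc_comm b a, F.mulLoc_comm c b, F.mulLoc_comm a (F.pencilOp φ lam y c),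
    F.mulLoc_pencilOp hφ.1 lam hy.1, F.mulLoc_comm c a, F.ηLoc_symm b]
  simp only [map_neg, neg_apply]
  ring

theorem contraChristoffel_metricPencil (k i j : Fin n) :
    contraChristoffel (F.metricPencil lam) φ k i j y
      = F.rOp φ y (F.mulLoc φ y (F.sharpLoc φ i y) (stdVec 𝕜 k)) j := by
  have h : contraComp (F.metricPencil lam) φ y i = F.pencilOp φ lam y (F.sharpLoc φ i y) :=
    funext fun j => F.contraComp_metricPencil hφ.1 hy.1 lam i j
  rw [contraChristoffel_eq, h, F.christoffelVec_metricPencil hφ hy]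
  simp

omit [IsManifold 𝓘(𝕜, Fin n → 𝕜) ∞ M] in
omit hy in
theorem sum_cUp_mul_R (hy : y ∈ φ.target) (α β γ : Fin n) :
    ∑ ε, F.cUp φ α ε γ y * F.R φ β ε y
      = F.rOp φ y (F.mulLoc φ y (F.sharpLoc φ α y) (stdVec 𝕜 γ)) β := by
  have hR : ∀ ε, F.R φ β ε y = F.rOp φ y (stdVec 𝕜 ε) β := fun ε => by
    rw [FrobeniusManifold.R, F.nablaVec_eq (F.differentiableAt_euler hφ.1 hy), F.ΓLoc_flat hφ hy,
      rOp_apply]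
    simp [Pi.single_apply]
  have hc : ∀ ε, F.cUp φ α ε γ y = F.mulLoc φ y (F.sharpLoc φ α y) (stdVec 𝕜 γ) ε := fun ε => by
    have h1 := map_eq_sum_stdVec ((F.mulLoc φ y).flip (stdVec 𝕜 γ)).toLinearMap (F.sharpLoc φ α y)
    simp only [ContinuousLinearMap.coe_coe, ContinuousLinearMap.flip_apply] at h1
    rw [h1, cUp, Finset.sum_apply]
    exact Finset.sum_congr rfl fun δ _ => by rw [F.inv_ηComp hφ.1 hy, F.mulComp_eq hφ.1 hy]; rfl
  have h2 := map_eq_sum_stdVec (F.rOp φ y).toLinearMap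
    (F.mulLoc φ y (F.sharpLoc φ α y) (stdVec 𝕜 γ))
  simp only [ContinuousLinearMap.coe_coe] at h2
  rw [h2, Finset.sum_apply]
  exact Finset.sum_congr rfl fun ε _ => by rw [hR, hc]; rfl

end FrobeniusManifold
end FlatChristoffel

/-! ### Flat coordinates of the pencil -/

section Bootstrap

variable {𝕜 : Type*} [RCLike 𝕜] {V W : Type*} [NormedAddCommGroup V] [NormedSpace 𝕜 V]
  [NormedAddCommGroup W] [NormedSpace 𝕜 W]

/-- Solutions of a smooth linear total differential equation are smooth. -/
theorem contDiffOn_of_hasFDerivAt_eq_apply {B : V → W →L[𝕜] V →L[𝕜] W} {ψ : V → W} {O : Set V}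
    (hO : IsOpen O) (hB : ContDiffOn 𝕜 ∞ B O)
    (hψ : ∀ y ∈ O, HasFDerivAt ψ (B y (ψ y)) y) : ContDiffOn 𝕜 ∞ ψ O := by
  rw [contDiffOn_infty]
  intro m
  induction m with
  | zero => exact contDiffOn_zero.2 fun y hy => (hψ y hy).continuousAt.continuousWithinAt
  | succ m ih =>
    rw [Nat.cast_add, Nat.cast_one, contDiffOn_succ_iff_fderiv_of_isOpen hO]
    refine ⟨fun y hy => (hψ y hy).differentiableAt.differentiableWithinAt, by simp, ?_⟩
    exact ((hB.of_le (by exact_mod_cast le_top)).clm_apply ih).congr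
      fun y hy => (hψ y hy).fderiv

theorem contDiffOn_of_hasFDerivAt {α : V → V →L[𝕜] W} {f : V → W} {O : Set V}
    (hO : IsOpen O) (hα : ContDiffOn 𝕜 ∞ α O)
    (hf : ∀ y ∈ O, HasFDerivAt f (α y) y) : ContDiffOn 𝕜 ∞ f O := by
  rw [contDiffOn_infty_iff_fderiv_of_isOpen hO]
  exact ⟨fun y hy => (hf y hy).differentiableAt.differentiableWithinAt,
    hα.congr fun y hy => (hf y hy).fderiv⟩

end Bootstrap

section FlatFunctions

variable {𝕜 : Type*} [RCLike 𝕜] {n : ℕ} {M : Type*} [TopologicalSpace M]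
  [ChartedSpace (Fin n → 𝕜) M] [IsManifold 𝓘(𝕜, Fin n → 𝕜) ∞ M]
  (F : FrobeniusManifold 𝕜 n M) {φ : CoordChart 𝕜 n M}

namespace FrobeniusManifold

omit [IsManifold 𝓘(𝕜, Fin n → 𝕜) ∞ M] in
theorem isInvertible_pencilOp (hφ : IsCoordinatePatch φ) {lam : 𝕜} {y : Fin n → 𝕜}
    (hy : y ∈ regularTarget (F.metricPencil lam) φ) : (F.pencilOp φ lam y).IsInvertible := by
  have hinj := (F.mem_invertibleLocus_metricPencil_iff hφ hy.1 lam).1 hy.2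
  exact ⟨(LinearEquiv.ofInjectiveEndo (F.pencilOp φ lam y).toLinearMap hinj).toContinuousLinearEquiv,
    by ext1 u; rfl⟩

/-- The vector `(E - lam)⁻¹ (1 - R) w`. -/
def gaussManinVec (φ : CoordChart 𝕜 n M) (lam : 𝕜) (y : Fin n → 𝕜) :
    (Fin n → 𝕜) →L[𝕜] (Fin n → 𝕜) :=
  (F.pencilOp φ lam y).inverse.comp (ContinuousLinearMap.id 𝕜 (Fin n → 𝕜) - F.rOp φ y)

/-- The coefficients of the linear system `∂_u ψ = -u · (E - lam)⁻¹ (1 - R) ψ` for the gradients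
(with respect to `<,>`) of the flat coordinates of the pencil. -/
def gaussManin (φ : CoordChart 𝕜 n M) (lam : 𝕜) (y : Fin n → 𝕜) :
    (Fin n → 𝕜) →L[𝕜] (Fin n → 𝕜) →L[𝕜] (Fin n → 𝕜) :=
  -(F.mulLoc φ y).comp (F.gaussManinVec φ lam y)

omit [IsManifold 𝓘(𝕜, Fin n → 𝕜) ∞ M] in
theorem gaussManin_apply (lam : 𝕜) (y w u : Fin n → 𝕜) : F.gaussManin φ lam y w u
    = -F.mulLoc φ y (F.gaussManinVec φ lam y w) u := rfl

omit [IsManifold 𝓘(𝕜, Fin n → 𝕜) ∞ M] in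
theorem contDiffOn_rOp (hφ : IsCoordinatePatch φ) : ContDiffOn 𝕜 ∞ (F.rOp φ) φ.target :=
  contDiffOn_const.add
    ((F.contDiffOn_vecLoc_euler hφ).fderiv_of_isOpen φ.open_target le_rfl)

omit [IsManifold 𝓘(𝕜, Fin n → 𝕜) ∞ M] in
theorem pencilOp_gaussManinVec (hφ : IsCoordinatePatch φ) {lam : 𝕜} {y : Fin n → 𝕜}
    (hy : y ∈ regularTarget (F.metricPencil lam) φ) (w : Fin n → 𝕜) :
    F.pencilOp φ lam y (F.gaussManinVec φ lam y w) = w - F.rOp φ y w :=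
  (((F.isInvertible_pencilOp hφ hy).inverse_apply_eq).1 rfl).symm

omit [IsManifold 𝓘(𝕜, Fin n → 𝕜) ∞ M] in
theorem contDiffOn_gaussManinVec (hφ : IsCoordinatePatch φ) (lam : 𝕜) :
    ContDiffOn 𝕜 ∞ (F.gaussManinVec φ lam) (regularTarget (F.metricPencil lam) φ) := by
  have hinv : ContDiffOn 𝕜 ∞ (fun y => (F.pencilOp φ lam y).inverse)
      (regularTarget (F.metricPencil lam) φ) := by
    intro y hy
    obtain ⟨e, he⟩ := F.isInvertible_pencilOp hφ hy
    have h1 : ContDiffAt 𝕜 ∞ ContinuousLinearMap.inverse (F.pencilOp φ lam y) :=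
      he ▸ contDiffAt_map_inverse e
    exact h1.comp_contDiffWithinAt y (((F.contDiffOn_pencilOp hφ lam).mono inter_subset_left) y hy)
  exact hinv.clm_comp (contDiffOn_const.sub ((F.contDiffOn_rOp hφ).mono inter_subset_left))

omit [IsManifold 𝓘(𝕜, Fin n → 𝕜) ∞ M] in
theorem contDiffOn_gaussManin (hφ : IsCoordinatePatch φ) (lam : 𝕜) :
    ContDiffOn 𝕜 ∞ (F.gaussManin φ lam) (regularTarget (F.metricPencil lam) φ) :=
  (((F.contDiffOn_mulLoc hφ).mono inter_subset_left).clm_comp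
    (F.contDiffOn_gaussManinVec hφ lam)).neg

variable (hφ : F.IsFlatChart φ) {lam : 𝕜} {y : Fin n → 𝕜}
  (hy : y ∈ regularTarget (F.metricPencil lam) φ)
include hφ hy

/-- The system for the gradients of flat coordinates is completely integrable. -/
theorem gaussManin_integrable (u v w : Fin n → 𝕜) :
    fderiv 𝕜 (F.gaussManin φ lam) y u w v + F.gaussManin φ lam y (F.gaussManin φ lam y w u) v
      = fderiv 𝕜 (F.gaussManin φ lam) y v w u
        + F.gaussManin φ lam y (F.gaussManin φ lam y w v) u := by
  have hnhds := ((F.isContravariantMetric_metricPencil lam).isOpen_regularTarget φ).mem_nhds hy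
  have hq : DifferentiableAt 𝕜 (fun z => F.gaussManinVec φ lam z w) y :=
    DifferentiableAt.clm_apply (((F.contDiffOn_gaussManinVec hφ.1 lam).contDiffAt
      hnhds).differentiableAt (by simp)) (differentiableAt_const w)
  have hB : DifferentiableAt 𝕜 (F.gaussManin φ lam) y :=
    ((F.contDiffOn_gaussManin hφ.1 lam).contDiffAt hnhds).differentiableAt (by simp)
  set q := F.gaussManinVec φ lam y w with hqdef
  set q' := fderiv 𝕜 (fun z => F.gaussManinVec φ lam z w) y with hq'
  -- the derivative of the system
  have hder : ∀ u v, fderiv 𝕜 (F.gaussManin φ lam) y u w v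
      = -(fderiv 𝕜 (F.mulLoc φ) y u q v + F.mulLoc φ y (q' u) v) := by
    intro u v
    have h1 := fderiv_clm_apply₂ hB (differentiableAt_const w) (differentiableAt_const v) u
    have h2 := fderiv_clm_apply₂ (F.differentiableAt_mulLoc hφ.1 hy.1) hq
      (differentiableAt_const v) u
    have h3 : fderiv 𝕜 (fun z => F.gaussManin φ lam z w v) y
        = -fderiv 𝕜 (fun z => F.mulLoc φ z (F.gaussManinVec φ lam z w) v) y := fderiv_fun_neg
    simp only [fderiv_fun_const, Pi.zero_apply, zero_apply, map_zero, add_zero] at h1 h2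
    rw [← h1, h3, neg_apply, h2]
  -- the derivative of `(E - lam) q = (1 - R) w`
  have hUq : ∀ u, fderiv 𝕜 (F.pencilOp φ lam) y u q + F.pencilOp φ lam y (q' u) = 0 := by
    intro u
    have h1 := ((F.differentiableAt_pencilOp hφ hy.1 lam).hasFDerivAt.clm_apply
      hq.hasFDerivAt).fderiv
    have h2 : (fun z => F.pencilOp φ lam z (F.gaussManinVec φ lam z w))
        =ᶠ[𝓝 y] fun z => w - F.rOp φ z w := by
      filter_upwards [hnhds] with z hz using F.pencilOp_gaussManinVec hφ.1 hz w
    have h3 := ((hasFDerivAt_const w y).sub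
      ((F.hasFDerivAt_rOp hφ hy.1).clm_apply (hasFDerivAt_const w y))).fderiv
    rw [h2.fderiv_eq] at h1
    have h4 := DFunLike.congr_fun (h1.symm.trans h3) u
    simp only [add_apply, ContinuousLinearMap.comp_apply, ContinuousLinearMap.flip_apply] at h4
    rw [_root_.add_comm]
    refine h4.trans ?_
    simp
  -- both sides are governed by `u · (R q - 2 q)`
  have hU2 : ∀ u, F.pencilOp φ lam y (q' u + F.gaussManinVec φ lam y (F.gaussManin φ lam y w u))
      = F.mulLoc φ y u (F.rOp φ y q - (2 : 𝕜) • q) := by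
    intro u
    have h1 := hUq u
    rw [F.fderiv_pencilOp hφ hy.1] at h1
    rw [map_add, F.pencilOp_gaussManinVec hφ.1 hy, gaussManin_apply, ← hqdef,
      F.mulLoc_comm q u, map_sub, map_smul, map_neg, two_smul]
    linear_combination (exp := 1) h1
  have hinj := (F.mem_invertibleLocus_metricPencil_iff hφ.1 hy.1 lam).1 hy.2
  have hkey : F.mulLoc φ y (q' u + F.gaussManinVec φ lam y (F.gaussManin φ lam y w u)) v
      = F.mulLoc φ y (q' v + F.gaussManinVec φ lam y (F.gaussManin φ lam y w v)) u := by
    refine hinj ?_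
    rw [← F.mulLoc_pencilOp hφ.1 lam hy.1, ← F.mulLoc_pencilOp hφ.1 lam hy.1, hU2, hU2,
      F.mulLoc_comm _ v, F.mulLoc_comm _ u, F.mulLoc_left_comm hφ.1 hy.1]
  simp only [map_add, add_apply] at hkey
  rw [hder, hder, gaussManin_apply, gaussManin_apply (w := F.gaussManin φ lam y w v),
    F.fderiv_mulLoc_symm_right hφ hy.1 u q v]
  linear_combination (exp := 1) -hkey

/-- Near a point of `M₀` the pencil has `n` independent flat coordinates. -/
theorem exists_flat_functions : ∃ O : Set (Fin n → 𝕜), IsOpen O ∧ y ∈ O ∧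
    O ⊆ regularTarget (F.metricPencil lam) φ ∧ ∃ f : Fin n → (Fin n → 𝕜) → 𝕜,
      (∀ a, ContDiffOn 𝕜 ∞ (f a) O) ∧
      (∀ a, ∀ z ∈ O, ∀ u v, fderiv 𝕜 (fderiv 𝕜 (f a)) z u v
        = fderiv 𝕜 (f a) z
          (christoffelVec (fun z => (contraComp (F.metricPencil lam) φ z)⁻¹) z u v)) ∧
      ∀ z ∈ O, LinearIndependent 𝕜 fun a => fderiv 𝕜 (f a) z := by
  set S := regularTarget (F.metricPencil lam) φ with hS
  have hSo : IsOpen S := (F.isContravariantMetric_metricPencil lam).isOpen_regularTarget φ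
  have hnhds := hSo.mem_nhds hy
  have hBs := F.contDiffOn_gaussManin hφ.1 lam
  have hB1 : ContDiffAt 𝕜 1 (F.gaussManin φ lam) y := (hBs.contDiffAt hnhds).of_le (by simp)
  have hint : ∀ᶠ z in 𝓝 y, ∀ u v w, fderiv 𝕜 (F.gaussManin φ lam) z u w v
      + F.gaussManin φ lam z (F.gaussManin φ lam z w u) v
      = fderiv 𝕜 (F.gaussManin φ lam) z v w u
        + F.gaussManin φ lam z (F.gaussManin φ lam z w v) u := by
    filter_upwards [hnhds] with z hz u v w using F.gaussManin_integrable hφ hz u v w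
  choose ψ hψ0 hψ using fun a : Fin n =>
    exists_hasFDerivAt_eq_apply hB1 hint (stdVec 𝕜 a)
  -- the gradients are smooth near `y`
  obtain ⟨O₁, hO₁, hO₁o, hyO₁⟩ := mem_nhds_iff.1
    (inter_mem hnhds (eventually_all.2 hψ))
  have hψs : ∀ a, ContDiffOn 𝕜 ∞ (ψ a) O₁ := fun a =>
    contDiffOn_of_hasFDerivAt_eq_apply hO₁o (hBs.mono fun z hz => (hO₁ hz).1)
      fun z hz => (hO₁ hz).2 a
  set H := F.ηLoc φ y with hH
  have hαs : ∀ a, ContDiffOn 𝕜 ∞ (fun z => H (ψ a z)) O₁ := fun a =>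
    contDiffOn_const.clm_apply (hψs a)
  have hαd : ∀ a, ∀ z ∈ O₁, ∀ u v, fderiv 𝕜 (fun z => H (ψ a z)) z u v
      = -F.ηLoc φ y (F.mulLoc φ z (F.gaussManinVec φ lam z (ψ a z)) u) v := by
    intro a z hz u v
    have h1 : HasFDerivAt (fun z => H (ψ a z)) (H.comp (F.gaussManin φ lam z (ψ a z))) z :=
      H.hasFDerivAt.comp z ((hO₁ hz).2 a)
    rw [h1.fderiv]
    simp [gaussManin_apply, hH]
  choose f hf using fun a : Fin n => exists_primitive_of_symm (y₀ := y)
    (((hαs a).contDiffAt (hO₁o.mem_nhds hyO₁)).of_le (by simp))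
    (by
      filter_upwards [hO₁o.mem_nhds hyO₁] with z hz u v
      rw [hαd a z hz, hαd a z hz, ← F.ηLoc_const hφ hy.1 (hO₁ hz).1.1,
        F.ηLoc_mulLoc hφ.1 (hO₁ hz).1.1,
        F.ηLoc_symm, F.ηLoc_mulLoc hφ.1 (hO₁ hz).1.1 _ v])
  have hdet : ∀ᶠ z in 𝓝 y, (Matrix.of fun a b => ψ a z b).det ≠ 0 := by
    have hc : ContinuousOn (fun z => (Matrix.of fun a b => ψ a z b).det) O₁ :=
      (contDiffOn_det fun a b => contDiffOn_pi.1 (hψs a) b).continuousOn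
    refine (hc.continuousAt (hO₁o.mem_nhds hyO₁)).eventually_ne ?_
    have : (Matrix.of fun a b => ψ a y b) = (1 : Matrix (Fin n) (Fin n) 𝕜) := by
      ext a b
      simp [hψ0, Matrix.one_apply, Pi.single_apply, eq_comm]
    simp [this]
  obtain ⟨O, hO, hOo, hyO⟩ := mem_nhds_iff.1
    (inter_mem (hO₁o.mem_nhds hyO₁) (inter_mem (eventually_all.2 hf) hdet))
  have hfd : ∀ a, ∀ z ∈ O, HasFDerivAt (f a) (H (ψ a z)) z := fun a z hz => (hO hz).2.1 a
  refine ⟨O, hOo, hyO, fun z hz => (hO₁ (hO hz).1).1, f, fun a => ?_, fun a z hz u v => ?_,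
    fun z hz => ?_⟩
  · exact contDiffOn_of_hasFDerivAt hOo ((hαs a).mono fun z hz => (hO hz).1) (hfd a)
  · have hzS := (hO₁ (hO hz).1).1
    have he : fderiv 𝕜 (f a) =ᶠ[𝓝 z] fun z => H (ψ a z) := by
      filter_upwards [hOo.mem_nhds hz] with x hx using (hfd a x hx).fderiv
    obtain ⟨b, rfl⟩ := F.surjective_pencilOp hφ.1 hzS.1 hzS.2 u
    rw [he.fderiv_eq, hαd a z (hO hz).1, (hfd a z hz).fderiv,
      F.christoffelVec_metricPencil hφ hzS, hH, ← F.ηLoc_const hφ hy.1 hzS.1,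
      F.mulLoc_comm, F.mulLoc_pencilOp hφ.1 lam hzS.1, F.mulLoc_comm b,
      ← F.mulLoc_pencilOp hφ.1 lam hzS.1, F.pencilOp_gaussManinVec hφ.1 hzS, map_neg,
      F.mulLoc_comm, F.ηLoc_mulLoc hφ.1 hzS.1]
    have h1 := F.ηLoc_rOp hφ hzS.1 (ψ a z) (F.mulLoc φ z b v)
    simp only [map_sub, sub_apply]
    linear_combination h1
  · have h1 : LinearIndependent 𝕜 fun a => ψ a z :=
      Matrix.linearIndependent_rows_iff_isUnit.2
        ((Matrix.isUnit_iff_isUnit_det _).2 (hO hz).2.2.isUnit)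
    have h2 := h1.map' H.toLinearMap (LinearMap.ker_eq_bot.2 fun u v huv =>
      F.ηLoc_ext hφ.1 hy.1 fun w => DFunLike.congr_fun huv w)
    have h3 : (fun a => fderiv 𝕜 (f a) z) = fun a => H (ψ a z) :=
      funext fun a => (hfd a z hz).fderiv
    rw [h3]
    exact h2

end FrobeniusManifold
end FlatFunctions

/-! ### Change of coordinates and flatness -/

section Transition

variable {𝕜 : Type*} [RCLike 𝕜] {n : ℕ}

/-- The Jacobian matrix of a map of the coordinate space. -/
def jacobian (Φ : (Fin n → 𝕜) → Fin n → 𝕜) (y : Fin n → 𝕜) : Matrix (Fin n) (Fin n) 𝕜 :=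
  Matrix.of fun a i => fderiv 𝕜 Φ y (stdVec 𝕜 i) a

theorem jacobian_mulVec (Φ : (Fin n → 𝕜) → Fin n → 𝕜) (y u : Fin n → 𝕜) :
    (jacobian Φ y).mulVec u = fderiv 𝕜 Φ y u := by
  have h := map_eq_sum_stdVec (fderiv 𝕜 Φ y).toLinearMap u
  simp only [ContinuousLinearMap.coe_coe] at h
  rw [h]
  ext a
  simp [jacobian, Matrix.mulVec, dotProduct, Finset.sum_apply, mul_comm]

/-- The second derivative of a composition with a function. -/
theorem fderiv_fderiv_comp {f : (Fin n → 𝕜) → 𝕜} {Φ : (Fin n → 𝕜) → Fin n → 𝕜} {y : Fin n → 𝕜}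
    (hf : ContDiffAt 𝕜 ∞ f (Φ y)) (hΦ : ContDiffAt 𝕜 ∞ Φ y) (u v : Fin n → 𝕜) :
    fderiv 𝕜 (fun z => fderiv 𝕜 (fun x => f (Φ x)) z v) y u
      = fderiv 𝕜 (fderiv 𝕜 f) (Φ y) (fderiv 𝕜 Φ y u) (fderiv 𝕜 Φ y v)
        + fderiv 𝕜 f (Φ y) (fderiv 𝕜 (fderiv 𝕜 Φ) y u v) := by
  have hfe : ∀ᶠ z in 𝓝 y, ContDiffAt 𝕜 1 f (Φ z) :=
    hΦ.continuousAt.eventually ((hf.of_le (by simp) : ContDiffAt 𝕜 1 f (Φ y)).eventually (by simp))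
  have hΦe : ∀ᶠ z in 𝓝 y, ContDiffAt 𝕜 1 Φ z :=
    (hΦ.of_le (by simp) : ContDiffAt 𝕜 1 Φ y).eventually (by simp)
  have he : (fun z => fderiv 𝕜 (fun x => f (Φ x)) z v)
      =ᶠ[𝓝 y] fun z => fderiv 𝕜 f (Φ z) (fderiv 𝕜 Φ z v) := by
    filter_upwards [hfe, hΦe] with z hz hz'
    rw [fderiv_comp_eq (hz.differentiableAt (by simp)) (hz'.differentiableAt (by simp))]
    rfl
  have hf2 : DifferentiableAt 𝕜 (fderiv 𝕜 f) (Φ y) :=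
    (hf.fderiv_right (m := 1) (by norm_cast)).differentiableAt (by simp)
  have hΦ2 : DifferentiableAt 𝕜 (fderiv 𝕜 Φ) y :=
    (hΦ.fderiv_right (m := 1) (by norm_cast)).differentiableAt (by simp)
  have hΦ1 := hΦ.differentiableAt (by simp)
  have h1 := ((differentiableAt_comp (f := fderiv 𝕜 f) hf2 hΦ1).hasFDerivAt.clm_apply
    (hΦ2.hasFDerivAt.clm_apply (hasFDerivAt_const v y))).fderiv
  rw [he.fderiv_eq, h1, fderiv_comp_eq (f := fderiv 𝕜 f) hf2 hΦ1]
  simp only [add_apply, ContinuousLinearMap.comp_apply, ContinuousLinearMap.flip_apply,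
    zero_apply, map_zero, zero_add]
  exact add_comm _ _

variable {M : Type*} [TopologicalSpace M] [ChartedSpace (Fin n → 𝕜) M] {φ ψ : CoordChart 𝕜 n M}
  {g : ContraForm 𝕜 n M}

theorem contraComp_apply_of_mem {x : M} (hx : x ∈ φ.source) (i j : Fin n) :
    contraComp g φ (φ x) i j
      = g x (dif (fun z : M => φ z i) x) (dif (fun z : M => φ z j) x) := by
  rw [contraComp, Matrix.of_apply, coframe, coframe, φ.left_inv hx]

variable (hφ : IsCoordinatePatch φ) (hψ : IsCoordinatePatch ψ)

section

variable {y : Fin n → 𝕜} (hy : y ∈ ψ.target) (hy' : ψ.symm y ∈ φ.source)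
include hφ hψ hy hy'

/-- The matrix of a bilinear form on the cotangent bundle in new coordinates. -/
theorem contraComp_transition (g : ContraForm 𝕜 n M) :
    contraComp g φ (φ (ψ.symm y)) = jacobian (fun z => φ (ψ.symm z)) y * contraComp g ψ y
      * (jacobian (fun z => φ (ψ.symm z)) y).transpose := by
  have hd : ∀ i, dif (fun z : M => φ z i) (ψ.symm y)
      = ∑ a, jacobian (fun z => φ (ψ.symm z)) y i a • coframe ψ a y := fun i => by
    have hm : MDifferentiableAt 𝓘(𝕜, Fin n → 𝕜) 𝓘(𝕜, 𝕜) (fun z : M => φ z i) (ψ.symm y) :=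
      (contMDiffAt_coord hφ hy' i).mdifferentiableAt (by simp)
    rw [dif_eq_sum hψ hy hm]
    refine Finset.sum_congr rfl fun a _ => ?_
    have h1 : pd a ((fun z : M => φ z i) ∘ ψ.symm) y
        = jacobian (fun z => φ (ψ.symm z)) y i a := by
      have hΦ := (contDiffAt_transition hψ hφ hy hy').differentiableAt (by simp)
      exact DFunLike.congr_fun (fderiv_apply hΦ i) _
    rw [h1]
  ext i j
  rw [contraComp_apply_of_mem hy', hd, hd]
  simp only [map_sum, map_smul, LinearMap.sum_apply, LinearMap.smul_apply, smul_eq_mul,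
    Matrix.mul_apply, Matrix.transpose_apply, Finset.sum_mul, Finset.mul_sum]
  refine Finset.sum_congr rfl fun a _ => Finset.sum_congr rfl fun b _ => ?_
  change _ = _ * g (ψ.symm y) (coframe ψ b y) (coframe ψ a y) * _
  ring

omit hφ hψ hy in
theorem mem_regularTarget_transition (hy : y ∈ regularTarget g ψ) :
    φ (ψ.symm y) ∈ regularTarget g φ :=
  ⟨φ.map_source hy', by rw [mem_preimage, φ.left_inv hy']; exact hy.2⟩

omit hy in
theorem det_jacobian_ne_zero (hy : y ∈ regularTarget g ψ) :
    (jacobian (fun z => φ (ψ.symm z)) y).det ≠ 0 := by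
  have hmem := mem_regularTarget_transition hy' hy
  have h := (mem_invertibleLocus_iff hφ hmem.1 g).1 hmem.2
  rw [contraComp_transition hφ hψ hy.1 hy', Matrix.det_mul, Matrix.det_mul] at h
  exact left_ne_zero_of_mul (left_ne_zero_of_mul h)

omit hy in
theorem form_transition (hy : y ∈ regularTarget g ψ) (u v : Fin n → 𝕜) :
    formOfMatrix ((contraComp g ψ y)⁻¹) u v
      = formOfMatrix ((contraComp g φ (φ (ψ.symm y)))⁻¹)
        (fderiv 𝕜 (fun z => φ (ψ.symm z)) y u) (fderiv 𝕜 (fun z => φ (ψ.symm z)) y v) := by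
  have hJ := (det_jacobian_ne_zero hφ hψ hy' hy).isUnit
  set J := jacobian (fun z => φ (ψ.symm z)) y with hJdef
  have hJt : IsUnit J.transpose.det := by rwa [Matrix.det_transpose]
  have h : J.transpose * ((contraComp g φ (φ (ψ.symm y)))⁻¹ * J) = (contraComp g ψ y)⁻¹ := by
    rw [contraComp_transition hφ hψ hy.1 hy', Matrix.mul_inv_rev, Matrix.mul_inv_rev,
      Matrix.mul_assoc, Matrix.mul_assoc, Matrix.nonsing_inv_mul _ hJ, Matrix.mul_one,
      ← Matrix.mul_assoc, Matrix.mul_nonsing_inv _ hJt, Matrix.one_mul]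
  rw [formOfMatrix_apply, formOfMatrix_apply, ← jacobian_mulVec, ← jacobian_mulVec, ← hJdef, ← h,
    ← Matrix.mulVec_mulVec, ← Matrix.mulVec_mulVec, Matrix.dotProduct_mulVec u,
    Matrix.vecMul_transpose]

omit hy in
/-- The transformation law of the Christoffel symbols of a contravariant metric. -/
theorem IsContravariantMetric.fderiv_christoffelVec (hg : IsContravariantMetric g)
    (hy : y ∈ regularTarget g ψ) (u v : Fin n → 𝕜) :
    fderiv 𝕜 (fun z => φ (ψ.symm z)) y
        (christoffelVec (fun z => (contraComp g ψ z)⁻¹) y u v)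
      = fderiv 𝕜 (fderiv 𝕜 (fun z => φ (ψ.symm z))) y u v
        + christoffelVec (fun z => (contraComp g φ z)⁻¹) (φ (ψ.symm y))
          (fderiv 𝕜 (fun z => φ (ψ.symm z)) y u) (fderiv 𝕜 (fun z => φ (ψ.symm z)) y v) := by
  have hmem := mem_regularTarget_transition hy' hy
  refine _root_.fderiv_christoffelVec (contDiffAt_transition hψ hφ hy.1 hy')
    (hg.differentiableAt_form_inv hφ hmem) (Eventually.of_forall (hg.isSymm_inv φ))
    (IsContravariantMetric.det_inv_ne_zero hφ hmem)
    (hg.differentiableAt_form_inv hψ hy) (Eventually.of_forall (hg.isSymm_inv ψ))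
    (IsContravariantMetric.det_inv_ne_zero hψ hy) ?_ ?_ u v
  · filter_upwards [(hg.isOpen_regularTarget ψ).mem_nhds hy,
      (ψ.isOpen_inter_preimage_symm φ.open_source).mem_nhds ⟨hy.1, hy'⟩] with z hz hz' u v
    exact form_transition hφ hψ hz'.2 hz u v
  · have hJ := (det_jacobian_ne_zero hφ hψ hy' hy).isUnit
    intro w
    refine ⟨(jacobian (fun z => φ (ψ.symm z)) y)⁻¹.mulVec w, ?_⟩
    rw [← jacobian_mulVec, Matrix.mulVec_mulVec, Matrix.mul_nonsing_inv _ hJ, Matrix.one_mulVec]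

end

include hφ in
/-- A function is a flat coordinate if in one coordinate patch its second derivative is given by
the Christoffel symbols. -/
theorem IsContravariantMetric.isFlatCoordinateOn (hg : IsContravariantMetric g)
    {O : Set (Fin n → 𝕜)} (hO : IsOpen O) (hOs : O ⊆ regularTarget g φ) {f : (Fin n → 𝕜) → 𝕜}
    (hf : ContDiffOn 𝕜 ∞ f O)
    (hess : ∀ z ∈ O, ∀ u v, fderiv 𝕜 (fderiv 𝕜 f) z u v
      = fderiv 𝕜 f z (christoffelVec (fun z => (contraComp g φ z)⁻¹) z u v)) :
    IsFlatCoordinateOn g (φ.source ∩ φ ⁻¹' O) fun x => f (φ x) where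
  smooth := fun x hx =>
    (((hf.contDiffAt (hO.mem_nhds hx.2)).contMDiffAt).comp x
      (contMDiffAt_of_mem_maximalAtlas hφ hx.1)).contMDiffWithinAt
  const := by
    intro ψ hψ y hy hyU i j
    have hfy := hf.contDiffAt (hO.mem_nhds hyU.2)
    have hyr : y ∈ regularTarget g ψ :=
      ⟨hy, by have := (hOs hyU.2).2; rwa [mem_preimage, φ.left_inv hyU.1] at this⟩
    have hΦ := contDiffAt_transition hψ hφ hy hyU.1
    set Φ := fun z => φ (ψ.symm z) with hΦdef
    have h1 : fderiv 𝕜 (fun x => f (Φ x)) y = (fderiv 𝕜 f (Φ y)).comp (fderiv 𝕜 Φ y) :=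
      fderiv_comp_eq (hfy.differentiableAt (by simp)) (hΦ.differentiableAt (by simp))
    have h2 : ∑ s, contraComp g ψ y i s * pd s (pd j ((fun x => f (φ x)) ∘ ψ.symm)) y
        = fderiv 𝕜 (fun z => fderiv 𝕜 (fun x => f (Φ x)) z (stdVec 𝕜 j)) y (contraComp g ψ y i) :=
      sum_mul_pd _ _ _
    have h3 : ∑ s, contraChristoffel g ψ j i s y * pd s ((fun x => f (φ x)) ∘ ψ.symm) y
        = -fderiv 𝕜 (fun x => f (Φ x)) y (christoffelVec (fun z => (contraComp g ψ z)⁻¹) y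
          (contraComp g ψ y i) (stdVec 𝕜 j)) := by
      rw [← map_neg, ← sum_mul_pd]
      exact Finset.sum_congr rfl fun s _ => by rw [contraChristoffel_eq]; rfl
    rw [h2, h3, fderiv_fderiv_comp hfy hΦ, h1, ContinuousLinearMap.comp_apply,
      hg.fderiv_christoffelVec hφ hψ hyU.1 hyr, hess _ hyU.2, map_add]
    ring

include hφ in
theorem linearIndependent_dif {O : Set (Fin n → 𝕜)} (hO : IsOpen O) {f : Fin n → (Fin n → 𝕜) → 𝕜}
    (hf : ∀ a, ContDiffOn 𝕜 ∞ (f a) O)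
    (hli : ∀ z ∈ O, LinearIndependent 𝕜 fun a => fderiv 𝕜 (f a) z) {x : M}
    (hx : x ∈ φ.source) (hxO : φ x ∈ O) :
    LinearIndependent 𝕜 fun a => (dif (fun x => f a (φ x)) x : Cotan 𝕜 n x) := by
  obtain ⟨y, hy, rfl⟩ : ∃ y ∈ φ.target, φ.symm y = x := ⟨φ x, φ.map_source hx, φ.left_inv hx⟩
  rw [φ.right_inv hy] at hxO
  rw [Fintype.linearIndependent_iff]
  intro c hc
  refine Fintype.linearIndependent_iff.1 (hli y hxO) c ?_
  ext1 v
  have h1 := DFunLike.congr_fun hc (toTan φ y v)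
  simp only [LinearMap.sum_apply, LinearMap.smul_apply, LinearMap.zero_apply] at h1
  simp only [sum_apply, smul_apply, zero_apply]
  rw [← h1]
  refine Finset.sum_congr rfl fun a _ => ?_
  have hm : MDifferentiableAt 𝓘(𝕜, Fin n → 𝕜) 𝓘(𝕜, 𝕜) (fun x => f a (φ x)) (φ.symm y) := by
    have h2 : ContMDiffAt 𝓘(𝕜, Fin n → 𝕜) 𝓘(𝕜, 𝕜) ∞ (f a) (φ (φ.symm y)) := by
      rw [φ.right_inv hy]
      exact ((hf a).contDiffAt (hO.mem_nhds hxO)).contMDiffAt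
    exact (h2.comp _ (contMDiffAt_of_mem_maximalAtlas hφ hx)).mdifferentiableAt (by simp)
  rw [dif_apply_toTan hφ hy hm]
  have he : (fun x => f a (φ x)) ∘ φ.symm =ᶠ[𝓝 y] f a := by
    filter_upwards [φ.open_target.mem_nhds hy] with z hz
    simp [φ.right_inv hz]
  rw [he.fderiv_eq]

theorem IsContravariantMetric.mem_closure_regularTarget (hg : IsContravariantMetric g)
    {y : Fin n → 𝕜} (hy : y ∈ ψ.target) : y ∈ closure (regularTarget g ψ) := by
  rw [mem_closure_iff]
  intro O hO hyO
  have h1 : IsOpen (ψ.source ∩ ψ ⁻¹' O) := ψ.isOpen_inter_preimage hO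
  obtain ⟨x, ⟨hx, hxO⟩, hxl⟩ := hg.dense.inter_open_nonempty _ h1
    ⟨ψ.symm y, ψ.map_target hy, by rw [mem_preimage, ψ.right_inv hy]; exact hyO⟩
  exact ⟨ψ x, hxO, ψ.map_source hx, by rw [mem_preimage, ψ.left_inv hx]; exact hxl⟩

end Transition

section Flatness

variable {𝕜 : Type*} [RCLike 𝕜] {n : ℕ} {M : Type*} [TopologicalSpace M]
  [ChartedSpace (Fin n → 𝕜) M] [IsManifold 𝓘(𝕜, Fin n → 𝕜) ∞ M]
  (F : FrobeniusManifold 𝕜 n M)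

namespace FrobeniusManifold

/-- Every metric of the pencil is flat. -/
theorem isFlatContra_metricPencil (lam : 𝕜) : IsFlatContra (F.metricPencil lam) := by
  intro x hx
  obtain ⟨φ, hφ, hxs⟩ := F.flat x
  have hg := F.isContravariantMetric_metricPencil lam
  have hy : φ x ∈ regularTarget (F.metricPencil lam) φ :=
    ⟨φ.map_source hxs, by rw [mem_preimage, φ.left_inv hxs]; exact hx⟩
  obtain ⟨O, hO, hxO, hOs, f, hf, hess, hli⟩ := F.exists_flat_functions hφ hy
  refine ⟨φ.source ∩ φ ⁻¹' O, φ.isOpen_inter_preimage hO, ⟨hxs, hxO⟩, fun z hz => ?_,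
    fun a z => f a (φ z), fun a => hg.isFlatCoordinateOn hφ.1 hO hOs (hf a) (hess a),
    fun z hz => linearIndependent_dif hφ.1 hO hf hli hz.1 hz.2⟩
  have := (hOs hz.2).2
  rwa [mem_preimage, φ.left_inv hz.1] at this

end FrobeniusManifold
end Flatness

/-! ### Extension of the connection across the discriminant -/

section Extension

variable {𝕜 : Type*} [RCLike 𝕜] {n : ℕ} {M : Type*} [TopologicalSpace M]
  [ChartedSpace (Fin n → 𝕜) M] {φ ψ : CoordChart 𝕜 n M} {g : ContraForm 𝕜 n M}

theorem eq_inv_mulVec {J : Matrix (Fin n) (Fin n) 𝕜} (hJ : J.det ≠ 0) {v w : Fin n → 𝕜}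
    (h : J.mulVec v = w) : v = J⁻¹.mulVec w := by
  rw [← h, Matrix.mulVec_mulVec, Matrix.nonsing_inv_mul _ hJ.isUnit, Matrix.one_mulVec]

variable (F : FrobeniusManifold 𝕜 n M)

namespace FrobeniusManifold

theorem regularTarget_cotMetric : regularTarget F.cotMetric ψ = ψ.target := by
  rw [regularTarget, invertibleLocus_cotMetric, preimage_univ, inter_univ]

theorem christoffelVec_cotMetric (hφ : F.IsFlatChart φ) {y : Fin n → 𝕜} (hy : y ∈ φ.target)
    (u v : Fin n → 𝕜) :
    christoffelVec (fun z => (contraComp F.cotMetric φ z)⁻¹) y u v = 0 := by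
  have hc : (fun z => (contraComp F.cotMetric φ z)⁻¹)
      =ᶠ[𝓝 y] fun _ => (contraComp F.cotMetric φ y)⁻¹ := by
    filter_upwards [φ.open_target.mem_nhds hy] with z hz
    congr 1
    ext i j
    rw [F.contraComp_cotMetric hφ.1 hz, F.contraComp_cotMetric hφ.1 hy, F.sharpLoc_const hφ hy hz]
  have hpd : ∀ l i j, pd l (fun z => (contraComp F.cotMetric φ z)⁻¹ i j) y = 0 := fun l i j => by
    have h : (fun z => (contraComp F.cotMetric φ z)⁻¹ i j)
        =ᶠ[𝓝 y] fun _ => (contraComp F.cotMetric φ y)⁻¹ i j := by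
      filter_upwards [hc] with z hz
      rw [hz]
    rw [pd, h.fderiv_eq]
    simp
  ext k
  simp [christoffelVec, christoffel, hpd]

variable (hφ : F.IsFlatChart φ) (hψ : IsCoordinatePatch ψ) {y : Fin n → 𝕜}
  (hy : y ∈ ψ.target) (hy' : ψ.symm y ∈ φ.source)
include hφ hψ hy hy'

omit hφ in
/-- Multiplication by `E - lam` commutes with changes of coordinates, read on the rows of the
matrix of the pencil. -/
theorem fderiv_contraComp_metricPencil (hφ : IsCoordinatePatch φ) (lam : 𝕜) (i : Fin n) :
    fderiv 𝕜 (fun z => φ (ψ.symm z)) y (contraComp (F.metricPencil lam) ψ y i)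
      = F.pencilOp φ lam (φ (ψ.symm y))
        (fderiv 𝕜 (fun z => φ (ψ.symm z)) y (F.sharpLoc ψ i y)) := by
  have hz : φ (ψ.symm y) ∈ φ.target := φ.map_source hy'
  have hJ := det_jacobian_ne_zero hφ hψ hy' (g := F.cotMetric)
    (by rw [regularTarget_cotMetric]; exact hy)
  have h1 := contraComp_transition hφ hψ hy hy' (F.metricPencil lam)
  have h2 := contraComp_transition hφ hψ hy hy' F.cotMetric
  simp only [← jacobian_mulVec]
  set J := jacobian (fun z => φ (ψ.symm z)) y with hJdef
  -- row `a` of `J G Jᵀ` is the combination of the vectors `J Gᵢ` with coefficients `J_{ai}`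
  have hrow : ∀ (G : Matrix (Fin n) (Fin n) 𝕜) a,
      (J * G * J.transpose) a = ∑ i, J a i • J.mulVec (G i) := by
    intro G a
    ext b
    rw [Matrix.mul_assoc, Matrix.mul_apply, Finset.sum_apply]
    refine Finset.sum_congr rfl fun c _ => ?_
    simp [Matrix.mul_apply, Matrix.mulVec, dotProduct, _root_.mul_comm]
  have hS : contraComp F.cotMetric ψ y = Matrix.of fun i => F.sharpLoc ψ i y := by
    ext i j
    exact F.contraComp_cotMetric hψ hy i j
  have hdiff : ∀ b, J.mulVec (fun i => J.mulVec (contraComp (F.metricPencil lam) ψ y i) b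
      - F.pencilOp φ lam (φ (ψ.symm y)) (J.mulVec (F.sharpLoc ψ i y)) b) = 0 := by
    intro b
    ext a
    have e1 := congrFun ((congrFun h1 a).symm.trans
      (funext fun j => F.contraComp_metricPencil hφ hz lam a j)) b
    have e2 : F.sharpLoc φ a (φ (ψ.symm y)) = ∑ i, J a i • J.mulVec (F.sharpLoc ψ i y) := by
      have := (funext fun j => (F.contraComp_cotMetric hφ hz a j).symm :
        F.sharpLoc φ a (φ (ψ.symm y)) = contraComp F.cotMetric φ (φ (ψ.symm y)) a)
      rw [this, h2, hrow, hS]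
      rfl
    rw [hrow, e2, map_sum, Finset.sum_apply, Finset.sum_apply] at e1
    simp only [map_smul, Pi.smul_apply, smul_eq_mul] at e1
    simp only [Matrix.mulVec, dotProduct, mul_sub, Finset.sum_sub_distrib, Pi.zero_apply] at e1 ⊢
    exact sub_eq_zero.2 e1
  ext b
  have h3 := congrFun (eq_inv_mulVec hJ (hdiff b)) i
  simp only [Matrix.mulVec_zero, Pi.zero_apply] at h3
  exact sub_eq_zero.1 h3

theorem contraChristoffel_cotMetric (k i j : Fin n) :
    contraChristoffel F.cotMetric ψ k i j y
      = ((jacobian (fun z => φ (ψ.symm z)) y)⁻¹.mulVec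
        (-fderiv 𝕜 (fderiv 𝕜 (fun z => φ (ψ.symm z))) y
          (contraComp F.cotMetric ψ y i) (stdVec 𝕜 k))) j := by
  have hyr : y ∈ regularTarget F.cotMetric ψ := by rw [regularTarget_cotMetric]; exact hy
  have h := F.isContravariantMetric_cotMetric.fderiv_christoffelVec hφ.1 hψ hy' hyr
    (contraComp F.cotMetric ψ y i) (stdVec 𝕜 k)
  rw [F.christoffelVec_cotMetric hφ (φ.map_source hy'), add_zero, ← jacobian_mulVec] at h
  rw [contraChristoffel_eq, ← h, Matrix.mulVec_neg,
    ← eq_inv_mulVec (det_jacobian_ne_zero hφ.1 hψ hy' hyr) rfl]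
  rfl

variable [IsManifold 𝓘(𝕜, Fin n → 𝕜) ∞ M]

omit hy in
/-- The contravariant Christoffel symbols of the pencil in arbitrary coordinates `ψ`. -/
theorem contraChristoffel_metricPencil_transition {lam : 𝕜}
    (hy : y ∈ regularTarget (F.metricPencil lam) ψ) (k i j : Fin n) :
    contraChristoffel (F.metricPencil lam) ψ k i j y
      = ((jacobian (fun z => φ (ψ.symm z)) y)⁻¹.mulVec
        (F.rOp φ (φ (ψ.symm y)) (F.mulLoc φ (φ (ψ.symm y))
            (fderiv 𝕜 (fun z => φ (ψ.symm z)) y (F.sharpLoc ψ i y))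
            (fderiv 𝕜 (fun z => φ (ψ.symm z)) y (stdVec 𝕜 k)))
          - fderiv 𝕜 (fderiv 𝕜 (fun z => φ (ψ.symm z))) y
            (contraComp (F.metricPencil lam) ψ y i) (stdVec 𝕜 k))) j := by
  have hmem := mem_regularTarget_transition hy' hy
  have h := (F.isContravariantMetric_metricPencil lam).fderiv_christoffelVec hφ.1 hψ hy' hy
    (contraComp (F.metricPencil lam) ψ y i) (stdVec 𝕜 k)
  rw [F.fderiv_contraComp_metricPencil hψ hy.1 hy' hφ.1,
    F.christoffelVec_metricPencil hφ hmem, ← sub_eq_add_neg, ← jacobian_mulVec] at h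
  rw [contraChristoffel_eq, ← neg_sub, ← h, Matrix.mulVec_neg,
    ← eq_inv_mulVec (det_jacobian_ne_zero hφ.1 hψ hy' hy) rfl]
  rfl

omit hφ hy hy' in
/-- The Christoffel symbols of the pencil extend smoothly across the complement of `M₀`, and they
depend on `lam` as an affine function. -/
theorem exists_smooth_contraChristoffel (hy : y ∈ ψ.target) (k i j : Fin n) :
    ∃ N : Set (Fin n → 𝕜), IsOpen N ∧ y ∈ N ∧ N ⊆ ψ.target ∧ ∃ p : (Fin n → 𝕜) → 𝕜,
      ContDiffOn 𝕜 ∞ p N ∧ ∀ lam, ∀ z ∈ N, z ∈ regularTarget (F.metricPencil lam) ψ →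
        contraChristoffel (F.metricPencil lam) ψ k i j z
          = p z - lam * contraChristoffel F.cotMetric ψ k i j z := by
  obtain ⟨φ, hφ, hy'⟩ := F.flat (ψ.symm y)
  set N := ψ.target ∩ ψ.symm ⁻¹' φ.source with hN
  have hNo : IsOpen N := ψ.isOpen_inter_preimage_symm φ.open_source
  set Φ := fun z => φ (ψ.symm z) with hΦdef
  have hΦ : ContDiffOn 𝕜 ∞ Φ N := fun z hz =>
    (contDiffAt_transition hψ hφ.1 hz.1 hz.2).contDiffWithinAt
  have hΦt : MapsTo Φ N φ.target := fun z hz => φ.map_source hz.2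
  have hD : ContDiffOn 𝕜 ∞ (fderiv 𝕜 Φ) N := hΦ.fderiv_of_isOpen hNo le_rfl
  have hD2 : ContDiffOn 𝕜 ∞ (fderiv 𝕜 (fderiv 𝕜 Φ)) N := hD.fderiv_of_isOpen hNo le_rfl
  have hJ : ∀ a i, ContDiffOn 𝕜 ∞ (fun z => jacobian Φ z a i) N := fun a i =>
    contDiffOn_pi.1 (hD.clm_apply contDiffOn_const) a
  have hJ0 : ∀ z ∈ N, (jacobian Φ z).det ≠ 0 := fun z hz =>
    det_jacobian_ne_zero hφ.1 hψ hz.2 (g := F.cotMetric)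
      (by rw [regularTarget_cotMetric]; exact hz.1)
  have hG : ContDiffOn 𝕜 ∞ (fun z => contraComp F.intersectionForm ψ z i) N :=
    contDiffOn_pi.2 fun b => by
      have h := F.contDiffOn_contraComp_metricPencil hψ 0 i b
      rw [metricPencil_zero] at h
      exact h.mono inter_subset_left
  have hvec : ContDiffOn 𝕜 ∞ (fun z =>
      F.rOp φ (Φ z) (F.mulLoc φ (Φ z) (fderiv 𝕜 Φ z (F.sharpLoc ψ i z))
        (fderiv 𝕜 Φ z (stdVec 𝕜 k)))
      - fderiv 𝕜 (fderiv 𝕜 Φ) z (contraComp F.intersectionForm ψ z i) (stdVec 𝕜 k)) N := by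
    refine ContDiffOn.sub ?_ ((hD2.clm_apply hG).clm_apply contDiffOn_const)
    refine ContDiffOn.clm_apply ((F.contDiffOn_rOp hφ.1).comp hΦ hΦt) ?_
    refine ContDiffOn.clm_apply (ContDiffOn.clm_apply ((F.contDiffOn_mulLoc hφ.1).comp hΦ hΦt) ?_)
      (hD.clm_apply contDiffOn_const)
    exact hD.clm_apply ((F.contDiffOn_sharpLoc hψ i).mono inter_subset_left)
  refine ⟨N, hNo, ⟨hy, hy'⟩, inter_subset_left, fun z => ((jacobian Φ z)⁻¹.mulVec
    (F.rOp φ (Φ z) (F.mulLoc φ (Φ z) (fderiv 𝕜 Φ z (F.sharpLoc ψ i z))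
        (fderiv 𝕜 Φ z (stdVec 𝕜 k)))
      - fderiv 𝕜 (fderiv 𝕜 Φ) z (contraComp F.intersectionForm ψ z i) (stdVec 𝕜 k))) j,
    ?_, fun lam z hz hzr => ?_⟩
  · simp only [Matrix.mulVec, dotProduct]
    exact ContDiffOn.sum fun b _ => (contDiffOn_inv_apply hJ hJ0 j b).mul (contDiffOn_pi.1 hvec b)
  · rw [F.contraChristoffel_metricPencil_transition hφ hψ hz.2 hzr,
      F.contraChristoffel_cotMetric hφ hψ hz.1 hz.2]
    have hlin : ∀ a b v : Fin n → 𝕜, fderiv 𝕜 (fderiv 𝕜 Φ) z (a - lam • b) v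
        = fderiv 𝕜 (fderiv 𝕜 Φ) z a v - lam • fderiv 𝕜 (fderiv 𝕜 Φ) z b v := fun a b v => by simp
    have hmul : ∀ (K : Matrix (Fin n) (Fin n) 𝕜) (a b c : Fin n → 𝕜),
        (K.mulVec (a - (b - lam • c))) j = (K.mulVec (a - b)) j - lam * (K.mulVec (-c)) j := by
      intro K a b c
      simp only [Matrix.mulVec_sub, Matrix.mulVec_smul, Matrix.mulVec_neg, Pi.sub_apply,
        Pi.smul_apply, Pi.neg_apply, smul_eq_mul]
      ring
    refine (congrArg (fun w => ((jacobian Φ z)⁻¹.mulVec (_ - w)) j) (hlin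
      (contraComp F.intersectionForm ψ z i) (contraComp F.cotMetric ψ z i)
      (stdVec 𝕜 k))).trans (hmul _ _ _ _)

end FrobeniusManifold
end Extension

section LeviCivita

variable {𝕜 : Type*} [RCLike 𝕜] {n : ℕ} {M : Type*} [TopologicalSpace M]
  [ChartedSpace (Fin n → 𝕜) M] [IsManifold 𝓘(𝕜, Fin n → 𝕜) ∞ M]
  (F : FrobeniusManifold 𝕜 n M)

namespace FrobeniusManifold

/-- The contravariant Levi-Civita connection of the intersection form: the continuous extension of
its Christoffel symbols. -/
def intersectionConnection : ContraConnection 𝕜 n M := fun ψ k i j =>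
  extendFrom (regularTarget F.intersectionForm ψ) (contraChristoffel F.intersectionForm ψ k i j)

theorem isContravariantMetric_intersectionForm : IsContravariantMetric F.intersectionForm := by
  have h := F.isContravariantMetric_metricPencil 0
  rwa [metricPencil_zero] at h

omit [IsManifold 𝓘(𝕜, Fin n → 𝕜) ∞ M] in
theorem isContravariantLeviCivita_cotMetric :
    IsContravariantLeviCivita F.cotMetric (contraChristoffel F.cotMetric) where
  smooth ψ hψ k i j := by
    have h := F.isContravariantMetric_cotMetric.contDiffOn_contraChristoffel hψ k i j
    rwa [regularTarget_cotMetric] at h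
  eq_on_locus _ _ _ _ _ _ _ _ := rfl

/-- Near each point the extended connection is smooth, and it determines the connections of the
whole pencil. -/
theorem intersectionConnection_spec {ψ : CoordChart 𝕜 n M} (hψ : IsCoordinatePatch ψ)
    {y : Fin n → 𝕜} (hy : y ∈ ψ.target) (k i j : Fin n) :
    ContDiffAt 𝕜 ∞ (F.intersectionConnection ψ k i j) y ∧
      ∀ lam, y ∈ regularTarget (F.metricPencil lam) ψ →
        F.intersectionConnection ψ k i j y - lam * contraChristoffel F.cotMetric ψ k i j y
          = contraChristoffel (F.metricPencil lam) ψ k i j y := by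
  obtain ⟨N, hNo, hyN, hN, p, hp, hpe⟩ := F.exists_smooth_contraChristoffel hψ hy k i j
  have he : ∀ z ∈ N, F.intersectionConnection ψ k i j z = p z := by
    intro z hz
    refine extendFrom_eq (F.isContravariantMetric_intersectionForm.mem_closure_regularTarget
      (hN hz)) ?_
    have ht : Tendsto p (𝓝[regularTarget F.intersectionForm ψ] z) (𝓝 (p z)) :=
      (hp.continuousOn.continuousAt (hNo.mem_nhds hz)).tendsto.mono_left nhdsWithin_le_nhds
    refine ht.congr' ?_
    filter_upwards [nhdsWithin_le_nhds (hNo.mem_nhds hz), self_mem_nhdsWithin] with x hx hx'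
    have h := hpe 0 x hx (by rw [metricPencil_zero]; exact hx')
    rw [metricPencil_zero, zero_mul, sub_zero] at h
    exact h.symm
  refine ⟨(hp.contDiffAt (hNo.mem_nhds hyN)).congr_of_eventuallyEq ?_, fun lam hlam => ?_⟩
  · filter_upwards [hNo.mem_nhds hyN] with z hz using he z hz
  · rw [he y hyN, hpe lam y hyN hlam]

theorem isContravariantLeviCivita_metricPencil (lam : 𝕜) :
    IsContravariantLeviCivita (F.metricPencil lam) fun φ k i j y =>
      F.intersectionConnection φ k i j y - lam * contraChristoffel F.cotMetric φ k i j y where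
  smooth ψ hψ k i j := by
    have h1 : ContDiffOn 𝕜 ∞ (F.intersectionConnection ψ k i j) ψ.target := fun y hy =>
      (F.intersectionConnection_spec hψ hy k i j).1.contDiffWithinAt
    exact h1.sub (contDiffOn_const.mul (F.isContravariantLeviCivita_cotMetric.smooth ψ hψ k i j))
  eq_on_locus ψ hψ y hy hyl k i j :=
    (F.intersectionConnection_spec hψ hy k i j).2 lam ⟨hy, hyl⟩

theorem isFlatPencil : IsFlatPencil F.intersectionForm F.cotMetric := by
  refine ⟨F.isContravariantMetric_intersectionForm, F.isContravariantMetric_cotMetric,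
    F.isContravariantMetric_metricPencil, ⟨F.intersectionConnection,
      contraChristoffel F.cotMetric, ?_, F.isContravariantLeviCivita_cotMetric,
      F.isContravariantLeviCivita_metricPencil⟩, F.isFlatContra_metricPencil⟩
  have h := F.isContravariantLeviCivita_metricPencil 0
  simp only [metricPencil_zero, zero_mul, sub_zero] at h
  exact h

/-- The Levi-Civita connection of the pencil in flat coordinates is `Γ^{αβ}_γ = c^{αε}_γ R^β_ε`,
first on `M₀` and then everywhere by continuity. -/
theorem leviCivita_flatChart {lam : 𝕜} {Γ : ContraConnection 𝕜 n M}
    (hΓ : IsContravariantLeviCivita (F.metricPencil lam) Γ) {φ : CoordChart 𝕜 n M}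
    (hφ : F.IsFlatChart φ) {y : Fin n → 𝕜} (hy : y ∈ φ.target) (α β γ : Fin n) :
    Γ φ γ α β y = ∑ ε, F.cUp φ α ε γ y * F.R φ β ε y := by
  rw [F.sum_cUp_mul_R hφ hy]
  set h : (Fin n → 𝕜) → 𝕜 := fun z =>
    F.rOp φ z (F.mulLoc φ z (F.sharpLoc φ α z) (stdVec 𝕜 γ)) β with hdef
  have hc : ContDiffOn 𝕜 ∞ h φ.target :=
    contDiffOn_pi.1 ((F.contDiffOn_rOp hφ.1).clm_apply
      (((F.contDiffOn_mulLoc hφ.1).clm_apply (F.contDiffOn_sharpLoc hφ.1 α)).clm_apply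
        contDiffOn_const)) β
  have hcl := (F.isContravariantMetric_metricPencil lam).mem_closure_regularTarget hy
  have := mem_closure_iff_nhdsWithin_neBot.1 hcl
  have hnhds := φ.open_target.mem_nhds hy
  have t1 : Tendsto (Γ φ γ α β) (𝓝[regularTarget (F.metricPencil lam) φ] y) (𝓝 (Γ φ γ α β y)) :=
    ((hΓ.smooth φ hφ.1 γ α β).continuousOn.continuousAt hnhds).tendsto.mono_left
      nhdsWithin_le_nhds
  have t2 : Tendsto h (𝓝[regularTarget (F.metricPencil lam) φ] y) (𝓝 (h y)) :=
    (hc.continuousOn.continuousAt hnhds).tendsto.mono_left nhdsWithin_le_nhds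
  refine tendsto_nhds_unique t1 (t2.congr' ?_)
  filter_upwards [self_mem_nhdsWithin] with z hz
  rw [hΓ.eq_on_locus φ hφ.1 z hz.1 hz.2, F.contraChristoffel_metricPencil hφ hz]

end FrobeniusManifold
end LeviCivita

/-! ### Normalized flat coordinates and the function `τ` -/

section Gluing

/-- On a simply connected, locally path connected space, local functions that differ by locally
constant functions can be corrected by constants to a global function: the possible corrections
form a covering space, which has a section. -/
theorem exists_function_eventuallyEq_add_const {X A : Type*} [TopologicalSpace X] [AddCommGroup A]
    [SimplyConnectedSpace X] [LocallyPathConnectedSpace X] {U : X → Set X} {τ : X → X → A}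
    (hU : ∀ i, IsOpen (U i)) (hmem : ∀ x, x ∈ U x)
    (hτ : ∀ i j, ∀ x ∈ U i ∩ U j, ∀ᶠ y in 𝓝 x, τ i y - τ j y = τ i x - τ j x) :
    ∃ f : X → A, ∀ x, ∃ c, ∀ᶠ y in 𝓝 x, f y = τ x y + c := by
  let _ : TopologicalSpace A := ⊥
  have : DiscreteTopology A := ⟨rfl⟩
  let Z : FiberBundleCore X X A :=
    { baseSet := U
      isOpen_baseSet := hU
      indexAt := id
      mem_baseSet_at := hmem
      coordChange := fun i j x v => v + (τ i x - τ j x)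
      coordChange_self := fun i x _ v => by simp
      continuousOn_coordChange := by
        rintro i j ⟨x, v⟩ ⟨hx, -⟩
        refine ContinuousAt.continuousWithinAt ?_
        refine continuousAt_const.congr (f := fun _ => v + (τ i x - τ j x)) ?_
        have hv : ∀ᶠ w in 𝓝 v, w = v := by simp [nhds_discrete]
        filter_upwards [(hτ i j x hx).prod_nhds hv] with p hp
        rw [hp.1, hp.2]
      coordChange_comp := fun i j k x _ v => by abel }
  have hcov : IsCoveringMap (Bundle.TotalSpace.proj : Z.TotalSpace → X) :=
    FiberBundle.isCoveringMap
  obtain ⟨x₀⟩ := (inferInstance : Nonempty X)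
  obtain ⟨G, ⟨-, hG⟩, -⟩ := hcov.existsUnique_continuousMap_lifts (ContinuousMap.id X) x₀
    (⟨x₀, (0 : A)⟩ : Z.TotalSpace) rfl
  have hG1 : ∀ x, (G x).1 = x := fun x => congrFun hG x
  let s : X → A := fun x => (G x).2
  refine ⟨fun x => τ x x + s x, fun x => ?_⟩
  -- in the trivialization over `U x` the section is locally constant
  have hc : ContinuousAt (fun y => (Z.localTriv x (G y)).2) x := by
    refine continuous_snd.continuousAt.comp (ContinuousAt.comp (f := G) ?_ G.continuous.continuousAt)
    refine (Z.localTriv x).continuousAt ?_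
    rw [FiberBundleCore.mem_localTriv_source, hG1]
    exact hmem x
  have hev : ∀ᶠ y in 𝓝 x, (Z.localTriv x (G y)).2 = (Z.localTriv x (G x)).2 := by
    have h := hc.tendsto
    rw [congrFun (nhds_discrete A) _, tendsto_pure] at h
    exact h
  refine ⟨(Z.localTriv x (G x)).2, ?_⟩
  filter_upwards [hev] with y hy
  have h1 : (Z.localTriv x (G y)).2 = s y + (τ (G y).1 (G y).1 - τ x (G y).1) := rfl
  rw [← hy, h1, hG1]
  abel

end Gluing

section Potential

variable {𝕜 : Type*} [RCLike 𝕜] {n : ℕ} {M : Type*} [TopologicalSpace M]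
  [ChartedSpace (Fin n → 𝕜) M]

/-- Functions with the same differential differ by a locally constant function. -/
theorem eventually_sub_eq_of_dif_eq [IsManifold 𝓘(𝕜, Fin n → 𝕜) ∞ M] {f g : M → 𝕜} {x : M}
    (hf : ∀ᶠ y in 𝓝 x, MDifferentiableAt 𝓘(𝕜, Fin n → 𝕜) 𝓘(𝕜, 𝕜) f y)
    (hg : ∀ᶠ y in 𝓝 x, MDifferentiableAt 𝓘(𝕜, Fin n → 𝕜) 𝓘(𝕜, 𝕜) g y)
    (h : ∀ᶠ y in 𝓝 x, (dif f y : Cotan 𝕜 n y) = dif g y) : ∀ᶠ y in 𝓝 x, f y - g y = f x - g x := by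
  set φ : CoordChart 𝕜 n M := chartAt (Fin n → 𝕜) x with hφdef
  have hφ : IsCoordinatePatch φ := IsManifold.chart_mem_maximalAtlas x
  have hxs : x ∈ φ.source := mem_chart_source _ x
  have hsymm : Tendsto φ.symm (𝓝 (φ x)) (𝓝 x) := φ.tendsto_symm hxs
  obtain ⟨r, hr, hball⟩ := Metric.eventually_nhds_iff_ball.1
    (((hsymm.eventually hf).and ((hsymm.eventually hg).and (hsymm.eventually h))).and
      (φ.open_target.mem_nhds (φ.map_source hxs)))
  have hdiff : ∀ {k : M → 𝕜} {y : Fin n → 𝕜}, y ∈ φ.target →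
      MDifferentiableAt 𝓘(𝕜, Fin n → 𝕜) 𝓘(𝕜, 𝕜) k (φ.symm y) →
      DifferentiableAt 𝕜 (k ∘ φ.symm) y := fun hy hk =>
    (hk.comp _ (hφ.mdifferentiable.mdifferentiableAt_symm hy)).differentiableAt
  have hconst : ∀ y ∈ Metric.ball (φ x) r, (f ∘ φ.symm - g ∘ φ.symm) y
      = (f ∘ φ.symm - g ∘ φ.symm) (φ x) := fun y hy =>
    (convex_ball (φ x) r).is_const_of_fderivWithin_eq_zero (𝕜 := 𝕜)
      (fun w hw => ((hdiff (hball w hw).2 (hball w hw).1.1).sub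
        (hdiff (hball w hw).2 (hball w hw).1.2.1)).differentiableWithinAt)
      (fun w hw => by
        rw [fderivWithin_of_isOpen Metric.isOpen_ball hw,
          fderiv_sub (hdiff (hball w hw).2 (hball w hw).1.1)
            (hdiff (hball w hw).2 (hball w hw).1.2.1)]
        ext1 v
        rw [sub_apply, ← dif_apply_toTan hφ (hball w hw).2 (hball w hw).1.1,
          ← dif_apply_toTan hφ (hball w hw).2 (hball w hw).1.2.1, (hball w hw).1.2.2, sub_self]
        rfl) hy (Metric.mem_ball_self hr)
  filter_upwards [φ.open_source.mem_nhds hxs,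
    (φ.continuousAt hxs).eventually (Metric.ball_mem_nhds _ hr)] with y hy hyb
  simpa [φ.left_inv hy, φ.left_inv hxs] using hconst _ hyb

variable (F : FrobeniusManifold 𝕜 n M) {φ : CoordChart 𝕜 n M}

namespace FrobeniusManifold

/-- The function `<e, t>` of flat coordinates `t`. -/
def flatPotential (φ : CoordChart 𝕜 n M) (x : M) : 𝕜 :=
  F.ηLoc φ (φ x) (vecLoc φ F.unit (φ x)) (φ x)

theorem contMDiffOn_flatPotential (hφ : IsCoordinatePatch φ) :
    ContMDiffOn 𝓘(𝕜, Fin n → 𝕜) 𝓘(𝕜, 𝕜) ∞ (F.flatPotential φ) φ.source := by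
  have h : ContDiffOn 𝕜 ∞ (fun z => F.ηLoc φ z (vecLoc φ F.unit z) z) φ.target :=
    ((F.contDiffOn_ηLoc hφ).clm_apply (F.contDiffOn_vecLoc_unit hφ)).clm_apply contDiffOn_id
  exact h.contMDiffOn.comp (contMDiffOn_of_mem_maximalAtlas hφ) fun x hx => φ.map_source hx

theorem dif_flatPotential (hφ : F.IsFlatChart φ) {x : M} (hx : x ∈ φ.source) :
    dif (F.flatPotential φ) x = F.η x (F.unit x) := by
  obtain ⟨y, hy, rfl⟩ : ∃ y ∈ φ.target, φ.symm y = x := ⟨φ x, φ.map_source hx, φ.left_inv hx⟩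
  have hm : MDifferentiableAt 𝓘(𝕜, Fin n → 𝕜) 𝓘(𝕜, 𝕜) (F.flatPotential φ) (φ.symm y) :=
    (F.contMDiffOn_flatPotential hφ.1).mdifferentiableOn (by simp) _ hx |>.mdifferentiableAt
      (φ.open_source.mem_nhds hx)
  have he : F.flatPotential φ ∘ φ.symm
      =ᶠ[𝓝 y] fun z => F.ηLoc φ z (vecLoc φ F.unit z) (id z) := by
    filter_upwards [φ.open_target.mem_nhds hy] with z hz
    simp [flatPotential, φ.right_inv hz]
  ext v
  rw [← toTan_ofTan hφ.1 hy v, dif_apply_toTan hφ.1 hy hm, he.fderiv_eq,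
    fderiv_clm_apply₂ (F.differentiableAt_ηLoc hφ.1 hy) (F.differentiableAt_unit hφ.1 hy)
      differentiableAt_id, F.fderiv_ηLoc_flat hφ hy, F.fderiv_unit_flat hφ hy]
  simp only [zero_apply, map_zero, zero_add, fderiv_id, ContinuousLinearMap.id_apply]
  rw [ηLoc_apply, toTan_vecLoc hφ.1 hy]

variable [IsManifold 𝓘(𝕜, Fin n → 𝕜) ∞ M]

/-- On a simply connected Frobenius manifold the closed form `<e, ·>` is exact. -/
theorem exists_dif_eq_unit [SimplyConnectedSpace M] :
    ∃ τ : M → 𝕜, ContMDiff 𝓘(𝕜, Fin n → 𝕜) 𝓘(𝕜, 𝕜) ∞ τ ∧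
      ∀ x, dif τ x = F.η x (F.unit x) := by
  have : LocallyPathConnectedSpace M := ChartedSpace.locallyPathConnectedSpace (Fin n → 𝕜) M
  choose φ hφ hx using F.flat
  have hsm : ∀ i, ∀ x ∈ (φ i).source,
      ContMDiffAt 𝓘(𝕜, Fin n → 𝕜) 𝓘(𝕜, 𝕜) ∞ (F.flatPotential (φ i)) x := fun i x hxi =>
    (F.contMDiffOn_flatPotential (hφ i).1).contMDiffAt ((φ i).open_source.mem_nhds hxi)
  have hmd : ∀ i, ∀ x ∈ (φ i).source,
      ∀ᶠ y in 𝓝 x, MDifferentiableAt 𝓘(𝕜, Fin n → 𝕜) 𝓘(𝕜, 𝕜) (F.flatPotential (φ i)) y :=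
    fun i x hxi => by
      filter_upwards [(φ i).open_source.mem_nhds hxi] with y hy
      exact (hsm i y hy).mdifferentiableAt (by simp)
  obtain ⟨τ, hτ⟩ := exists_function_eventuallyEq_add_const (U := fun i => (φ i).source)
    (τ := fun i => F.flatPotential (φ i)) (fun i => (φ i).open_source) hx
    fun i j x hxij => eventually_sub_eq_of_dif_eq (hmd i x hxij.1) (hmd j x hxij.2) (by
      filter_upwards [(φ i).open_source.mem_nhds hxij.1,
        (φ j).open_source.mem_nhds hxij.2] with y hyi hyj
      rw [F.dif_flatPotential (hφ i) hyi, F.dif_flatPotential (hφ j) hyj])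
  refine ⟨τ, fun x => ?_, fun x => ?_⟩
  · obtain ⟨c, hc⟩ := hτ x
    exact ((hsm x x (hx x)).add contMDiffAt_const).congr_of_eventuallyEq hc
  · obtain ⟨c, hc⟩ := hτ x
    have h1 : HasMFDerivAt 𝓘(𝕜, Fin n → 𝕜) 𝓘(𝕜, 𝕜) (fun y => F.flatPotential (φ x) y + c) x
        (mfderiv 𝓘(𝕜, Fin n → 𝕜) 𝓘(𝕜, 𝕜) (F.flatPotential (φ x)) x) := by
      have := ((hsm x x (hx x)).mdifferentiableAt (by simp)).hasMFDerivAt.add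
        (hasMFDerivAt_const c x)
      exact this.congr_mfderiv
        (add_zero (mfderiv 𝓘(𝕜, Fin n → 𝕜) 𝓘(𝕜, 𝕜) (F.flatPotential (φ x)) x))
    rw [← F.dif_flatPotential (hφ x) (hx x), dif, dif, Filter.EventuallyEq.mfderiv_eq hc, h1.mfderiv]

end FrobeniusManifold
end Potential

section NormalizedCharts

variable {𝕜 : Type*} [RCLike 𝕜] {n : ℕ} {M : Type*} [TopologicalSpace M]
  [ChartedSpace (Fin n → 𝕜) M] (F : FrobeniusManifold 𝕜 n M) {φ : CoordChart 𝕜 n M}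

namespace FrobeniusManifold

theorem flatPotential_eq_sum {o : Fin n} (hφ : F.IsNormalizedFlatChart φ o) {x : M}
    (hx : x ∈ φ.source) :
    F.flatPotential φ x = ∑ α, F.ηComp φ (φ x) o α * φ x α := by
  have hy := φ.map_source hx
  have he : vecLoc φ F.unit (φ x) = stdVec 𝕜 o := by
    rw [← ofTan_eq_vecLoc hφ.1.1 hy, hφ.2 _ hy, frame_eq_toTan, ofTan_toTan hφ.1.1 hy]
  have h := map_eq_sum_stdVec (F.ηLoc φ (φ x) (stdVec 𝕜 o)).toLinearMap (φ x)
  simp only [ContinuousLinearMap.coe_coe] at h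
  rw [flatPotential, he, h]
  exact Finset.sum_congr rfl fun α _ => _root_.mul_comm _ _

variable [IsManifold 𝓘(𝕜, Fin n → 𝕜) ∞ M]

theorem isQuasihomogeneousWith_normalized {o : Fin n} (hφ : F.IsNormalizedFlatChart φ o) :
    IsQuasihomogeneousWith φ.source F.intersectionForm F.cotMetric F.d
      (fun x => ∑ α, F.ηComp φ (φ x) o α * φ x α) F.euler F.unit := by
  have heq : ∀ x ∈ φ.source, ∑ α, F.ηComp φ (φ x) o α * φ x α = F.flatPotential φ x :=
    fun x hx => (F.flatPotential_eq_sum hφ hx).symm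
  refine F.isQuasihomogeneousWith ((F.contMDiffOn_flatPotential hφ.1.1).congr heq) fun x hx => ?_
  rw [← F.dif_flatPotential hφ.1 hx, dif, dif, Filter.EventuallyEq.mfderiv_eq
    (Filter.eventuallyEq_of_mem (φ.open_source.mem_nhds hx) heq)]

/-- Flat coordinates can be changed linearly so that a given coordinate field becomes the unity. -/
theorem exists_isNormalizedFlatChart (o : Fin n) (x : M) :
    ∃ φ, F.IsNormalizedFlatChart φ o ∧ x ∈ φ.source := by
  obtain ⟨ψ, hψ, hx⟩ := F.flat x
  have hy := ψ.map_source hx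
  obtain ⟨r, hr, hball⟩ := Metric.isOpen_iff.1 ψ.open_target _ hy
  set e := vecLoc ψ F.unit (ψ x) with he
  have ho : stdVec 𝕜 o ≠ 0 := by simp
  have he0 : e ≠ 0 := fun h0 => ho (by
    have h := F.unit_mulLoc hψ.1 hy (stdVec 𝕜 o)
    rw [← he, h0, map_zero, zero_apply] at h
    exact h.symm)
  obtain ⟨A, hA⟩ := SeparatingDual.exists_continuousLinearEquiv_apply_eq (R := 𝕜) he0 ho
  have hAo : A.symm (stdVec 𝕜 o) = e := by rw [← hA, A.symm_apply_apply]
  set φ : CoordChart 𝕜 n M := (ψ.trans (OpenPartialHomeomorph.ofSet (Metric.ball (ψ x) r)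
    Metric.isOpen_ball)).transHomeomorph A.toHomeomorph with hφdef
  have hφs : φ.source = ψ.source ∩ ψ ⁻¹' Metric.ball (ψ x) r := by simp [φ]
  have hφt : ∀ {z}, z ∈ φ.target → A.symm z ∈ Metric.ball (ψ x) r := by
    intro z hz
    simp [φ] at hz
    simpa using hz.1
  have hsymm : ∀ z, φ.symm z = ψ.symm (A.symm z) := fun z => rfl
  have hcoe : ∀ z, φ z = A (ψ z) := fun z => rfl
  have hpatch : IsCoordinatePatch φ := by
    refine OpenPartialHomeomorph.mem_maximalAtlas_of_contMDiffOn φ ?_ ?_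
    · have h1 : ContMDiffOn 𝓘(𝕜, Fin n → 𝕜) 𝓘(𝕜, Fin n → 𝕜) ∞ (fun z => A (ψ z)) ψ.source :=
        (A.contDiff.contMDiff.comp_contMDiffOn (contMDiffOn_of_mem_maximalAtlas hψ.1))
      exact h1.mono (by rw [hφs]; exact inter_subset_left)
    · have h1 : ContMDiffOn 𝓘(𝕜, Fin n → 𝕜) 𝓘(𝕜, Fin n → 𝕜) ∞ (fun z => ψ.symm (A.symm z))
          φ.target :=
        (contMDiffOn_symm_of_mem_maximalAtlas hψ.1).comp A.symm.contDiff.contMDiff.contMDiffOn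
          fun z hz => hball (hφt hz)
      exact h1
  have hframe : ∀ {z}, z ∈ φ.target → ∀ v, toTan φ z v = toTan ψ (A.symm z) (A.symm v) := by
    intro z hz v
    have h1 := (hψ.1.mdifferentiable.mdifferentiableAt_symm (hball (hφt hz))).hasMFDerivAt
    have h2 : HasMFDerivAt 𝓘(𝕜, Fin n → 𝕜) 𝓘(𝕜, Fin n → 𝕜) A.symm z
      (A.symm : (Fin n → 𝕜) →L[𝕜] (Fin n → 𝕜)) := A.symm.hasFDerivAt.hasMFDerivAt
    have h3 := (h1.comp z h2).mfderiv
    exact DFunLike.congr_fun h3 v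
  have hη : ∀ z ∈ φ.target, ∀ i j, F.ηComp φ z i j
      = F.ηLoc ψ (ψ x) (A.symm (stdVec 𝕜 i)) (A.symm (stdVec 𝕜 j)) := by
    intro z hz i j
    have h1 : F.ηComp φ z i j = F.η (ψ.symm (A.symm z)) (toTan φ z (stdVec 𝕜 i))
      (toTan φ z (stdVec 𝕜 j)) := rfl
    rw [h1, hframe hz, hframe hz, ← F.ηLoc_const hψ hy (hball (hφt hz))]
    rfl
  refine ⟨φ, ⟨⟨hpatch, fun z hz z' hz' => ?_⟩, fun z hz => ?_⟩, ?_⟩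
  · ext i j
    rw [hη z hz, hη z' hz']
  · have h1 := F.vecLoc_unit_eq_of_mem_ball hψ hball (hφt hz)
    have h2 := toTan_vecLoc hψ.1 (hball (hφt hz)) F.unit
    rw [h1, ← he, ← hAo] at h2
    rw [frame_eq_toTan]
    exact h2.symm.trans (hframe hz _).symm
  · rw [hφs]
    exact ⟨hx, Metric.mem_ball_self hr⟩

end FrobeniusManifold
end NormalizedCharts

end

theorem theorem1p1 {𝕜 : Type*} [RCLike 𝕜] {n : ℕ} {M : Type*} [TopologicalSpace M]
    [ChartedSpace (Fin n → 𝕜) M] [IsManifold 𝓘(𝕜, Fin n → 𝕜) ∞ M]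
    (F : FrobeniusManifold 𝕜 n M) :
    -- the two metrics form a flat pencil
    IsFlatPencil F.intersectionForm F.cotMetric ∧
    -- in flat coordinates, for every `lam`, the contravariant Levi-Civita connection of the metric
    -- `(,) - lam <,>` is `Γ^{αβ}_γ = c^{αε}_γ R^β_ε`
    (∀ (lam : 𝕜) (Γ : ContraConnection 𝕜 n M),
      IsContravariantLeviCivita (pencil F.intersectionForm F.cotMetric lam) Γ →
      ∀ φ, F.IsFlatChart φ → ∀ y ∈ φ.target, ∀ α β γ,
        Γ φ γ α β y = ∑ ε, F.cUp φ α ε γ y * F.R φ β ε y) ∧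
    -- flat coordinates with `e = ∂/∂t^o` exist around every point, and `τ = η_{oα} t^α` makes the
    -- pencil quasihomogeneous of degree `d` on their domain
    (∀ o : Fin n, ∀ x : M, ∃ φ, F.IsNormalizedFlatChart φ o ∧ x ∈ φ.source) ∧
    (∀ (o : Fin n) (φ : CoordChart 𝕜 n M), F.IsNormalizedFlatChart φ o →
      IsQuasihomogeneousWith φ.source F.intersectionForm F.cotMetric F.d
        (fun x => ∑ α, F.ηComp φ (φ x) o α * φ x α) F.euler F.unit) ∧
    -- globally: every smooth `τ` with `dτ = <e, ·>` works on `M`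
    (∀ τ : M → 𝕜, ContMDiff 𝓘(𝕜, Fin n → 𝕜) 𝓘(𝕜, 𝕜) ∞ τ →
      (∀ x, dif τ x = F.η x (F.unit x)) →
      IsQuasihomogeneousWith Set.univ F.intersectionForm F.cotMetric F.d τ F.euler F.unit) ∧
    -- and such a `τ` exists if `M` is simply connected
    (SimplyConnectedSpace M → ∃ τ : M → 𝕜,
      IsQuasihomogeneousWith Set.univ F.intersectionForm F.cotMetric F.d τ F.euler F.unit) := by
  refine ⟨F.isFlatPencil, fun lam Γ hΓ φ hφ y hy α β γ => F.leviCivita_flatChart hΓ hφ hy α β γ,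
    F.exists_isNormalizedFlatChart, fun o φ hφ => F.isQuasihomogeneousWith_normalized hφ,
    fun τ hτ hd => F.isQuasihomogeneousWith hτ.contMDiffOn fun x _ => hd x, fun _ => ?_⟩
  obtain ⟨τ, hτ, hd⟩ := F.exists_dif_eq_unit
  exact ⟨τ, F.isQuasihomogeneousWith hτ.contMDiffOn fun x _ => hd x⟩
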